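/- For $k:\mathbb{N}\to\mathbb{N}$, a $k(n)$-prover Arthur–Merlin protocol is given by functions $q,a,r:\mathbb{N}\to\mathbb{N}$ and a deterministic polynomial-time verification procedure $V$ as follows. On an input $x\in\{0,1\}^n$, Arthur draws independent uniform questions $y_1,\dots,y_{k(n)}\in\{0,1\}^{q(n)}$ and an independent uniform auxiliary random string $w\in\{0,1\}^{r(n)}$; the $i$-th Merlin, seeing only $y_i$ (and $x$), answers $b_i(y_i)\in\{0,1\}^{a(n)}$; and Arthur accepts iff $V(x,y_1,\dots,y_{k(n)},b_1(y_1),\dots,b_{k(n)}(y_{k(n)}),w)=1$. Since Arthur runs in polynomial time, each of the maps $1^n\mapsto 1^{k(n)},1^{q(n)},1^{a(n)},1^{r(n)}$ is required to be computable in polynomial time (in particular $k,q,a,r$ are polynomially bounded; every polynomial satisfies this requirement). The protocol decides a language $L\subseteq\{0,1\}^*$ if for every $x\in L$ there are functions $b_1,\dots,b_{k(n)}:\{0,1\}^{q(n)}\to\{0,1\}^{a(n)}$ for which Arthur accepts with probability at least $2/3$, while for every $x\notin L$ and all such functions Arthur accepts with probability at most $1/3$. Let $\mathsf{AM}(k)$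 be the class of languages decided by some such protocol, and let $\mathsf{EXP}$ be the class of languages decidable by a deterministic Turing machine in time $2^{\mathrm{poly}(n)}$. Then: (1) $\mathsf{AM}(k)\subseteq\mathsf{EXP}$ for every $k$, in particular for every polynomial $k=k(n)$ (and for $k=2$). (2) There is an absolute constant $C$ such that, whenever $L$ is decided by a protocol with $k=2$ in which every message has at most $p(n)$ bits (that is, $q(n)\le p(n)$ and $a(n)\le p(n)$ for all $n$) and which uses $r(n)$ auxiliary random bits, there is a polynomial $s$ such that $L$ is decidable by a deterministic Turing machine in time $2^{C\,p(n)^2+r(n)}\,s(n)$, and also by a probabilistic Turing machine that on every input of length $n$ always halts within $2^{C\,p(n)^2}\,s(n)$ steps and answers correctly with probability at least $2/3$. -/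

import Mathlib

/-- `{0,1}^m`. -/
abbrev Bits (m : ℕ) : Type := Fin m → Bool

/-! ### Time-bounded computation, over Mathlib's multi-stack Turing machines -/

open Classical in
/-- Languages decided by a deterministic Turing machine that halts, on every input of length `n`,
within `T n` steps. -/
def DTIME (T : ℕ → ℕ) : Set (Language Bool) :=
  {L | ∃ M : Turing.TM2ComputableInTime (fun x : List Bool => x) Computability.encodeBool
      (fun x : List Bool => decide (x ∈ L)), ∀ n, M.time n ≤ T n}

/-- `EXP`: languages decidable in deterministic time `2^{poly(n)}`. -/
def EXP : Set (Language Bool) :=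
  {L | ∃ s : Polynomial ℕ, L ∈ DTIME (fun n => 2 ^ s.eval n)}

/-- A probabilistic Turing machine, with input and output alphabet `{0,1}`: a Turing machine with
two programs (transition functions). At every step a fair coin decides which of them is applied. -/
structure ProbTM extends Turing.TM2ComputableAux Bool Bool where
  /-- the second program -/
  m' : tm.Λ → Turing.TM2.Stmt tm.Γ tm.Λ tm.σ

namespace ProbTM

variable (M : ProbTM)

/-- One step under the coin `c`; a halted configuration is left unchanged. -/
def coinStep (cfg : M.tm.Cfg) (c : Bool) : M.tm.Cfg :=
  letI := M.tm.kDecidableEq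
  (Turing.TM2.step (bif c then M.m' else M.tm.m) cfg).getD cfg

/-- The configuration reached from the input `x` after the coin tosses `c`. -/
def run (x : List Bool) {t : ℕ} (c : Bits t) : M.tm.Cfg :=
  (List.ofFn c).foldl M.coinStep (Turing.initList M.tm (x.map M.inputAlphabet.invFun))

/-- After the coin tosses `c`, the machine has halted on the input `x` with the answer `o`. -/
def HaltsWith (x : List Bool) {t : ℕ} (c : Bits t) (o : Bool) : Prop :=
  M.run x c = Turing.haltList M.tm
    ((Computability.encodeBool o).map M.outputAlphabet.invFun)

end ProbTM

open Classical in
/-- Languages decided by a probabilistic Turing machine that halts, on every input of length `n` and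
for every outcome of the coin tosses, with an answer within `T n` steps, the answer being correct
with probability at least `2/3`. -/
noncomputable def BPTIME (T : ℕ → ℕ) : Set (Language Bool) :=
  {L | ∃ M : ProbTM, ∀ x : List Bool,
    (∀ c : Bits (T x.length), ∃ o : Bool, M.HaltsWith x c o) ∧
    (2 / 3 : ℚ) ≤
      ((Finset.univ.filter fun c : Bits (T x.length) => M.HaltsWith x c (decide (x ∈ L))).card : ℚ)
        / Fintype.card (Bits (T x.length))}

/-- `1^n ↦ 1^{f(n)}` is computable in polynomial time (so `f` is polynomially bounded). -/
def PolyTimeConstructible (f : ℕ → ℕ) : Prop :=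
  Nonempty (Turing.TM2ComputableInPolyTime
    Computability.unaryEncodeNat Computability.unaryEncodeNat f)

/-! ### Arthur–Merlin protocols with `k(n)` Merlins -/

/-- What Arthur's verification procedure looks at, on an input `x` of length `n`: the input, his
questions `y i` to the `k n` Merlins (`q n` bits each), the Merlins' answers `b i` (`a n` bits
each), and his `r n` auxiliary random bits `w`. -/
structure Transcript (k q a r : ℕ → ℕ) where
  x : List Bool
  y : Fin (k x.length) → Bits (q x.length)
  b : Fin (k x.length) → Bits (a x.length)
  w : Bits (r x.length)

/-- `x # y_1 # ⋯ # y_k # b_1 # ⋯ # b_k # w #`, with `none` as the separator `#`. -/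
def Transcript.encode {k q a r : ℕ → ℕ} (t : Transcript k q a r) : List (Option Bool) :=
  (t.x :: ((List.ofFn fun i => List.ofFn (t.y i)) ++ (List.ofFn fun i => List.ofFn (t.b i)) ++
    [List.ofFn t.w])).flatMap fun s => s.map some ++ [none]

/-- A one-round protocol between a probabilistic polynomial-time Arthur and `k n` Merlins. Arthur
can compute in polynomial time how many Merlins there are, how long the messages are, and
how many auxiliary random bits he needs; when these numbers are polynomials in `n`, that is no
restriction. -/
structure AMProtocol (k : ℕ → ℕ) where
  /-- length of a question -/
  q : ℕ → ℕ
  /-- length of an answer -/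
  a : ℕ → ℕ
  /-- number of auxiliary random bits -/
  r : ℕ → ℕ
  /-- the verification procedure -/
  V : Transcript k q a r → Bool
  k_constructible : PolyTimeConstructible k
  q_constructible : PolyTimeConstructible q
  a_constructible : PolyTimeConstructible a
  r_constructible : PolyTimeConstructible r
  V_polyTime : Nonempty (Turing.TM2ComputableInPolyTime
    Transcript.encode Computability.encodeBool V)

namespace AMProtocol

variable {k : ℕ → ℕ} (P : AMProtocol k)

/-- Strategies `b_1, …, b_k` of the Merlins on an input of length `n`: each Merlin's answer is a
function of his own question. -/
abbrev Strategies (n : ℕ) : Type := Fin (k n) → Bits (P.q n) → Bits (P.a n)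

/-- The probability, over independent uniform questions and auxiliary random bits, that Arthur
accepts `x` when the Merlins play `β`. -/
def acceptProb (x : List Bool) (β : P.Strategies x.length) : ℚ :=
  ((Finset.univ.filter fun yw : (Fin (k x.length) → Bits (P.q x.length)) × Bits (P.r x.length) =>
      P.V ⟨x, yw.1, fun i => β i (yw.1 i), yw.2⟩ = true).card : ℚ)
    / Fintype.card ((Fin (k x.length) → Bits (P.q x.length)) × Bits (P.r x.length))

/-- Completeness `2/3` and soundness `1/3` for the language `L`. -/
def Decides (L : Language Bool) : Prop :=
  ∀ x : List Bool,
    (x ∈ L → ∃ β : P.Strategies x.length, 2 / 3 ≤ P.acceptProb x β) ∧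
    (x ∉ L → ∀ β : P.Strategies x.length, P.acceptProb x β ≤ 1 / 3)

end AMProtocol

/-- The class `AM(k)`. -/
def AM (k : ℕ → ℕ) : Set (Language Bool) := {L | ∃ P : AMProtocol k, P.Decides L}

/-! On an input of length n a tuple of strategies is a table of size k·a·2^q, so trying all of them
takes doubly exponential time. The search runs instead over short descriptions of strategies, called
advice. For each Merlin the advice lists m = 5000(a+1)k² situations, each consisting of questions
and answers of all Merlins. Merlin c answers a question η by the α that maximises the number of
acceptances over his listed situations, once his own question and answer there are overwritten by η
and α (`localScore`). There are 2^(k·m·k(q+a)) pieces of advice. The exponent is polynomial for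
every admissible k, and O(p²) when k = 2.

Soundness is immediate: each piece of advice describes genuine strategies, so none of them does
better than the Merlins can (`not_found`). Completeness is a hybrid argument (`exists_good_hybrid`).
Starting from good strategies, the Merlins are switched one at a time to answers computed from
advice. The situations for the next Merlin are sampled questions together with the answers of the
current hybrid. An exponential-moment bound with a term log |A| for the choice among the answers
(`expect_sum_select_le`) shows that best answers on a random sample are nearly best on average
(`exists_sample`). Only the average over η matters, so one sample serves all questions η and m does
not depend on q. Each switch costs at most 1/(24k), hence 1/24 in all, and an acceptance rate of
7/12 stays above the threshold 1/2.

The machine does not maximise for each Merlin separately. For given advice and questions it takes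
the first answer tuple of maximal total score. The score is a sum of terms each depending on the
question and answer of one Merlin, and the number that codes an answer tuple is a similar sum. The
lexicographic optimum is therefore attained coordinate by coordinate (`IsBest.apply`), and each
Merlin's answer depends on his own question only (`exists_choice`).

Acceptance rates are measured over a list ω of auxiliary random strings. The deterministic machine
lists all 2^r strings. The probabilistic one draws 2048·2^q·2^a of them. When x ∉ L, a union bound
over all pairs of strategies keeps every empirical rate below 1/2; when x ∈ L, a single good pair
has to keep rate 7/12 (`card_good_le`, `three_mul_card_le`). This removes the factor 2^r.

The rest realises the search on multi-stack Turing machines, by programs that come with a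
specification of their effect on the stacks and a bound for their time. Apart from the step that
draws random bits, the number of steps is independent of the coins, so the random bits come from
known positions of the coin sequence. -/

section

open Turing Turing.TM2

set_option linter.unusedSectionVars false
set_option linter.unusedSimpArgs false

/-! ### Programs with stack variables and subroutines -/

/-- Tape symbols: `none` is a separator, `some (m, b)` a bit `b` carrying a mark `m`. -/
abbrev Symb : Type := Option (Bool × Bool)

/-- A machine that is used as a subroutine, with translations to and from tape symbols. -/
structure SubMachine where
  tm : FinTM2
  enc : Symb → tm.Γ tm.k₀
  dec : tm.Γ tm.k₁ → Symb

instance (tm : FinTM2) : Fintype tm.K := tm.kFin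
instance (tm : FinTM2) : Fintype tm.Λ := tm.ΛFin
instance (tm : FinTM2) : Fintype tm.σ := tm.σFin

/-- Stacks: one stack for input and output, one for each variable, and those of the subroutines. -/
abbrev Key (V : Type) {ι : Type} (S : ι → SubMachine) : Type :=
  Option (V ⊕ (Σ i, (S i).tm.K))

/-- The alphabets of the stacks. -/
abbrev keyAlphabet (V : Type) {ι : Type} (S : ι → SubMachine) : Key V S → Type
  | none => Bool
  | some (Sum.inl _) => Symb
  | some (Sum.inr p) => (S p.1).tm.Γ p.2

/-- Internal states: a register holding the last symbol, and the states of the subroutines. -/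
abbrev Reg {ι : Type} (S : ι → SubMachine) : Type :=
  Option Symb × (∀ i, (S i).tm.σ)

/-- A program over the variables `V` with subroutines `S`; it may toss a coin at each step. The
program exits by halting. -/
structure Mac (V : Type) {ι : Type} (S : ι → SubMachine) where
  Λ : Type
  fin : Fintype Λ
  entry : Λ
  m : Bool → Λ → Stmt (keyAlphabet V S) Λ (Reg S)

/-- Rename labels, and continue at `h` instead of halting. -/
def relabel {K Λ Λ' σ : Type} {Γ : K → Type} (f : Λ → Λ') (h : Option Λ') :
    Stmt Γ Λ σ → Stmt Γ Λ' σ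
  | .push k g q => .push k g (relabel f h q)
  | .peek k g q => .peek k g (relabel f h q)
  | .pop k g q => .pop k g (relabel f h q)
  | .load g q => .load g (relabel f h q)
  | .branch g q₁ q₂ => .branch g (relabel f h q₁) (relabel f h q₂)
  | .goto g => .goto fun s => f (g s)
  | .halt => h.elim .halt fun l => .goto fun _ => l

/-- The configuration of the host program for a configuration of a relabelled program. -/
def liftCfg {K Λ Λ' σ : Type} {Γ : K → Type} (f : Λ → Λ') (h : Option Λ') (c : Cfg Γ Λ σ) :
    Cfg Γ Λ' σ := ⟨c.l.elim h fun l => some (f l), c.var, c.stk⟩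

theorem stepAux_relabel {K Λ Λ' σ : Type} {Γ : K → Type} [DecidableEq K] (f : Λ → Λ')
    (h : Option Λ') (q : Stmt Γ Λ σ) (v : σ) (T : ∀ k, List (Γ k)) :
    stepAux (relabel f h q) v T = liftCfg f h (stepAux q v T) := by
  induction q generalizing v T with
  | branch g q₁ q₂ h₁ h₂ => cases hg : g v <;> simp [relabel, hg, h₁, h₂]
  | halt => cases h <;> simp [relabel, liftCfg]
  | _ => simp_all [relabel, liftCfg]


/-! ### Runs of programs, sequential composition and loops -/

section Programs

variable {V : Type} [DecidableEq V] {ι : Type} [DecidableEq ι] {S : ι → SubMachine}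

/-- Configurations of a program with labels `Λ`. -/
abbrev MCfg (V : Type) {ι : Type} (S : ι → SubMachine) (Λ : Type) : Type :=
  Cfg (keyAlphabet V S) Λ (Reg S)

namespace Mac

/-- One step under the coin `c`. -/
def step (P : Mac V S) (c : Bool) : MCfg V S P.Λ → MCfg V S P.Λ
  | ⟨none, v, T⟩ => ⟨none, v, T⟩
  | ⟨some l, v, T⟩ => stepAux (P.m c l) v T

/-- The coins `cs` lead from one configuration to another, without halting before the end. -/
def ReachC (P : Mac V S) : List Bool → MCfg V S P.Λ → MCfg V S P.Λ → Prop
  | [], a, b => a = b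
  | c :: cs, a, b => a.l ≠ none ∧ P.ReachC cs (P.step c a) b

theorem ReachC.trans {P : Mac V S} {cs ds : List Bool} {a b d : MCfg V S P.Λ}
    (h₁ : P.ReachC cs a b) (h₂ : P.ReachC ds b d) : P.ReachC (cs ++ ds) a d := by
  induction cs generalizing a with
  | nil => cases h₁; exact h₂
  | cons c cs ih => exact ⟨h₁.1, ih h₁.2⟩

/-- `ReachC` forbids halting before the last coin. The only halted configuration on the way can thus
be the final one, and there the relabelled program has jumped to `h` in the same step. -/
theorem ReachC.lift {P Q : Mac V S} {f : P.Λ → Q.Λ} {h : Option Q.Λ}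
    (hm : ∀ c l, Q.m c (f l) = relabel f h (P.m c l)) {cs : List Bool} {a b : MCfg V S P.Λ}
    (hr : P.ReachC cs a b) : Q.ReachC cs (liftCfg f h a) (liftCfg f h b) := by
  induction cs generalizing a with
  | nil => cases hr; rfl
  | cons c cs ih =>
    obtain ⟨_ | l, v, T⟩ := a
    · exact absurd rfl hr.1
    · refine ⟨by simp [liftCfg], ?_⟩
      have := ih hr.2
      simpa [Mac.step, liftCfg, hm, stepAux_relabel] using this

end Mac

/-- The stacks when the subroutines are idle. -/
def stk (io : List Bool) (v : V → List Symb) : ∀ k : Key V S, List (keyAlphabet V S k)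
  | none => io
  | some (Sum.inl A) => v A
  | some (Sum.inr _) => []

@[simp] theorem update_stk_var (io : List Bool) (v : V → List Symb) (A : V) (l : List Symb) :
    Function.update (stk (S := S) io v) (some (Sum.inl A)) l = stk io (Function.update v A l) := by
  funext k
  rcases k with _ | B | p
  · simp [stk]
  · by_cases h : B = A
    · subst h; simp [stk]
    · simp [stk, h]
  · simp [stk]

@[simp] theorem update_stk_io (io io' : List Bool) (v : V → List Symb) :
    Function.update (stk (S := S) io v) none io' = stk io' v := by
  funext k
  rcases k with _ | B | p <;> simp [stk]

@[simp] theorem stk_var (io : List Bool) (v : V → List Symb) (A : V) :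
    stk (S := S) io v (some (Sum.inl A)) = v A := rfl

@[simp] theorem stk_io (io : List Bool) (v : V → List Symb) :
    stk (S := S) io v none = io := rfl

/-- The configuration at label `l` with register `g` and idle subroutines. -/
def cfg {Λ : Type} (l : Option Λ) (g : Option Symb) (io : List Bool) (v : V → List Symb) :
    MCfg V S Λ := ⟨l, (g, fun i => (S i).tm.initialState), stk io v⟩

namespace Mac

/-- Under the coins `cs` the program transforms the contents of the stacks as given. -/
def RunsC (P : Mac V S) (cs : List Bool) (io : List Bool) (v : V → List Symb) (io' : List Bool)
    (v' : V → List Symb) : Prop :=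
  ∀ g, ∃ g', P.ReachC cs (cfg (some P.entry) g io v) (cfg none g' io' v')

/-- Within `n` steps, and in a number of steps that does not depend on the coins, the program
transforms the contents of the stacks as given. -/
def RunsTape (P : Mac V S) (io : List Bool) (v : V → List Symb) (io' : List Bool)
    (v' : V → List Symb) (n : ℕ) : Prop :=
  ∀ g, ∃ g', ∃ n' ≤ n, ∀ cs : List Bool, cs.length = n' →
    P.ReachC cs (cfg (some P.entry) g io v) (cfg none g' io' v')

/-- `RunsTape` with nothing on the input and output stack. -/
abbrev Runs (P : Mac V S) (v v' : V → List Symb) (n : ℕ) : Prop := P.RunsTape [] v [] v' n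

theorem RunsTape.mono {P : Mac V S} {io io' : List Bool} {v v' : V → List Symb} {n n' : ℕ}
    (h : P.RunsTape io v io' v' n) (hn : n ≤ n') : P.RunsTape io v io' v' n' := by
  intro g
  obtain ⟨g', k, hk, h⟩ := h g
  exact ⟨g', k, hk.trans hn, h⟩

theorem RunsTape.congr {P : Mac V S} {io io' : List Bool} {v v' w : V → List Symb} {n n' : ℕ}
    (h : P.RunsTape io v io' v' n) (hv : v' = w) (hn : n ≤ n') : P.RunsTape io v io' w n' :=
  hv ▸ h.mono hn

theorem RunsTape.conv {P : Mac V S} {io io' : List Bool} {v v' w w' : V → List Symb} {n n' : ℕ}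
    (h : P.RunsTape io v io' v' n) (hv : v = w) (hv' : v' = w') (hn : n ≤ n') :
    P.RunsTape io w io' w' n' :=
  hv ▸ hv' ▸ h.mono hn

/-- Sequential composition. -/
def seq (P Q : Mac V S) : Mac V S where
  Λ := P.Λ ⊕ Q.Λ
  fin := letI := P.fin; letI := Q.fin; inferInstance
  entry := Sum.inl P.entry
  m c := Sum.elim (fun l => relabel Sum.inl (some (Sum.inr Q.entry)) (P.m c l))
    (fun l => relabel Sum.inr none (Q.m c l))

/-- Run one program after the other. -/
infixr:60 " ;; " => Mac.seq

theorem reachC_seq_left {P Q : Mac V S} {cs : List Bool} {g g' : Option Symb}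
    {io io' : List Bool} {v v' : V → List Symb}
    (h : P.ReachC cs (cfg (some P.entry) g io v) (cfg none g' io' v')) :
    (P ;; Q).ReachC cs (cfg (some (P ;; Q).entry) g io v)
      (cfg (some (Sum.inr Q.entry)) g' io' v') :=
  h.lift (Q := P ;; Q) (f := Sum.inl) (h := some (Sum.inr Q.entry)) fun _ _ => rfl

theorem reachC_seq_right {P Q : Mac V S} {cs : List Bool} {g g' : Option Symb}
    {io io' : List Bool} {v v' : V → List Symb}
    (h : Q.ReachC cs (cfg (some Q.entry) g io v) (cfg none g' io' v')) :
    (P ;; Q).ReachC cs (cfg (some (Sum.inr Q.entry)) g io v) (cfg none g' io' v') :=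
  h.lift (Q := P ;; Q) (f := Sum.inr) (h := none) fun _ _ => rfl

/-- The coin sequence is cut where the first program stops. This place is known before the coins
are, because `RunsTape` fixes the number of steps ahead of them. -/
theorem RunsTape.seq {P Q : Mac V S} {io₁ io₂ io₃ : List Bool} {v₁ v₂ v₃ : V → List Symb}
    {n₁ n₂ : ℕ} (h₁ : P.RunsTape io₁ v₁ io₂ v₂ n₁) (h₂ : Q.RunsTape io₂ v₂ io₃ v₃ n₂) :
    (P ;; Q).RunsTape io₁ v₁ io₃ v₃ (n₁ + n₂) := by
  intro g
  obtain ⟨g₂, k₁, hk₁, h₁⟩ := h₁ g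
  obtain ⟨g₃, k₂, hk₂, h₂⟩ := h₂ g₂
  refine ⟨g₃, k₁ + k₂, by omega, fun cs hcs => ?_⟩
  rw [← List.take_append_drop k₁ cs]
  exact (reachC_seq_left (h₁ _ (by simp; omega))).trans (reachC_seq_right (h₂ _ (by simp; omega)))

/-- The program with a single statement. -/
def basic (q : Stmt (keyAlphabet V S) Unit (Reg S)) : Mac V S where
  Λ := Unit
  fin := inferInstance
  entry := ()
  m _ _ := q

/-- The program that does nothing. -/
def skip : Mac V S := basic .halt

theorem skip_runs (v : V → List Symb) : (skip : Mac V S).Runs v v 1 := by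
  intro g
  refine ⟨g, 1, le_rfl, fun cs hcs => ?_⟩
  match cs, hcs with
  | [c], _ => exact ⟨by simp [cfg], by simp [skip, basic, step, cfg, ReachC]⟩

/-- Push a symbol. -/
def push (A : V) (s : Symb) : Mac V S := basic (.push (some (Sum.inl A)) (fun _ => s) .halt)

theorem push_runs (A : V) (s : Symb) (v : V → List Symb) :
    (push A s : Mac V S).Runs v (Function.update v A (s :: v A)) 1 := by
  intro g
  refine ⟨g, 1, le_rfl, fun cs hcs => ?_⟩
  match cs, hcs with
  | [c], _ =>
    exact ⟨by simp [cfg], by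
      simp only [push, basic, step, cfg, stepAux, ReachC, stk_var]; rw [update_stk_var]⟩

/-- Push a bit onto the output stack. -/
def pushTape (b : Bool) : Mac V S := basic (.push none (fun _ => b) .halt)

theorem pushTape_runs (b : Bool) (io : List Bool) (v : V → List Symb) :
    (pushTape b : Mac V S).RunsTape io v (b :: io) v 1 := by
  intro g
  refine ⟨g, 1, le_rfl, fun cs hcs => ?_⟩
  match cs, hcs with
  | [c], _ =>
    exact ⟨by simp [cfg], by
      simp only [pushTape, basic, step, cfg, stepAux, ReachC, stk_io]; rw [update_stk_io]⟩

/-- Pop a symbol and continue according to the result. -/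
def pop (A : V) (f : Option Symb → Mac V S) : Mac V S where
  Λ := Option (Σ s, (f s).Λ)
  fin := letI := fun s => (f s).fin; inferInstance
  entry := none
  m c
    | none => .pop (some (Sum.inl A)) (fun r s => (s, r.2))
        (.goto fun r => some ⟨r.1, (f r.1).entry⟩)
    | some ⟨s, l⟩ => relabel (fun l => some ⟨s, l⟩) none ((f s).m c l)

theorem pop_runs {A : V} {f : Option Symb → Mac V S} {v : V → List Symb} {io' : List Bool}
    {v' : V → List Symb} {n : ℕ} (h : (f (v A).head?).RunsTape []
      (Function.update v A (v A).tail) io' v' n) :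
    (pop A f).RunsTape [] v io' v' (n + 1) := by
  intro g
  obtain ⟨g', k, hk, h⟩ := h (v A).head?
  refine ⟨g', k + 1, by omega, fun cs hcs => ?_⟩
  match cs, hcs with
  | c :: cs, hcs =>
    refine ⟨by simp [cfg], ?_⟩
    have := (h cs (by simpa using hcs)).lift (Q := pop A f)
      (f := fun l => some ⟨(v A).head?, l⟩) (h := none) (fun _ _ => rfl)
    simp only [pop, step, cfg, stepAux, stk_var] at this ⊢
    rw [update_stk_var]
    exact this

/-- Pop symbols until the stack is empty or a symbol satisfying `isLast` has been popped, and run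
`f s` after popping `s`. -/
def loop (A : V) (isLast : Symb → Bool) (f : Symb → Mac V S) : Mac V S where
  Λ := Option (Σ s, (f s).Λ)
  fin := letI := fun s => (f s).fin; inferInstance
  entry := none
  m c
    | none => .pop (some (Sum.inl A)) (fun r s => (s, r.2))
        (.branch (fun r => r.1.isSome)
          (.goto fun r => r.1.elim none fun s => some ⟨s, (f s).entry⟩) .halt)
    | some ⟨s, l⟩ =>
      relabel (fun l => some ⟨s, l⟩) (if isLast s then none else some none) ((f s).m c l)

theorem loop_nil {A : V} {isLast : Symb → Bool} {f : Symb → Mac V S} {v : V → List Symb}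
    (hv : v A = []) : (loop A isLast f).Runs v v 1 := by
  intro g
  refine ⟨none, 1, le_rfl, fun cs hcs => ?_⟩
  match cs, hcs with
  | [c], _ =>
    refine ⟨by simp [cfg], ?_⟩
    simp only [loop, step, cfg, stepAux, stk_var, ReachC, hv, List.head?_nil, List.tail_nil]
    rw [update_stk_var, ← hv, Function.update_eq_self]
    rfl

/-- One pass through the body, covering both ways in which it can end: leaving the loop or returning
to its head. -/
theorem loop_entry {A : V} {isLast : Symb → Bool} {f : Symb → Mac V S} {v v' : V → List Symb}
    {s : Symb} {l : List Symb} {n : ℕ} (hv : v A = s :: l)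
    (h : (f s).Runs (Function.update v A l) v' n) (g : Option Symb) :
    ∃ g', ∃ n' ≤ n + 1, ∀ cs : List Bool, cs.length = n' →
      (loop A isLast f).ReachC cs (cfg (some none) g [] v)
        (cfg (if isLast s then none else some none) g' [] v') := by
  obtain ⟨g', k, hk, h⟩ := h (some s)
  refine ⟨g', k + 1, by omega, fun cs hcs => ?_⟩
  match cs, hcs with
  | c :: cs, hcs =>
    refine ⟨by simp [cfg], ?_⟩
    have := (h cs (by simpa using hcs)).lift (Q := loop A isLast f)
      (f := fun l => some ⟨s, l⟩) (h := if isLast s then none else some none) (fun _ _ => rfl)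
    simp only [loop, step, cfg, stepAux, stk_var, hv, List.head?_cons, List.tail_cons] at this ⊢
    rw [update_stk_var]
    exact this

theorem loop_stop {A : V} {isLast : Symb → Bool} {f : Symb → Mac V S} {v v' : V → List Symb}
    {s : Symb} {l : List Symb} {n : ℕ} (hv : v A = s :: l) (hs : isLast s = true)
    (h : (f s).Runs (Function.update v A l) v' n) :
    (loop A isLast f).Runs v v' (n + 1) := by
  intro g
  obtain ⟨g', k, hk, h⟩ := loop_entry (isLast := isLast) hv h g
  exact ⟨g', k, hk, fun cs hcs => by have := h cs hcs; rw [hs] at this; exact this⟩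

theorem loop_cons {A : V} {isLast : Symb → Bool} {f : Symb → Mac V S} {v v₁ v₂ : V → List Symb}
    {s : Symb} {l : List Symb} {n₁ n₂ : ℕ} (hv : v A = s :: l) (hs : isLast s = false)
    (h₁ : (f s).Runs (Function.update v A l) v₁ n₁) (h₂ : (loop A isLast f).Runs v₁ v₂ n₂) :
    (loop A isLast f).Runs v v₂ (n₁ + 1 + n₂) := by
  intro g
  obtain ⟨g₁, k₁, hk₁, h₁⟩ := loop_entry (isLast := isLast) hv h₁ g
  obtain ⟨g₂, k₂, hk₂, h₂⟩ := h₂ g₁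
  refine ⟨g₂, k₁ + k₂, by omega, fun cs hcs => ?_⟩
  rw [← List.take_append_drop k₁ cs]
  have := h₁ (cs.take k₁) (by simp; omega)
  rw [hs] at this
  exact this.trans (h₂ _ (by simp; omega))

/-- Pop symbols until the stack is empty, and run `f s` after popping `s`. -/
abbrev whilePop (A : V) (f : Symb → Mac V S) : Mac V S := loop A (fun _ => false) f

/-- Read the input: each bit is pushed onto `A`, together with a mark on `B`. -/
def readTape (A B : V) : Mac V S :=
  basic (.pop none (fun r s => (s.map fun b => some (false, b), r.2))
    (.branch (fun r => r.1.isSome)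
      (.push (some (Sum.inl A)) (fun r => r.1.getD none)
        (.push (some (Sum.inl B)) (fun _ => some (false, false)) (.goto fun _ => ()))) .halt))

theorem readTape_runs {A B : V} (hAB : A ≠ B) (io : List Bool) (v : V → List Symb) :
    (readTape A B : Mac V S).RunsTape io v [] (Function.update (Function.update v A
      ((io.map fun b => some (false, b)).reverse ++ v A)) B
        (List.replicate io.length (some (false, false)) ++ v B)) (io.length + 1) := by
  intro g
  induction io generalizing v g with
  | nil =>
    refine ⟨none, 1, le_rfl, fun cs hcs => ?_⟩
    match cs, hcs with
    | [c], _ =>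
      refine ⟨by simp [cfg], ?_⟩
      simp only [readTape, basic, step, cfg, stepAux, ReachC, stk_io]
      rw [update_stk_io]
      simp
  | cons b io ih =>
    obtain ⟨g', k, hk, h⟩ := ih (Function.update (Function.update v A (some (false, b) :: v A)) B
      (some (false, false) :: v B)) (some (some (false, b)))
    refine ⟨g', k + 1, by simpa using hk, fun cs hcs => ?_⟩
    match cs, hcs with
    | c :: cs, hcs =>
      refine ⟨by simp [cfg], ?_⟩
      have := h cs (by simpa using hcs)
      simp only [readTape, basic, step, cfg, stepAux, stk_io, List.head?_cons, Option.map_some,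
        Option.isSome_some, cond_true, List.tail_cons, Option.getD_some] at this ⊢
      rw [update_stk_io, stk_var, update_stk_var, stk_var, update_stk_var]
      convert this using 3
      · simp [hAB.symm]
      · funext X
        by_cases hB : X = B
        · subst hB; simp [List.replicate_succ']
        · by_cases hA : X = A
          · subst hA; simp [hAB]
          · simp [hA, hB]

/-- Copy the template on `A` to `B`, replacing each bit by a random bit. -/
def sample (A B : V) : Mac V S where
  Λ := Unit
  fin := inferInstance
  entry := ()
  m c _ := .pop (some (Sum.inl A)) (fun r s => (s, r.2))
    (.branch (fun r => r.1.isSome)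
      (.push (some (Sum.inl B)) (fun r => (r.1.getD none).map fun _ => (false, c))
        (.goto fun _ => ())) .halt)

/-- Every symbol uses up one coin, separators included, and a last coin passes while the empty stack
is noticed. The outcome depends on the coins, so it is expressed by `RunsC`. -/
theorem sample_runs {A B : V} (hAB : A ≠ B) (l : List Symb) (cs : List Bool)
    (hcs : cs.length = l.length) (c : Bool) (io : List Bool) (v : V → List Symb) (hv : v A = l) :
    (sample A B : Mac V S).RunsC (cs ++ [c]) io v io (Function.update (Function.update v A []) B
      ((List.zipWith (fun s c => Option.map (fun _ => (false, c)) s) l cs).reverse ++ v B)) := by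
  intro g
  induction l generalizing v g cs with
  | nil =>
    obtain rfl := List.length_eq_zero_iff.1 hcs
    refine ⟨none, by simp [cfg], ?_⟩
    simp only [sample, step, cfg, stepAux, ReachC, stk_var, hv]
    rw [update_stk_var]
    simp only [List.head?_nil, Option.isSome_none, cond_false, List.tail_nil]
    congr 2
    funext X
    by_cases hB : X = B
    · subst hB; simp [hAB.symm]
    · simp [hB]
  | cons s l ih =>
    match cs, hcs with
    | d :: cs, hcs =>
      obtain ⟨g', h⟩ := ih cs (by simpa using hcs) (Function.update (Function.update v A l) B
        (s.map (fun _ => (false, d)) :: v B)) (by simp [hAB]) (some s)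
      refine ⟨g', by simp [cfg], ?_⟩
      simp only [sample, step, cfg, stepAux, stk_var, hv, List.head?_cons,
        Option.isSome_some, cond_true, List.tail_cons, Option.getD_some] at h ⊢
      rw [update_stk_var, stk_var, update_stk_var]
      rw [Function.update_of_ne hAB.symm]
      convert h using 2
      · rfl
      refine congrArg (stk io) (funext fun X => ?_)
      by_cases hB : X = B
      · subst hB; simp [hAB.symm]
      · by_cases hA : X = A
        · subst hA; simp [hAB]
        · simp [hA, hB]

end Mac

end Programs

/-! ### Turing machines as subroutines -/

section Calls

variable {V : Type} [DecidableEq V] {ι : Type} [DecidableEq ι] {S : ι → SubMachine}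

/-- A statement of the `i`-th subroutine as a statement of the host program, with label `h` instead
of halting. -/
def embed {Λ' : Type} (i : ι) (f : (S i).tm.Λ → Λ') (h : Λ') :
    Stmt (S i).tm.Γ (S i).tm.Λ (S i).tm.σ → Stmt (keyAlphabet V S) Λ' (Reg S)
  | .push k g q => .push (some (Sum.inr ⟨i, k⟩)) (fun r => g (r.2 i)) (embed i f h q)
  | .peek k g q => .peek (some (Sum.inr ⟨i, k⟩))
      (fun r s => (r.1, Function.update r.2 i (g (r.2 i) s))) (embed i f h q)
  | .pop k g q => .pop (some (Sum.inr ⟨i, k⟩))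
      (fun r s => (r.1, Function.update r.2 i (g (r.2 i) s))) (embed i f h q)
  | .load g q => .load (fun r => (r.1, Function.update r.2 i (g (r.2 i)))) (embed i f h q)
  | .branch g q₁ q₂ => .branch (fun r => g (r.2 i)) (embed i f h q₁) (embed i f h q₂)
  | .goto g => .goto fun r => f (g (r.2 i))
  | .halt => .goto fun _ => h

/-- The stacks when the `i`-th subroutine has the stacks `T` and the others are idle. -/
def subStk (v : V → List Symb) (i : ι) (T : ∀ k, List ((S i).tm.Γ k)) :
    ∀ k : Key V S, List (keyAlphabet V S k)
  | none => []
  | some (Sum.inl A) => v A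
  | some (Sum.inr ⟨j, k⟩) => if h : i = j then by subst h; exact T k else []

theorem subStk_empty (v : V → List Symb) (i : ι) :
    subStk v i (fun _ => []) = stk (S := S) [] v := by
  funext k
  rcases k with _ | B | ⟨j, k⟩
  · rfl
  · rfl
  · by_cases h : i = j
    · subst h; simp [subStk, stk]
    · simp [subStk, stk, h]

theorem update_subStk_var (v : V → List Symb) (i : ι) (T : ∀ k, List ((S i).tm.Γ k)) (A : V)
    (l : List Symb) :
    Function.update (subStk v i T) (some (Sum.inl A)) l = subStk (Function.update v A l) i T := by
  funext k
  rcases k with _ | B | ⟨j, k⟩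
  · simp [subStk]
  · by_cases h : B = A
    · subst h; simp [subStk]
    · simp [subStk, h]
  · simp [subStk]

theorem subStk_sub (v : V → List Symb) (i : ι) (T : ∀ k, List ((S i).tm.Γ k)) (k : (S i).tm.K) :
    subStk v i T (some (Sum.inr ⟨i, k⟩)) = T k := by simp [subStk]

theorem update_subStk_sub (v : V → List Symb) (i : ι) (T : ∀ k, List ((S i).tm.Γ k))
    (k : (S i).tm.K) (l : List ((S i).tm.Γ k)) :
    Function.update (subStk v i T) (some (Sum.inr ⟨i, k⟩)) l =
      subStk v i (Function.update T k l) := by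
  funext k'
  rcases k' with _ | B | ⟨j, k'⟩
  · simp [subStk]
  · simp [subStk]
  · by_cases h : i = j
    · subst h
      by_cases hk : k' = k
      · subst hk; simp [subStk]
      · rw [Function.update_of_ne (by simpa using hk)]
        simp [subStk, hk]
    · rw [Function.update_of_ne]
      · simp [subStk, h]
      · intro h'
        simp only [Option.some.injEq, Sum.inr.injEq, Sigma.mk.injEq] at h'
        exact h h'.1.symm

/-- The internal state when the `i`-th subroutine has the state `s` and the others are idle. -/
def subReg (g : Option Symb) (i : ι) (s : (S i).tm.σ) : Reg S :=
  (g, Function.update (fun j => (S j).tm.initialState) i s)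

/-- The configuration when the `i`-th subroutine has the configuration `c` and the others are
idle. -/
def embedCfg {Λ' : Type} (v : V → List Symb) (g : Option Symb) (i : ι) (f : (S i).tm.Λ → Λ')
    (h : Λ') (c : (S i).tm.Cfg) : MCfg V S Λ' :=
  ⟨some (c.l.elim h f), subReg g i c.var, subStk v i c.stk⟩

theorem stepAux_embed {Λ' : Type} (v : V → List Symb) (g : Option Symb) (i : ι)
    (f : (S i).tm.Λ → Λ') (h : Λ') (q : Stmt (S i).tm.Γ (S i).tm.Λ (S i).tm.σ) (s : (S i).tm.σ)
    (T : ∀ k, List ((S i).tm.Γ k)) :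
    stepAux (embed i f h q) (subReg g i s) (subStk v i T) =
      embedCfg v g i f h (stepAux q s T) := by
  induction q generalizing s T with
  | push k a q ih =>
    simp only [embed, stepAux]
    rw [update_subStk_sub, subStk_sub, ← ih]
    simp [subReg]
  | peek k a q ih =>
    simp only [embed, stepAux]
    rw [subStk_sub, ← ih]
    simp [subReg]
  | pop k a q ih =>
    simp only [embed, stepAux]
    rw [subStk_sub, update_subStk_sub, ← ih]
    simp [subReg]
  | load a q ih =>
    simp only [embed, stepAux]
    rw [← ih]
    simp [subReg]
  | branch a q₁ q₂ h₁ h₂ =>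
    have : (subReg g i s : Reg S).2 i = s := by simp [subReg]
    simp only [embed, stepAux, this]
    cases a s
    · exact h₂ s T
    · exact h₁ s T
  | goto a => simp [embed, stepAux, embedCfg, subReg]
  | halt => simp [embed, stepAux, embedCfg, subReg]

namespace Mac

/-- Run the `i`-th subroutine. The argument is taken from `A`, last symbol on top; the result is
pushed onto `B`. -/
def call (i : ι) (A B : V) : Mac V S where
  Λ := Bool ⊕ (S i).tm.Λ
  fin := inferInstance
  entry := Sum.inl false
  m _
    | Sum.inl false => .pop (some (Sum.inl A)) (fun r s => (s, r.2))
        (.branch (fun r => r.1.isSome)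
          (.push (some (Sum.inr ⟨i, (S i).tm.k₀⟩)) (fun r => (S i).enc (r.1.getD none))
            (.goto fun _ => Sum.inl false)) (.goto fun _ => Sum.inr (S i).tm.main))
    | Sum.inl true => .pop (some (Sum.inr ⟨i, (S i).tm.k₁⟩)) (fun r s => (s.map (S i).dec, r.2))
        (.branch (fun r => r.1.isSome)
          (.push (some (Sum.inl B)) (fun r => r.1.getD none) (.goto fun _ => Sum.inl true)) .halt)
    | Sum.inr l => embed i Sum.inr (Sum.inl true) ((S i).tm.m l)

/-- Moving symbols from stack to stack reverses them, which is why arguments are stored with the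
last symbol on top. The list `inp` of symbols already moved makes the induction go through. -/
theorem call_load (i : ι) (A B : V) (l : List Symb) (inp : List ((S i).tm.Γ (S i).tm.k₀))
    (v : V → List Symb) (hv : v A = l) (g : Option Symb) (cs : List Bool)
    (hcs : cs.length = l.length + 1) :
    (call i A B).ReachC cs
      ⟨some (Sum.inl false), subReg g i (S i).tm.initialState,
        subStk v i (Function.update (fun _ => []) (S i).tm.k₀ inp)⟩
      ⟨some (Sum.inr (S i).tm.main), subReg none i (S i).tm.initialState,
        subStk (Function.update v A []) i
          (Function.update (fun _ => []) (S i).tm.k₀ ((l.map (S i).enc).reverse ++ inp))⟩ := by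
  induction l generalizing v g cs inp with
  | nil =>
    match cs, hcs with
    | [c], _ =>
      refine ⟨by simp, ?_⟩
      simp only [call, step, stepAux, ReachC]
      rw [show subStk v i (Function.update (fun _ => []) (S i).tm.k₀ inp) (some (Sum.inl A)) = []
        from hv, update_subStk_var]
      simp [subReg]
  | cons s l ih =>
    match cs, hcs with
    | c :: cs, hcs =>
      refine ⟨by simp, ?_⟩
      have := ih ((S i).enc s :: inp) (Function.update v A l) (by simp) (some s) cs
        (by simpa using hcs)
      simp only [call, step, stepAux] at this ⊢
      rw [show subStk v i (Function.update (fun _ => []) (S i).tm.k₀ inp) (some (Sum.inl A)) =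
        s :: l from hv, update_subStk_var]
      simp only [List.head?_cons, Option.isSome_some, cond_true, List.tail_cons,
        Option.getD_some]
      rw [subStk_sub, update_subStk_sub]
      simpa [subReg] using this

theorem call_unload (i : ι) (A B : V) (out : List ((S i).tm.Γ (S i).tm.k₁))
    (v : V → List Symb) (g : Option Symb) (cs : List Bool) (hcs : cs.length = out.length + 1) :
    (call i A B).ReachC cs
      ⟨some (Sum.inl true), subReg g i (S i).tm.initialState,
        subStk v i (Function.update (fun _ => []) (S i).tm.k₁ out)⟩
      ⟨none, subReg none i (S i).tm.initialState,
        subStk (Function.update v B ((out.map (S i).dec).reverse ++ v B)) i (fun _ => [])⟩ := by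
  induction out generalizing v g cs with
  | nil =>
    match cs, hcs with
    | [c], _ =>
      refine ⟨by simp, ?_⟩
      simp only [call, step, stepAux, ReachC]
      rw [subStk_sub, update_subStk_sub]
      simp [subReg]
  | cons s l ih =>
    match cs, hcs with
    | c :: cs, hcs =>
      refine ⟨by simp, ?_⟩
      have := ih (Function.update v B ((S i).dec s :: v B)) (some ((S i).dec s)) cs
        (by simpa using hcs)
      simp only [call, step, stepAux] at this ⊢
      rw [subStk_sub, update_subStk_sub]
      simp only [Function.update_self, List.head?_cons, Option.map_some, Option.isSome_some,
        cond_true, List.tail_cons, Option.getD_some, Function.update_idem]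
      rw [update_subStk_var]
      simpa [subReg, subStk] using this

theorem initList_stk (tm : FinTM2) (l : List (tm.Γ tm.k₀)) :
    (initList tm l).stk = Function.update (fun _ => []) tm.k₀ l := by
  funext k
  by_cases h : k = tm.k₀
  · subst h; simp [initList]
  · simp [initList, h]

theorem haltList_stk (tm : FinTM2) (l : List (tm.Γ tm.k₁)) :
    (haltList tm l).stk = Function.update (fun _ => []) tm.k₁ l := by
  funext k
  by_cases h : k = tm.k₁
  · subst h; simp [haltList]
  · simp [haltList, h]

theorem iterate_bind_none {α : Type} (f : α → Option α) (n : ℕ) :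
    (flip bind f)^[n] none = none := by
  induction n with
  | zero => rfl
  | succ n ih => rw [Function.iterate_succ_apply]; exact ih

theorem call_run (i : ι) (A B : V) (v : V → List Symb) (g : Option Symb) (n : ℕ)
    (c d : (S i).tm.Cfg) (h : (flip bind (S i).tm.step)^[n] (some c) = some d)
    (cs : List Bool) (hcs : cs.length = n) :
    (call i A B).ReachC cs (embedCfg v g i Sum.inr (Sum.inl true) c)
      (embedCfg v g i Sum.inr (Sum.inl true) d) := by
  induction n generalizing c cs with
  | zero =>
    obtain rfl := List.length_eq_zero_iff.1 hcs
    simp only [Function.iterate_zero, id_eq, Option.some.injEq] at h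
    subst h
    rfl
  | succ n ih =>
    match cs, hcs with
    | x :: cs, hcs =>
      refine ⟨by simp [embedCfg], ?_⟩
      obtain ⟨_ | l, s, T⟩ := c
      -- A halted configuration has no successor, so the iteration would be stuck at `none` and
      -- could not reach `d`.
      · rw [Function.iterate_succ_apply] at h
        change (flip bind (S i).tm.step)^[n] none = some d at h
        rw [iterate_bind_none] at h
        exact absurd h (by simp)
      · rw [Function.iterate_succ_apply] at h
        have := ih _ h cs (by simpa using hcs)
        have e := stepAux_embed v g i (Sum.inr : _ → Bool ⊕ (S i).tm.Λ) (Sum.inl true)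
          ((S i).tm.m l) s T
        exact Eq.mp (congrArg (fun z => (call i A B).ReachC cs z
          (embedCfg v g i Sum.inr (Sum.inl true) d)) e.symm) this

/-- A machine that outputs a result stops in its initial internal state with nothing but the result
on its stacks. Once the result is unloaded it is idle again and can be called any number of times.
-/
theorem call_runs {i : ι} {A B : V} {v : V → List Symb}
    {inp : List ((S i).tm.Γ (S i).tm.k₀)} {out : List ((S i).tm.Γ (S i).tm.k₁)} {n : ℕ}
    (hin : ((v A).map (S i).enc).reverse = inp)
    (h : Nonempty (TM2OutputsInTime (S i).tm inp (some out) n)) :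
    (call (S := S) i A B).Runs v (Function.update (Function.update v A []) B
        ((out.map (S i).dec).reverse ++ Function.update v A [] B))
      ((v A).length + n + out.length + 2) := by
  intro g
  obtain ⟨⟨k, hk⟩, hkn⟩ := h
  refine ⟨none, ((v A).length + 1) + (k + (out.length + 1)), ?_, fun cs hcs => ?_⟩
  · simp only at hkn; omega
  have h₁ := call_load (S := S) i A B (v A) [] v rfl g (cs.take ((v A).length + 1)) (by simp; omega)
  have h₂ := call_run (S := S) i A B (Function.update v A []) none k _ _ hk
    ((cs.drop ((v A).length + 1)).take k) (by simp; omega)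
  have h₃ := call_unload (S := S) i A B out (Function.update v A []) none
    ((cs.drop ((v A).length + 1)).drop k) (by simp; omega)
  rw [← List.take_append_drop ((v A).length + 1) cs,
    ← List.take_append_drop k (cs.drop ((v A).length + 1))]
  have e : ∀ (w : V → List Symb) {Λ : Type} (l : Option Λ) (g : Option Symb),
      (⟨l, subReg g i (S i).tm.initialState, subStk w i (fun _ => [])⟩ : MCfg V S Λ) =
        cfg l g [] w := by
    intro w Λ l g
    simp [cfg, subReg, subStk_empty]
  rw [Function.update_eq_self (f := fun _ => []), e] at h₁
  rw [e] at h₃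
  refine h₁.trans (ReachC.trans ?_ h₃)
  have e₁ := initList_stk (S i).tm inp
  have e₂ := haltList_stk (S i).tm out
  simp only [embedCfg] at h₂
  rw [e₁, e₂] at h₂
  rw [hin, List.append_nil]
  exact h₂

end Mac

end Calls

/-! ### Binary counters interspersed with separators and marks -/

/-- Add one to the binary number formed by the bits, least significant bit first. -/
def incr : List Symb → List Symb
  | [] => []
  | none :: l => none :: incr l
  | some (m, false) :: l => some (m, true) :: l
  | some (m, true) :: l => some (m, false) :: incr l

/-- Whether `incr` overflows. -/
def carry : List Symb → Bool
  | [] => true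
  | none :: l => carry l
  | some (_, false) :: _ => false
  | some (_, true) :: l => carry l

/-- The number of bits. -/
def bits : List Symb → ℕ
  | [] => 0
  | none :: l => bits l
  | some _ :: l => bits l + 1

/-- Write the number `n` into the bits, least significant bit first. -/
def fill : List Symb → ℕ → List Symb
  | [], _ => []
  | none :: l, n => none :: fill l n
  | some (m, _) :: l, n => some (m, decide (n % 2 = 1)) :: fill l (n / 2)

/-- The number formed by the bits, least significant bit first. -/
def num : List Symb → ℕ
  | [] => 0
  | none :: l => num l
  | some (_, b) :: l => b.toNat + 2 * num l

@[simp] theorem length_fill (l : List Symb) (n : ℕ) : (fill l n).length = l.length := by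
  fun_induction fill l n <;> simp_all

@[simp] theorem bits_fill (l : List Symb) (n : ℕ) : bits (fill l n) = bits l := by
  fun_induction fill l n <;> simp_all [bits]

theorem carry_fill (l : List Symb) (n : ℕ) (hn : n < 2 ^ bits l) :
    carry (fill l n) = decide (n + 1 = 2 ^ bits l) := by
  fun_induction fill l n with
  | case1 n => simp_all [bits, carry]
  | case2 l n ih => exact ih hn
  | case3 m b l n ih =>
    simp only [bits, pow_succ] at hn ⊢
    have := ih (by omega)
    rcases Nat.mod_two_eq_zero_or_one n with h | h
    · simp only [h, zero_ne_one, decide_false, carry]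
      symm; rw [decide_eq_false_iff_not]; omega
    · simp only [h, decide_true, carry, this, decide_eq_decide]; omega

/-- An odd `n` carries into the remaining digits. On overflow the counter wraps around to zero, so a
finished enumeration leaves its stack as it was at the start. -/
theorem incr_fill (l : List Symb) (n : ℕ) (hn : n < 2 ^ bits l) :
    incr (fill l n) = fill l (if n + 1 = 2 ^ bits l then 0 else n + 1) := by
  fun_induction fill l n with
  | case1 n => simp [incr, fill]
  | case2 l n ih => simp only [incr, bits, fill]; rw [ih hn]; rfl
  | case3 m b l n ih =>
    simp only [bits, pow_succ] at hn ⊢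
    have := ih (by omega)
    rcases Nat.mod_two_eq_zero_or_one n with h | h
    · have h1 : n + 1 ≠ 2 ^ bits l * 2 := by omega
      have h2 : (n + 1) % 2 = 1 := by omega
      have h3 : (n + 1) / 2 = n / 2 := by omega
      simp [h, h1, h2, h3, incr, fill]
    · simp only [h, decide_true, incr, this, fill]
      split_ifs with h1 h2 h2
      · simp
      · omega
      · omega
      · have h3 : (n + 1) % 2 = 0 := by omega
        have h4 : (n + 1) / 2 = n / 2 + 1 := by omega
        simp [h3, h4]

/-! ### Traversals, enumerations and comparisons -/

/-- Stack variables: each name comes with a stack, a stack that holds symbols during a traversal, and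
a stack that holds the control mark of an enumeration. -/
abbrev Var (N : Type) : Type := N × Fin 3

namespace Mac

variable {N : Type} [DecidableEq N] {ι : Type} [DecidableEq ι] {S : ι → SubMachine}

open Function (update)

theorem pop_cons {V : Type} [DecidableEq V] {a : V} {f : Option Symb → Mac V S}
    {v v' : V → List Symb} {io' : List Bool} {s : Symb} {l : List Symb} {n : ℕ} (hv : v a = s :: l)
    (h : (f (some s)).RunsTape [] (update v a l) io' v' n) :
    (pop a f).RunsTape [] v io' v' (n + 1) :=
  pop_runs (by rw [hv]; exact h)

theorem pop_nil {V : Type} [DecidableEq V] {a : V} {f : Option Symb → Mac V S}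
    {v v' : V → List Symb} {io' : List Bool} {n : ℕ} (hv : v a = [])
    (h : (f none).RunsTape [] v io' v' n) : (pop a f).RunsTape [] v io' v' (n + 1) :=
  pop_runs (by
    have e : update v a [] = v := by rw [← hv, Function.update_eq_self]
    rw [hv, List.tail_nil, e]; exact h)

/-- Move the stack `a` to `b`, reversing it. -/
def mv {V : Type} [DecidableEq V] (a b : V) : Mac V S := whilePop a fun s => push b s

theorem mv_runs {V : Type} [DecidableEq V] {a b : V} (hab : a ≠ b) (v : V → List Symb) :
    (mv a b : Mac V S).Runs v (update (update v a []) b ((v a).reverse ++ v b))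
      (2 * (v a).length + 1) := by
  generalize hl : v a = l
  induction l generalizing v with
  | nil =>
    refine (loop_nil hl).congr ?_ (by simp)
    funext X
    by_cases h : X = a <;> by_cases h' : X = b <;> simp_all [Function.update_apply]
  | cons s l ih =>
    refine (loop_cons hl rfl (push_runs b s _) (ih _ ?_)).congr ?_ ?_
    · simp [hab]
    · funext X
      by_cases h : X = a <;> by_cases h' : X = b <;> simp_all [Function.update_apply]
    · simp; omega

/-- Empty a stack. -/
def clear {V : Type} [DecidableEq V] (a : V) : Mac V S := whilePop a fun _ => skip

theorem clear_runs {V : Type} [DecidableEq V] {a : V} (v : V → List Symb) :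
    (clear a : Mac V S).Runs v (update v a []) (2 * (v a).length + 1) := by
  generalize hl : v a = l
  induction l generalizing v with
  | nil =>
    refine (loop_nil hl).congr ?_ (by simp)
    rw [← hl, Function.update_eq_self]
  | cons s l ih =>
    refine (loop_cons hl rfl (skip_runs _) (ih _ ?_)).congr ?_ ?_
    · simp
    · simp
    · simp; omega

/-- Run `f s` for each symbol `s` of the stack `n`, which is preserved. -/
def forEach (n : N) (f : Symb → Mac (Var N) S) : Mac (Var N) S :=
  whilePop (n, 0) (fun s => push (n, 1) s ;; f s) ;; mv (n, 1) (n, 0)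

/-- The stacks during a traversal of `n`. -/
def trav (v : Var N → List Symb) (n : N) (l l' : List Symb) : Var N → List Symb :=
  update (update v (n, 0) l) (n, 1) l'

@[simp] theorem trav_zero (v : Var N → List Symb) (n : N) (l l' : List Symb) :
    trav v n l l' (n, 0) = l := by simp [trav]

@[simp] theorem trav_one (v : Var N → List Symb) (n : N) (l l' : List Symb) :
    trav v n l l' (n, 1) = l' := by simp [trav]

theorem trav_self {v : Var N → List Symb} {n : N} (h : v (n, 1) = []) :
    trav v n (v (n, 0)) [] = v := by
  simp [trav, ← h]

theorem trav_trav (v : Var N → List Symb) (n : N) (l l' k k' : List Symb) :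
    trav (trav v n l l') n k k' = trav v n k k' := by
  funext X
  by_cases h : X = (n, 0) <;> by_cases h' : X = (n, 1) <;> simp_all [trav]

/-- `G pre` is the loop invariant: the other stacks once `pre` has been processed. While the body
runs, the symbols seen so far lie reversed on the second stack of `n`, the current one on top. -/
theorem forEach_runs {n : N} {f : Symb → Mac (Var N) S} {l : List Symb}
    (G : List Symb → Var N → List Symb) {t : ℕ}
    (h : ∀ pre s suf, l = pre ++ s :: suf →
      (f s).Runs (trav (G pre) n suf (s :: pre.reverse))
        (trav (G (pre ++ [s])) n suf (s :: pre.reverse)) t) :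
    (forEach n f).Runs (trav (G []) n l []) (trav (G l) n l []) ((t + 4) * l.length + 2) := by
  have key : ∀ suf pre, l = pre ++ suf →
      (whilePop (n, 0) (fun s => push (n, 1) s ;; f s)).Runs
        (trav (G pre) n suf pre.reverse) (trav (G l) n [] l.reverse) ((t + 2) * suf.length + 1) := by
    intro suf
    induction suf with
    | nil =>
      intro pre hp
      obtain rfl : l = pre := by simpa using hp
      exact (loop_nil (by simp)).mono (by simp)
    | cons s suf ih =>
      intro pre hp
      have h₂ := ih (pre ++ [s]) (by simp [hp])
      refine (loop_cons (s := s) (l := suf) (by simp) rfl ((push_runs _ _ _).seq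
        ((h pre s suf hp).conv ?_ rfl le_rfl)) (h₂.conv ?_ rfl le_rfl)).mono ?_
      · funext X
        by_cases h : X = (n, 0) <;> by_cases h' : X = (n, 1) <;> simp_all [trav]
      · simp
      · simp only [List.length_cons]; ring_nf; omega
  have h₁ := key l [] rfl
  refine (h₁.seq (mv_runs (by simp) _)).congr ?_ ?_
  · funext X
    by_cases h : X = (n, 0) <;> by_cases h' : X = (n, 1) <;> simp_all [trav]
  · simp; ring_nf; omega

/-- Push the image under `g` of each symbol of the stack `n` onto `b`. -/
def copyRev (n : N) (b : Var N) (g : Symb → Symb) : Mac (Var N) S := forEach n fun s => push b (g s)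

theorem copyRev_runs {n : N} {b : Var N} {g : Symb → Symb} {v : Var N → List Symb}
    (h₀ : b ≠ (n, 0)) (h₁ : b ≠ (n, 1)) (hv : v (n, 1) = []) :
    (copyRev n b g : Mac (Var N) S).Runs v
      (update v b (((v (n, 0)).map g).reverse ++ v b)) (5 * (v (n, 0)).length + 2) := by
  have := forEach_runs (S := S) (n := n) (f := fun s => push b (g s)) (l := v (n, 0))
    (fun pre => update v b ((pre.map g).reverse ++ v b)) (t := 1) ?_
  · refine Eq.mp ?_ (this.congr (w := update v b (((v (n, 0)).map g).reverse ++ v b)) ?_ le_rfl)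
    · congr 1
      simp only [List.map_nil, List.reverse_nil, List.nil_append, Function.update_eq_self]
      exact trav_self hv
    · rw [← trav_self (n := n) (v := update v b (((v (n, 0)).map g).reverse ++ v b))]
      · simp only [trav_trav]
        congr 1
        simp [h₀.symm]
      · simp [h₁.symm, hv]
  · intro pre s suf hl
    refine (push_runs _ _ _).congr ?_ le_rfl
    funext X
    by_cases h : X = (n, 0) <;> by_cases h' : X = (n, 1) <;> by_cases h'' : X = b <;>
      simp_all [trav]

/-- Put a copy of the stack `n` on top of the stack `b`. -/
def copy (n b : N) : Mac (Var N) S := copyRev n (b, 1) id ;; mv (b, 1) (b, 0)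

theorem copy_runs {n b : N} {v : Var N → List Symb} (h : b ≠ n) (hv : v (n, 1) = [])
    (hb : v (b, 1) = []) :
    (copy n b : Mac (Var N) S).Runs v (update v (b, 0) (v (n, 0) ++ v (b, 0)))
      (7 * (v (n, 0)).length + 3) := by
  refine ((copyRev_runs (by simp [h]) (by simp [h]) hv).seq (mv_runs (by simp) _)).congr ?_ ?_
  · funext X
    by_cases h : X = (b, 0) <;> by_cases h' : X = (b, 1) <;> simp_all
  · simp [hb]; omega

/-- The step of `inc` after popping a symbol. -/
def incStep (n : N) : Symb → Mac (Var N) S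
  | none => push (n, 1) none
  | some (m, true) => push (n, 1) (some (m, false))
  | some (m, false) => push (n, 1) (some (m, true)) ;; push (n, 2) none

/-- Whether a symbol is a bit with value zero. -/
def isZero : Symb → Bool
  | some (_, false) => true
  | _ => false

/-- Add one to the binary number on the stack `n`, and set the control mark of `n` unless this
overflows. -/
def inc (n : N) : Mac (Var N) S := loop (n, 0) isZero (incStep n) ;; mv (n, 1) (n, 0)

/-- The digits split into `p`, those the carry has passed through, now reversed on the second stack,
and `r`, those it never reached. The carry stops at the first zero, and exactly then the control
mark is set. -/
theorem loop_inc_runs {n : N} (l : List Symb) (v : Var N → List Symb) (hv : v (n, 0) = l) :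
    ∃ p r, incr l = p.reverse ++ r ∧ p.length ≤ l.length ∧
      (loop (n, 0) isZero (incStep n) : Mac (Var N) S).Runs v
        (update (update (update v (n, 0) r) (n, 1) (p ++ v (n, 1))) (n, 2)
          (if carry l then v (n, 2) else none :: v (n, 2))) (2 * l.length + 2) := by
  induction l generalizing v with
  | nil =>
    refine ⟨[], [], rfl, le_rfl, (loop_nil hv).congr ?_ (by simp)⟩
    funext X
    by_cases h0 : X = (n, 0) <;> by_cases h1 : X = (n, 1) <;> by_cases h2 : X = (n, 2) <;>
      simp_all [carry]
  | cons s l ih =>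
    have step : ∀ (s' : Symb) (hs : isZero s = false) (hc : carry (s :: l) = carry l)
        (hi : incr (s :: l) = s' :: incr l)
        (hr : (incStep n s : Mac (Var N) S).Runs (update v (n, 0) l)
          (update (update v (n, 0) l) (n, 1) (s' :: v (n, 1))) 1),
        ∃ p r, incr (s :: l) = p.reverse ++ r ∧ p.length ≤ (s :: l).length ∧
          (loop (n, 0) isZero (incStep n) : Mac (Var N) S).Runs v
            (update (update (update v (n, 0) r) (n, 1) (p ++ v (n, 1))) (n, 2)
            (if carry (s :: l) then v (n, 2) else none :: v (n, 2)))
            (2 * (s :: l).length + 2) := by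
      intro s' hs hc hi hr
      obtain ⟨p, r, h₁, hp, h₂⟩ := ih (update (update v (n, 0) l) (n, 1) (s' :: v (n, 1)))
        (by simp)
      refine ⟨p ++ [s'], r, by simp [hi, h₁], by simpa using hp,
        (loop_cons hv hs hr h₂).congr ?_ (by simp; omega)⟩
      funext X
      by_cases h0 : X = (n, 0) <;> by_cases h1 : X = (n, 1) <;> by_cases h2 : X = (n, 2) <;>
        simp_all
    rcases s with _ | ⟨m, _ | _⟩
    · exact step none rfl rfl rfl ((push_runs _ _ _).congr (by simp) le_rfl)
    · refine ⟨[some (m, true)], l, by simp [incr], by simp, (loop_stop hv rfl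
        ((push_runs _ _ _).seq (push_runs _ _ _))).congr ?_ (by simp; omega)⟩
      funext X
      by_cases h0 : X = (n, 0) <;> by_cases h1 : X = (n, 1) <;> by_cases h2 : X = (n, 2) <;>
        simp_all [carry]
    · exact step (some (m, false)) rfl rfl rfl ((push_runs _ _ _).congr (by simp) le_rfl)

theorem inc_runs {n : N} {v : Var N → List Symb} (h : v (n, 1) = []) :
    (inc n : Mac (Var N) S).Runs v (update (update v (n, 0) (incr (v (n, 0)))) (n, 2)
      (if carry (v (n, 0)) then v (n, 2) else none :: v (n, 2))) (4 * (v (n, 0)).length + 3) := by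
  obtain ⟨p, r, h₁, hp, h₂⟩ := loop_inc_runs (S := S) _ v rfl
  refine (h₂.seq (mv_runs (by simp) _)).congr ?_ ?_
  · funext X
    by_cases h0 : X = (n, 0) <;> by_cases h1 : X = (n, 1) <;> by_cases h2 : X = (n, 2) <;>
      simp_all
  · simp [h]; omega

/-- Run `P` for all values of the bits on the stack `n`. -/
def enum (n : N) (P : Mac (Var N) S) : Mac (Var N) S :=
  push (n, 2) none ;; whilePop (n, 2) fun _ => P ;; inc n

/-- The invariant `G i` describes the stacks with the counter shown at zero; the actual counter
value is put in by `update`. With this convention the final stacks are again of the form `G`,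
because the counter wraps around. -/
theorem enum_runs {n : N} {P : Mac (Var N) S} {z : List Symb} (G : ℕ → Var N → List Symb) {t : ℕ}
    (h0 : ∀ i ≤ 2 ^ bits z, G i (n, 0) = fill z 0) (h1 : ∀ i ≤ 2 ^ bits z, G i (n, 1) = [])
    (h2 : ∀ i ≤ 2 ^ bits z, G i (n, 2) = [])
    (h : ∀ i < 2 ^ bits z, P.Runs (update (G i) (n, 0) (fill z i))
      (update (G (i + 1)) (n, 0) (fill z i)) t) :
    (enum n P).Runs (G 0) (G (2 ^ bits z)) ((t + 4 * z.length + 4) * 2 ^ bits z + 2) := by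
  -- Induction on the number `j` of values that remain after `i`; for `j = 0` the increment
  -- overflows and sets no mark.
  have key : ∀ j i, i + j + 1 = 2 ^ bits z →
      (whilePop (n, 2) fun _ => P ;; inc n).Runs
        (update (update (G i) (n, 0) (fill z i)) (n, 2) [none]) (G (2 ^ bits z))
        ((t + 4 * z.length + 4) * (j + 1) + 1) := by
    intro j
    induction j with
    | zero =>
      intro i hi
      refine (loop_cons (s := none) (l := []) (by simp) rfl
        (((h i (by omega)).conv ?_ rfl le_rfl).seq
        (inc_runs (by simp [h1 (i + 1) (by omega)]))) ((loop_nil ?_).conv rfl ?_ le_rfl)).mono ?_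
      · have := h2 i (by omega)
        funext X
        by_cases h0 : X = (n, 0) <;> by_cases h2 : X = (n, 2) <;> simp_all
      · simp [carry_fill z i (by omega), show i + 1 = 2 ^ bits z by omega, h2 _ le_rfl]
      · have e1 := carry_fill z i (by omega)
        have e2 := incr_fill z i (by omega)
        rw [show i + 1 = 2 ^ bits z by omega] at e1 e2 ⊢
        have := h2 _ le_rfl
        have := h0 _ le_rfl
        funext X
        by_cases h0 : X = (n, 0) <;> by_cases h2 : X = (n, 2) <;> simp_all
      · simp; omega
    | succ j ih =>
      intro i hi
      refine (loop_cons (s := none) (l := []) (by simp) rfl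
        (((h i (by omega)).conv ?_ rfl le_rfl).seq
        (inc_runs (by simp [h1 (i + 1) (by omega)]))) ((ih (i + 1) (by omega)).conv ?_ rfl
          le_rfl)).mono ?_
      · have := h2 i (by omega)
        funext X
        by_cases h0 : X = (n, 0) <;> by_cases h2 : X = (n, 2) <;> simp_all
      · have e1 := carry_fill z i (by omega)
        have e2 := incr_fill z i (by omega)
        have e3 : i + 1 ≠ 2 ^ bits z := by omega
        have := h2 (i + 1) (by omega)
        funext X
        by_cases h0 : X = (n, 0) <;> by_cases h2 : X = (n, 2) <;> simp_all
      · simp; ring_nf; omega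
  have hpos : 0 < 2 ^ bits z := by positivity
  refine ((push_runs _ _ _).seq ((key (2 ^ bits z - 1) 0 (by omega)).conv ?_ rfl le_rfl)).mono ?_
  · rw [← h0 0 (by omega), Function.update_eq_self, h2 0 (by omega)]
  · rw [show 2 ^ bits z - 1 + 1 = 2 ^ bits z by omega]; omega

/-- Empty `a` and `b`, and push as many marks onto `c` as `a` was larger than `b`. -/
def excess {V : Type} [DecidableEq V] (a b c : V) : Mac V S :=
  whilePop a (fun _ => pop b fun o => if o = none then push c none else skip) ;; clear b

theorem excess_runs {V : Type} [DecidableEq V] {a b c : V} (hab : a ≠ b) (hac : a ≠ c)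
    (hbc : b ≠ c) (v : V → List Symb) :
    (excess a b c : Mac V S).Runs v (update (update (update v a []) b []) c
      (List.replicate ((v a).length - (v b).length) none ++ v c))
      (3 * (v a).length + 2 * (v b).length + 2) := by
  have key : ∀ (l : List Symb) (v : V → List Symb), v a = l →
      (whilePop a (fun _ => pop b fun o => if o = none then push c none else skip) :
        Mac V S).Runs v (update (update (update v a []) b ((v b).drop l.length)) c
          (List.replicate (l.length - (v b).length) none ++ v c)) (3 * l.length + 1) := by
    intro l
    induction l with
    | nil =>
      intro v hv
      refine (loop_nil hv).congr ?_ (by simp)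
      funext X
      by_cases h0 : X = a <;> by_cases h1 : X = b <;> by_cases h2 : X = c <;> simp_all
    | cons s l ih =>
      intro v hv
      rcases hb : v b with _ | ⟨s', k⟩
      · refine (loop_cons hv rfl (pop_runs (v' := update (update v a l) c (none :: v c)) (n := 1) ?_)
          (ih _ (by simp [hac]))).congr ?_ (by simp; omega)
        · have : (update v a l) b = [] := by simp [hab.symm, hb]
          rw [this]
          refine (push_runs c none _).congr ?_ le_rfl
          funext X
          by_cases h0 : X = a <;> by_cases h1 : X = b <;> by_cases h2 : X = c <;> simp_all
        · have := hab.symm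
          funext X
          by_cases h0 : X = a <;> by_cases h1 : X = b <;> by_cases h2 : X = c <;>
            simp_all [List.replicate_succ']
      · refine (loop_cons hv rfl (pop_runs (v' := update (update v a l) b k) (n := 1) ?_)
          (ih _ (by simp [hab]))).congr ?_ (by simp; omega)
        · have : (update v a l) b = s' :: k := by simp [hab.symm, hb]
          rw [this]
          refine (skip_runs _).congr ?_ le_rfl
          rfl
        · funext X
          by_cases h0 : X = a <;> by_cases h1 : X = b <;> by_cases h2 : X = c <;> simp_all
  refine ((key _ v rfl).seq (clear_runs _)).congr ?_ ?_
  · funext X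
    by_cases h0 : X = a <;> by_cases h1 : X = b <;> by_cases h2 : X = c <;> simp_all
  · simp [hbc]; omega

end Mac

/-! ### Counting acceptances of one transcript -/

/-- The names of the stacks. -/
inductive Name
  | inp | len | cntK | cntQ | cntA | cntR | arg | res | coins | adv | qst | ans | bestAns | bestScore
  | pos | neg | posSum | negSum | found | cur | join | tmp | tmp2 | cnt
  deriving DecidableEq

instance : Fintype Name :=
  ⟨{.inp, .len, .cntK, .cntQ, .cntA, .cntR, .arg, .res, .coins, .adv, .qst, .ans, .bestAns,
    .bestScore, .pos, .neg, .posSum, .negSum, .found, .cur, .join, .tmp, .tmp2, .cnt},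
    fun x => by cases x <;> decide⟩

theorem ext_on {V : Type} {v w : V → List Symb} (ks : List V) (h : ∀ k ∈ ks, v k = w k)
    (h' : ∀ X, X ∉ ks → v X = w X) : v = w := by
  funext X
  by_cases hX : X ∈ ks
  exacts [h X hX, h' X hX]

namespace Mac

variable {ι : Type} [DecidableEq ι] {S : ι → SubMachine}

open Function (update)
open Name

/-- The verification procedure `i` answers `acc s` on the string `s` within `t` steps. -/
def Verifies (S : ι → SubMachine) (i : ι) (acc : List Symb → Bool) (t : ℕ) (s : List Symb) : Prop :=
  ∀ v : Var Name → List Symb, v (arg, 0) = s.reverse → v (res, 0) = [] →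
    (call (S := S) i (arg, 0) (res, 0)).Runs v
      (update (update v (arg, 0) []) (res, 0) [some (false, acc s)]) t

/-- Put the fixed part of the input of the verification procedure onto its argument stack. -/
def prepare : Mac (Var Name) S := copyRev inp (arg, 0) id ;; copyRev cur (arg, 0) id

theorem prepare_runs {v : Var Name → List Symb} (h₁ : v (inp, 1) = []) (h₂ : v (cur, 1) = [])
    (h : v (arg, 0) = []) :
    (prepare : Mac (Var Name) S).Runs v (update v (arg, 0) (v (inp, 0) ++ v (cur, 0)).reverse)
      (5 * (v (inp, 0) ++ v (cur, 0)).length + 4) := by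
  refine ((copyRev_runs (by simp) (by simp) h₁).seq
    (copyRev_runs (by simp) (by simp) (by simp [h₂]))).congr ?_ ?_
  · simp [h]
  · simp; omega

/-- Ask the verification procedure and record its answer. -/
def ask (i : ι) : Mac (Var Name) S :=
  call i (arg, 0) (res, 0) ;;
    pop (res, 0) fun o => if (o.getD none).getD (false, false) = (false, true) then push (pos, 0) none
      else push (neg, 0) none

theorem ask_runs {i : ι} {acc : List Symb → Bool} {t : ℕ} {s : List Symb}
    (hs : Verifies S i acc t s) {v : Var Name → List Symb} (h : v (arg, 0) = s.reverse)
    (hr : v (res, 0) = []) :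
    (ask i : Mac (Var Name) S).Runs v (update (update (update v (arg, 0) [])
      (pos, 0) (List.replicate (acc s).toNat none ++ v (pos, 0)))
      (neg, 0) (List.replicate (!acc s).toNat none ++ v (neg, 0))) (t + 2) := by
  refine (hs v h hr).seq (pop_cons (s := some (false, acc s)) (l := []) (by simp) ?_)
  cases ha : acc s
  · refine (push_runs _ _ _).congr ?_ le_rfl
    refine ext_on [(arg, 0), (res, 0), (pos, 0), (neg, 0)] (by simp [hr]) fun X hX => ?_
    simp only [List.mem_cons, not_or, List.not_mem_nil, not_false_eq_true, and_true] at hX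
    simp [hX]
  · refine (push_runs _ _ _).congr ?_ le_rfl
    refine ext_on [(arg, 0), (res, 0), (pos, 0), (neg, 0)] (by simp [hr]) fun X hX => ?_
    simp only [List.mem_cons, not_or, List.not_mem_nil, not_false_eq_true, and_true] at hX
    simp [hX]

/-- Process a symbol of the list of coin strings. -/
def tallyStep (i : ι) : Symb → Mac (Var Name) S
  | none => push (arg, 0) none ;; ask i ;; prepare
  | some b => push (arg, 0) (some b)

/-- Count the coin strings with which the current transcript is accepted and rejected. -/
def tally (i : ι) : Mac (Var Name) S :=
  prepare ;; forEach coins (tallyStep i) ;; clear (arg, 0)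

/-- The stack contents for a list of strings. -/
def flat (ws : List (List Symb)) : List Symb := ws.flatMap fun w => w ++ [none]

/-- The stacks during `tally`. -/
def tallySt (v : Var Name → List Symb) (l l' a p n : List Symb) : Var Name → List Symb :=
  update (update (update (trav v coins l l') (arg, 0) a) (pos, 0) p) (neg, 0) n

/-- The outer induction is over the strings, the inner one over the rest `w₂` of the current string,
whose prefix `w₁` already lies on the argument stack. Strings contain no separator, so the first
separator marks the end of a string: there the question is asked and the fixed part is laid out
again. -/
theorem tally_loop {i : ι} {acc : List Symb → Bool} {t r L : ℕ} {ws : List (List Symb)}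
    {v : Var Name → List Symb} (hL : (v (inp, 0) ++ v (cur, 0)).length ≤ L)
    (hr : ∀ w ∈ ws, w.length ≤ r) (hn : ∀ w ∈ ws, none ∉ w)
    (hs : ∀ w ∈ ws, Verifies S i acc t (v (inp, 0) ++ v (cur, 0) ++ (w ++ [none])))
    (h₁ : v (inp, 1) = []) (h₂ : v (cur, 1) = []) (h₃ : v (res, 0) = []) (l' p n : List Symb) :
    (whilePop (coins, 0) fun s => push (coins, 1) s ;; tallyStep i s : Mac (Var Name) S).Runs
      (tallySt v (flat ws) l' (v (inp, 0) ++ v (cur, 0)).reverse p n)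
      (tallySt v [] ((flat ws).reverse ++ l') (v (inp, 0) ++ v (cur, 0)).reverse
        (List.replicate (ws.countP fun w => acc (v (inp, 0) ++ v (cur, 0) ++ (w ++ [none]))) none ++ p)
        (List.replicate (ws.countP fun w => !acc (v (inp, 0) ++ v (cur, 0) ++ (w ++ [none]))) none
          ++ n)) ((t + 5 * L + 3 * r + 10) * ws.length + 1) := by
  induction ws generalizing l' p n with
  | nil => exact (loop_nil (by simp [tallySt, flat, trav])).conv rfl (by simp [flat]) (by simp)
  | cons w ws ih =>
    set x := v (inp, 0) ++ v (cur, 0) with hx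
    have key : ∀ (w₂ w₁ : List Symb) (l' : List Symb), w = w₁ ++ w₂ →
        (whilePop (coins, 0) fun s => push (coins, 1) s ;; tallyStep i s : Mac (Var Name) S).Runs
      (tallySt v (w₂ ++ none :: flat ws) l' (x ++ w₁).reverse p n)
      (tallySt v [] ((w₂ ++ none :: flat ws).reverse ++ l') x.reverse
        (List.replicate ((w :: ws).countP fun w => acc (x ++ (w ++ [none]))) none ++ p)
        (List.replicate ((w :: ws).countP fun w => !acc (x ++ (w ++ [none]))) none ++ n))
        ((t + 5 * L + 3 * r + 10) * ws.length + 1 + 3 * w₂.length + (t + 5 * L + 10)) := by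
      intro w₂
      induction w₂ with
      | nil =>
        intro w₁ l' hw
        have ih := ih (fun w hw => hr w (by simp [hw])) (fun w hw => hn w (by simp [hw]))
          (fun w hw => hs w (by simp [hw])) (none :: l')
          (List.replicate (acc (x ++ (w ++ [none]))).toNat none ++ p)
          (List.replicate (!acc (x ++ (w ++ [none]))).toNat none ++ n)
        have hw' : w₁ = w := by simp [hw]
        subst hw'
        refine (loop_cons (s := none) (l := flat ws) ?_ rfl ((push_runs _ _ _).seq
          ((push_runs _ _ _).seq ((ask_runs (hs w₁ (by simp)) ?_ ?_).seq
            (prepare_runs ?_ ?_ ?_)))) (ih.conv ?_ rfl le_rfl)).conv rfl ?_ ?_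
        · simp [tallySt]
        · simp [tallySt, hx]
        · simp [tallySt, trav, h₃]
        · simp [tallySt, trav, h₁]
        · simp [tallySt, trav, h₂]
        · simp [tallySt, trav]
        · refine ext_on [(coins, 0), (coins, 1), (arg, 0), (pos, 0), (neg, 0)]
            (by simp [tallySt, trav, hx]) fun X hX => ?_
          simp only [List.mem_cons, not_or, List.not_mem_nil, not_false_eq_true, and_true] at hX
          simp [tallySt, trav, hX]
        · rw [List.countP_cons, List.countP_cons]
          cases acc (x ++ (w₁ ++ [none])) <;> simp [List.replicate_succ']
        · have hL' : (v (inp, 0)).length + (v (cur, 0)).length ≤ L := by simpa [hx] using hL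
          simp [tallySt, trav]
          omega
      | cons s w₂ ihw =>
        intro w₁ l' hw
        have hs : s ≠ none := by rintro rfl; exact hn w (by simp) (by simp [hw])
        obtain ⟨b, rfl⟩ := Option.ne_none_iff_exists'.1 hs
        refine (loop_cons (s := some b) (l := w₂ ++ none :: flat ws) ?_ rfl ((push_runs _ _ _).seq
          (push_runs _ _ _)) ((ihw (w₁ ++ [some b]) (some b :: l') (by simp [hw])).conv ?_ rfl
            le_rfl)).conv rfl ?_ ?_
        · simp [tallySt]
        · refine ext_on [(coins, 0), (coins, 1), (arg, 0), (pos, 0), (neg, 0)]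
            (by simp [tallySt, trav]) fun X hX => ?_
          simp only [List.mem_cons, not_or, List.not_mem_nil, not_false_eq_true, and_true] at hX
          simp [tallySt, trav, hX]
        · simp
        · simp; omega
    refine (key w [] l' rfl).conv (by simp [flat]) (by simp [flat]) ?_
    have := hr w (by simp)
    simp only [List.length_cons]
    ring_nf; omega

theorem length_flat_le {ws : List (List Symb)} {r : ℕ} (hr : ∀ w ∈ ws, w.length ≤ r) :
    (flat ws).length ≤ (r + 1) * ws.length := by
  induction ws with
  | nil => simp [flat]
  | cons w ws ih =>
    have h₁ := ih fun w hw => hr w (by simp [hw])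
    have h₂ := hr w (by simp)
    simp only [flat, List.flatMap_cons, List.length_append, List.length_singleton,
      List.length_cons] at h₁ ⊢
    rw [mul_add]; simp only [List.length_nil]; omega

theorem tally_runs {i : ι} {acc : List Symb → Bool} {t r L : ℕ} {ws : List (List Symb)}
    {x y : List Symb} {v : Var Name → List Symb} (hx : v (inp, 0) = x) (hy : v (cur, 0) = y)
    (hw : v (coins, 0) = flat ws) (hL : (x ++ y).length ≤ L)
    (hr : ∀ w ∈ ws, w.length ≤ r) (hn : ∀ w ∈ ws, none ∉ w)
    (hs : ∀ w ∈ ws, Verifies S i acc t (x ++ y ++ (w ++ [none])))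
    (h₁ : v (inp, 1) = []) (h₂ : v (cur, 1) = []) (h₃ : v (coins, 1) = [])
    (h₄ : v (arg, 0) = []) (h₅ : v (res, 0) = []) :
    (tally i : Mac (Var Name) S).Runs v
      (update (update v (pos, 0)
        (List.replicate (ws.countP fun w => acc (x ++ y ++ (w ++ [none]))) none ++ v (pos, 0)))
        (neg, 0) (List.replicate (ws.countP fun w => !acc (x ++ y ++ (w ++ [none]))) none
          ++ v (neg, 0))) ((t + 5 * L + 5 * r + 12) * ws.length + 7 * L + 10) := by
  subst hx hy
  have h := tally_loop hL hr hn hs h₁ h₂ h₅ [] (v (pos, 0)) (v (neg, 0))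
  refine ((prepare_runs h₁ h₂ h₄).seq (((h.conv ?_ rfl le_rfl).seq (mv_runs (by simp) _)).seq
    (clear_runs _))).conv rfl ?_ ?_
  · refine ext_on [(coins, 0), (coins, 1), (arg, 0), (pos, 0), (neg, 0)]
      (by simp [tallySt, trav, hw, h₃]) fun X hX => ?_
    simp only [List.mem_cons, not_or, List.not_mem_nil, not_false_eq_true, and_true] at hX
    simp [tallySt, trav, hX]
  · refine ext_on [(coins, 0), (coins, 1), (arg, 0), (pos, 0), (neg, 0)]
      (by simp [tallySt, trav, hw, h₃, h₄]) fun X hX => ?_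
    simp only [List.mem_cons, not_or, List.not_mem_nil, not_false_eq_true, and_true] at hX
    simp [tallySt, trav, hX]
  · have hf := length_flat_le hr
    simp only [List.length_append] at hL
    simp [tallySt, trav]
    ring_nf at hf ⊢
    omega

/-! ### Scoring answers against the advice -/

/-- Select a symbol of the current transcript if the advice symbol is marked, and the advice symbol
otherwise. -/
def select (s : Symb) : Symb → Symb
  | none => none
  | some (true, _) => s
  | some (false, b) => some (false, b)

theorem zipWith_concat {α β γ : Type} (f : α → β → γ) {l : List α} {k : List β} (a : α)
    (h : l.length < k.length) :
    List.zipWith f (l ++ [a]) k = List.zipWith f l k ++ [f a k[l.length]] := by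
  induction l generalizing k with
  | nil =>
    cases k with
    | nil => simp at h
    | cons c k => simp
  | cons b l ih =>
    cases k with
    | nil => simp at h
    | cons c k => simp [ih (k := k) (by simpa using h)]

/-- Merge the transcript on `join` with the next block of advice. -/
def merge : Mac (Var Name) S :=
  forEach join (fun s => pop (adv, 0) fun o =>
    push (adv, 1) (o.getD none) ;; push (cur, 1) (select s (o.getD none))) ;; mv (cur, 1) (cur, 0)

theorem merge_runs {v : Var Name → List Symb} {z g l : List Symb} (hz : v (join, 0) = z)
    (hg : v (adv, 0) = g ++ l) (hl : g.length = z.length) (h₁ : v (join, 1) = [])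
    (h₂ : v (cur, 1) = []) (h₃ : v (cur, 0) = []) :
    (merge : Mac (Var Name) S).Runs v (update (update (update v (adv, 0) l) (adv, 1)
      (g.reverse ++ v (adv, 1))) (cur, 0) (List.zipWith select z g)) (9 * z.length + 3) := by
  have := forEach_runs (S := S) (n := join) (f := fun s => pop (adv, 0) fun o =>
    push (adv, 1) (o.getD none) ;; push (cur, 1) (select s (o.getD none))) (l := z) (t := 3)
    (fun pre => update (update (update v (adv, 0) (g.drop pre.length ++ l)) (adv, 1)
      ((g.take pre.length).reverse ++ v (adv, 1))) (cur, 1) (List.zipWith select pre g).reverse) ?_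
  · refine ((this.conv ?_ rfl le_rfl).seq (mv_runs (by simp) _)).conv rfl ?_ ?_
    · refine ext_on [(adv, 0), (adv, 1), (cur, 1), (join, 0), (join, 1)]
        (by simp [trav, hz, hg, h₁, h₂]) fun X hX => ?_
      simp only [List.mem_cons, not_or, List.not_mem_nil, not_false_eq_true, and_true] at hX
      simp [trav, hX]
    · refine ext_on [(adv, 0), (adv, 1), (cur, 1), (cur, 0), (join, 0), (join, 1)]
        (by simp [trav, hz, hl, h₁, h₂, h₃, List.take_of_length_le hl.le]) fun X hX => ?_
      simp only [List.mem_cons, not_or, List.not_mem_nil, not_false_eq_true, and_true] at hX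
      simp [trav, hX]
    · simp [trav, hl]; omega
  · intro pre s suf hp
    have hlt : pre.length < g.length := by rw [hl, hp]; simp
    refine (pop_cons (s := g[pre.length]) (l := g.drop (pre.length + 1) ++ l) ?_
      ((push_runs _ _ _).seq (push_runs _ _ _))).conv rfl ?_ le_rfl
    · simp only [trav]
      rw [Function.update_of_ne (by simp), Function.update_of_ne (by simp),
        Function.update_of_ne (by simp), Function.update_of_ne (by simp), Function.update_self,
        List.drop_eq_getElem_cons hlt, List.cons_append]
    · have e := zipWith_concat select s hlt
      have e' : (g.take (pre.length + 1)).reverse = g[pre.length] :: (g.take pre.length).reverse := by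
        rw [List.take_add_one, List.getElem?_eq_getElem hlt]; simp
      refine ext_on [(adv, 0), (adv, 1), (cur, 1), (join, 0), (join, 1)]
        (by simp [trav, e, e']) fun X hX => ?_
      simp only [List.mem_cons, not_or, List.not_mem_nil, not_false_eq_true, and_true] at hX
      simp [trav, hX]

/-- The stacks that are empty between two evaluations. -/
structure Idle (v : Var Name → List Symb) : Prop where
  shadow : ∀ n, v (n, 1) = []
  arg : v (arg, 0) = []
  res : v (res, 0) = []
  cur : v (cur, 0) = []
  join : v (join, 0) = []
  pos : v (pos, 0) = []
  neg : v (neg, 0) = []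
  tmp : v (tmp, 0) = []
  tmp2 : v (tmp2, 0) = []

theorem Idle.update {v : Var Name → List Symb} (h : Idle v) {k : Var Name} {l : List Symb}
    (hk : k.2 ≠ 1) (h' : k.2 = 0 → k.1 ≠ .arg ∧ k.1 ≠ .res ∧ k.1 ≠ .cur ∧ k.1 ≠ .join ∧ k.1 ≠ .pos ∧
      k.1 ≠ .neg ∧ k.1 ≠ .tmp ∧ k.1 ≠ .tmp2) : Idle (update v k l) := by
  have key : ∀ n, k ≠ (n, 0) → Function.update v k l (n, 0) = v (n, 0) := fun n hn =>
    Function.update_of_ne hn.symm _ _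
  obtain ⟨n, j⟩ := k
  constructor
  · intro m
    rw [Function.update_of_ne (by rintro ⟨⟩; exact hk rfl), h.shadow]
  all_goals
    rw [key _ (by rintro ⟨⟩; simp at h')]
    first
    | exact h.arg
    | exact h.res
    | exact h.cur
    | exact h.join
    | exact h.pos
    | exact h.neg
    | exact h.tmp
    | exact h.tmp2

/-- The number of coin strings with which the transcript `y` is accepted. -/
def wins (acc : List Symb → Bool) (x : List Symb) (ws : List (List Symb)) (y : List Symb) : ℕ :=
  ws.countP fun w => acc (x ++ y ++ (w ++ [none]))

/-- The total number of acceptances when the marked parts of the advice are replaced. -/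
def scoreVal (acc : List Symb → Bool) (x : List Symb) (ws gs : List (List Symb)) (z : List Symb) :
    ℕ := (gs.map fun g => wins acc x ws (List.zipWith select z g)).sum

/-- Compute the score of the questions and answers at hand. -/
def score (i : ι) : Mac (Var Name) S :=
  copy ans join ;; copy qst join ;;
    whilePop (adv, 0) (fun s => push (adv, 1) s ;; merge ;; tally i ;; clear (cur, 0)) ;;
      mv (adv, 1) (adv, 0) ;; clear (neg, 0) ;; clear (join, 0)

/-- Rejections are counted along with acceptances but play no role in the score. Their marks `q` are
left unspecified except for the length, which bounds the time to clear them. -/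
theorem score_loop {i : ι} {acc : List Symb → Bool} {t r L : ℕ} {ws gs : List (List Symb)}
    {x z : List Symb} {v : Var Name → List Symb} (hx : v (inp, 0) = x) (hz : v (join, 0) = z)
    (hw : v (coins, 0) = flat ws) (hL : x.length + z.length ≤ L)
    (hr : ∀ w ∈ ws, w.length ≤ r) (hn : ∀ w ∈ ws, none ∉ w)
    (hg : ∀ g ∈ gs, g.length = z.length)
    (hs : ∀ g ∈ gs, ∀ w ∈ ws,
      Verifies S i acc t (x ++ List.zipWith select z g ++ (w ++ [none])))
    (h₁ : ∀ n, n ≠ adv → v (n, 1) = []) (h₄ : v (arg, 0) = []) (h₅ : v (res, 0) = [])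
    (h₆ : v (cur, 0) = []) (l' p n : List Symb) :
    ∃ q, (whilePop (adv, 0) (fun s => push (adv, 1) s ;; merge ;; tally i ;; clear (cur, 0)) :
      Mac (Var Name) S).Runs
      (update (update (trav v adv (gs.flatMap (none :: ·)) l') (pos, 0) p) (neg, 0) n)
      (update (update (trav v adv [] ((gs.flatMap (none :: ·)).reverse ++ l')) (pos, 0)
        (List.replicate (scoreVal acc x ws gs z) none ++ p)) (neg, 0) q)
      (((t + 5 * L + 5 * r + 12) * ws.length + 20 * L + 20) * gs.length + 1) ∧
      q.length ≤ n.length + ws.length * gs.length := by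
  induction gs generalizing l' p n with
  | nil => exact ⟨n, (loop_nil (by simp [trav])).conv rfl (by simp [scoreVal]) (by simp), by simp⟩
  | cons g gs ih =>
    obtain ⟨q, h, hq⟩ := ih (fun g hg' => hg g (by simp [hg']))
      (fun g hg' => hs g (by simp [hg'])) (g.reverse ++ none :: l')
      (List.replicate (wins acc x ws (List.zipWith select z g)) none ++ p)
      (List.replicate (ws.countP fun w => !acc (x ++ List.zipWith select z g ++ (w ++ [none]))) none
        ++ n)
    have hgz := hg g (by simp)
    refine ⟨q, (loop_cons (s := none) (l := g ++ gs.flatMap (none :: ·)) ?_ rfl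
      ((push_runs _ _ _).seq ((merge_runs (z := z) (g := g) (l := gs.flatMap (none :: ·))
        ?_ ?_ hgz ?_ ?_ ?_).seq ((tally_runs (L := L) (x := x) (y := List.zipWith select z g)
          ?_ ?_ ?_ ?_ hr hn (hs g (by simp)) ?_ ?_ ?_ ?_ ?_).seq (clear_runs _))))
            (h.conv ?_ rfl le_rfl)).conv rfl ?_ ?_, ?_⟩
    · simp [trav]
    · simp [trav, hz]
    · simp [trav]
    · simp [trav, h₁]
    · simp [trav, h₁]
    · simp [trav, h₆]
    · simp [trav, hx]
    · simp [trav]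
    · simp [trav, hw]
    · simp [hgz]; exact hL
    · simp [trav, h₁]
    · simp [trav, h₁]
    · simp [trav, h₁]
    · simp [trav, h₄]
    · simp [trav, h₅]
    · refine ext_on [(adv, 0), (adv, 1), (cur, 0), (pos, 0), (neg, 0)]
        (by simp [trav, wins, h₆]) fun X hX => ?_
      simp only [List.mem_cons, not_or, List.not_mem_nil, not_false_eq_true, and_true] at hX
      simp [trav, hX]
    · have : scoreVal acc x ws (g :: gs) z =
          scoreVal acc x ws gs z + wins acc x ws (List.zipWith select z g) := by
        simp [scoreVal, Nat.add_comm]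
      rw [this, ← List.append_assoc (List.replicate _ none), List.replicate_append_replicate]
      simp
    · simp [hgz]; ring_nf; omega
    · have := ws.countP_le_length (p := fun w => !acc (x ++ List.zipWith select z g ++ (w ++ [none])))
      simp only [List.length_append, List.length_replicate, List.length_cons] at hq ⊢
      rw [Nat.mul_add]; omega

theorem score_runs {i : ι} {acc : List Symb → Bool} {t r L : ℕ} {ws gs : List (List Symb)}
    {x y b : List Symb} {v : Var Name → List Symb} (hv : Idle v) (hx : v (inp, 0) = x)
    (hy : v (qst, 0) = y) (hb : v (ans, 0) = b) (ha : v (adv, 0) = gs.flatMap (none :: ·))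
    (hw : v (coins, 0) = flat ws) (hL : x.length + (y ++ b).length ≤ L)
    (hr : ∀ w ∈ ws, w.length ≤ r) (hn : ∀ w ∈ ws, none ∉ w)
    (hg : ∀ g ∈ gs, g.length = (y ++ b).length)
    (hs : ∀ g ∈ gs, ∀ w ∈ ws,
      Verifies S i acc t (x ++ List.zipWith select (y ++ b) g ++ (w ++ [none]))) :
    (score i : Mac (Var Name) S).Runs v
      (update v (pos, 0) (List.replicate (scoreVal acc x ws gs (y ++ b)) none))
      (((t + 5 * L + 5 * r + 14) * ws.length + 22 * L + 22) * gs.length + 9 * L + 10) := by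
  obtain ⟨q, h, hq⟩ := score_loop (v := update v (join, 0) (y ++ b)) (z := y ++ b) (x := x)
    (by simp [hx]) (by simp) (by simp [hw]) hL hr hn hg hs (fun n _ => by simp [hv.shadow])
    (by simp [hv.arg]) (by simp [hv.res]) (by simp [hv.cur]) [] [] []
  refine ((copy_runs (by simp) (hv.shadow _) (hv.shadow _)).seq ((copy_runs (by simp)
    (by simp [hv.shadow]) (by simp [hv.shadow])).seq ((h.conv ?_ rfl le_rfl).seq
      ((mv_runs (by simp) _).seq ((clear_runs _).seq (clear_runs _)))))).conv rfl ?_ ?_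
  · refine ext_on [(adv, 0), (adv, 1), (join, 0), (pos, 0), (neg, 0)]
      (by simp [trav, ha, hb, hy, hv.shadow, hv.pos, hv.neg, hv.join]) fun X hX => ?_
    simp only [List.mem_cons, not_or, List.not_mem_nil, not_false_eq_true, and_true] at hX
    simp [trav, hX]
  · refine ext_on [(adv, 0), (adv, 1), (join, 0), (pos, 0), (neg, 0)]
      (by simp [trav, ha, hb, hy, hv.shadow, hv.pos, hv.neg, hv.join]) fun X hX => ?_
    simp only [List.mem_cons, not_or, List.not_mem_nil, not_false_eq_true, and_true] at hX
    simp [trav, hX]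
  · have e : (gs.flatMap (none :: ·)).length = (y.length + b.length + 1) * gs.length := by
      clear h hs ha hq
      induction gs with
      | nil => simp
      | cons g gs ih =>
        have h₁ := ih fun g hg' => hg g (by simp [hg'])
        have h₂ := hg g (by simp)
        simp only [List.flatMap_cons, List.length_append, List.length_cons] at h₁ h₂ ⊢
        rw [h₁, h₂]; ring
    have h₁ : (y.length + b.length) * gs.length ≤ L * gs.length :=
      Nat.mul_le_mul_right _ (by simp at hL; omega)
    simp only [List.length_append] at hL
    simp [trav, hb, hy, hv.join, e]
    simp only [List.length_nil, zero_add] at hq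
    ring_nf at hq h₁ ⊢
    omega

/-- The largest value of `f` below `n`, and the first place where it is attained. -/
def firstMax (f : ℕ → ℕ) : ℕ → ℕ × ℕ
  | 0 => (0, 0)
  | n + 1 => if (firstMax f n).1 < f n then (f n, n) else firstMax f n

/-- Compare the score of the answers at hand with the best score so far. -/
def improve : Mac (Var Name) S :=
  copyRev bestScore (tmp, 0) id ;; excess (pos, 0) (tmp, 0) (tmp2, 0) ;;
    pop (tmp2, 0) fun o => if o = none then skip else
      push (bestScore, 0) none ;; mv (tmp2, 0) (bestScore, 0) ;;
        clear (bestAns, 0) ;; copy ans bestAns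

theorem improve_runs {v : Var Name → List Symb} {b b' : List Symb} {m n L : ℕ}
    (h : ∀ n, v (n, 1) = []) (hb : v (ans, 0) = b) (hb' : v (bestAns, 0) = b')
    (hm : v (bestScore, 0) = List.replicate m none) (hn : v (pos, 0) = List.replicate n none)
    (h₁ : v (tmp, 0) = []) (h₂ : v (tmp2, 0) = []) (hL : b.length ≤ L) (hL' : b'.length ≤ L) :
    (improve : Mac (Var Name) S).Runs v (update (update (update v (pos, 0) []) (bestScore, 0)
      (List.replicate (if m < n then n else m) none)) (bestAns, 0) (if m < n then b else b'))
      (7 * m + 5 * n + 9 * L + 20) := by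
  refine ((copyRev_runs (by simp) (by simp) (h _)).seq ((excess_runs (by simp) (by simp) (by simp)
    _).seq (n₂ := 2 * n + 9 * L + 10) ?_)).mono (by simp [hm, hn, h₁]; omega)
  by_cases hmn : m < n
  -- The difference has `k + 1` marks. The test consumes one of them, which is restored directly on
  -- `bestScore`; the other `k` are moved there.
  · obtain ⟨k, rfl⟩ : ∃ k, n = m + k + 1 := ⟨n - m - 1, by omega⟩
    refine RunsTape.conv (pop_cons (s := none) (l := List.replicate k none) ?_ ((push_runs _ _ _).seq
      ((mv_runs (by simp) _).seq ((clear_runs _).seq (copy_runs (by simp) ?_ ?_))))) rfl ?_ ?_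
    · simp [hm, hn, h₁, h₂, Nat.add_assoc, List.replicate_succ]
    · simp [h]
    · simp [h]
    · refine ext_on [(pos, 0), (tmp, 0), (tmp2, 0), (bestScore, 0), (bestAns, 0)]
        ?_ fun X hX => ?_
      · simp [hm, h₁, h₂, hb, hmn, ← List.replicate_succ]; omega
      · simp only [List.mem_cons, not_or, List.not_mem_nil, not_false_eq_true, and_true] at hX
        simp [hX]
    · simp [hb, hb']; omega
  · refine RunsTape.conv (pop_nil ?_ (skip_runs _)) rfl ?_ (by omega)
    · simp [hm, hn, h₁, h₂]; omega
    · refine ext_on [(pos, 0), (tmp, 0), (tmp2, 0), (bestScore, 0), (bestAns, 0)]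
        ?_ fun X hX => ?_
      · simp [hm, hn, h₁, h₂, hb', hmn, show n - m = 0 by omega]
      · simp only [List.mem_cons, not_or, List.not_mem_nil, not_false_eq_true, and_true] at hX
        simp [hX]

/-- Find the best answers to the questions at hand. -/
def choose (i : ι) : Mac (Var Name) S := copy ans bestAns ;; enum ans (score i ;; improve)

theorem firstMax_le {f : ℕ → ℕ} {c : ℕ} (hf : ∀ n, f n ≤ c) (n : ℕ) : (firstMax f n).1 ≤ c := by
  induction n with
  | zero => exact Nat.zero_le _
  | succ n ih => simp only [firstMax]; split_ifs; exacts [hf n, ih]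

theorem scoreVal_le (acc : List Symb → Bool) (x : List Symb) (ws gs : List (List Symb))
    (z : List Symb) : scoreVal acc x ws gs z ≤ ws.length * gs.length := by
  induction gs with
  | nil => simp [scoreVal]
  | cons g gs ih =>
    have : wins acc x ws (List.zipWith select z g) ≤ ws.length := List.countP_le_length
    simp only [scoreVal, List.map_cons, List.sum_cons, List.length_cons] at ih ⊢
    rw [Nat.mul_add]; omega

/-- The enumeration starts with the all-zero answers and score zero as the best so far, which
matches the base case of `firstMax`. Replacing them only on strict improvement keeps the earliest
maximiser, and later the identity of this maximiser matters. -/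
theorem choose_runs {i : ι} {acc : List Symb → Bool} {t r L : ℕ} {ws gs : List (List Symb)}
    {x y b : List Symb} {v : Var Name → List Symb} (hv : Idle v) (hx : v (inp, 0) = x)
    (hy : v (qst, 0) = y) (hb : v (ans, 0) = fill b 0) (ha : v (adv, 0) = gs.flatMap (none :: ·))
    (hw : v (coins, 0) = flat ws) (hL : x.length + (y ++ b).length ≤ L)
    (hr : ∀ w ∈ ws, w.length ≤ r) (hn : ∀ w ∈ ws, none ∉ w)
    (hg : ∀ g ∈ gs, g.length = (y ++ b).length)
    (hs : ∀ n, ∀ g ∈ gs, ∀ w ∈ ws,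
      Verifies S i acc t (x ++ List.zipWith select (y ++ fill b n) g ++ (w ++ [none])))
    (hf : v (ans, 2) = []) (h₁ : v (bestAns, 0) = []) (h₂ : v (bestScore, 0) = []) :
    (choose i : Mac (Var Name) S).Runs v (update (update v
      (bestScore, 0) (List.replicate
        (firstMax (fun n => scoreVal acc x ws gs (y ++ fill b n)) (2 ^ bits b)).1 none))
      (bestAns, 0)
        (fill b (firstMax (fun n => scoreVal acc x ws gs (y ++ fill b n)) (2 ^ bits b)).2))
      ((((t + 5 * L + 5 * r + 26) * ws.length + 22 * L + 22) * gs.length + 22 * L + 34) *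
        2 ^ bits b + 7 * L + 5) := by
  set f := fun n => scoreVal acc x ws gs (y ++ fill b n) with hf'
  have hle : ∀ n, f n ≤ ws.length * gs.length := fun n => scoreVal_le _ _ _ _ _
  have := enum_runs (S := S) (n := ans) (P := score i ;; improve) (z := b)
    (fun n => update (update v (bestScore, 0) (List.replicate (firstMax f n).1 none)) (bestAns, 0)
      (fill b (firstMax f n).2))
    (t := ((t + 5 * L + 5 * r + 26) * ws.length + 22 * L + 22) * gs.length + 18 * L + 30)
    ?_ ?_ ?_ ?_
  · refine ((copy_runs (by simp) (hv.shadow _) (hv.shadow _)).seq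
      (this.conv ?_ rfl le_rfl)).conv rfl ?_ ?_
    · refine ext_on [(bestScore, 0), (bestAns, 0)] (by simp [hb, h₁, h₂, firstMax]) fun X hX => ?_
      simp only [List.mem_cons, not_or, List.not_mem_nil, not_false_eq_true, and_true] at hX
      simp [hX]
    · rfl
    · have h₀ : b.length ≤ L := by simp at hL; omega
      have := Nat.mul_le_mul_right (2 ^ bits b) (show ((t + 5 * L + 5 * r + 26) * ws.length +
        22 * L + 22) * gs.length + 18 * L + 30 + 4 * b.length + 4 ≤ ((t + 5 * L + 5 * r + 26) *
        ws.length + 22 * L + 22) * gs.length + 22 * L + 34 by omega)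
      simp only [hb, length_fill]
      omega
  · simp [hb]
  · simp [hv.shadow]
  · simp [hf]
  · intro n hn'
    have hI : Idle (update (update (update v (bestScore, 0)
        (List.replicate (firstMax f n).1 none)) (bestAns, 0) (fill b (firstMax f n).2)) (ans, 0)
          (fill b n)) :=
      ((hv.update (by simp) (by simp)).update (by simp) (by simp)).update (by simp) (by simp)
    have e₁ := firstMax_le hle n
    have e₂ := hle n
    refine ((score_runs (acc := acc) (t := t) (L := L) hI (x := x) (y := y) (b := fill b n) (gs := gs) ?_ ?_ ?_ ?_ ?_ ?_ hr
      hn ?_ ?_).seq (improve_runs (b := fill b n) (b' := fill b (firstMax f n).2)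
      (m := (firstMax f n).1) (n := f n) (L := L) ?_ ?_ ?_ ?_ ?_ ?_ ?_ ?_ ?_)).conv rfl ?_ ?_
    · simp [hx]
    · simp [hy]
    · simp
    · simp [ha]
    · simp [hw]
    · simpa using hL
    · simpa using hg
    · exact hs n
    · simp [hv.shadow]
    · simp
    · simp
    · simp
    · simp [hf']
    · simp [hv.tmp]
    · simp [hv.tmp2]
    · simp at hL ⊢; omega
    · simp at hL ⊢; omega
    · refine ext_on [(pos, 0), (bestScore, 0), (bestAns, 0), (ans, 0)] ?_ fun X hX => ?_
      · by_cases h : (firstMax f n).1 < f n <;> simp [h, firstMax, hv.pos]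
      · simp only [List.mem_cons, not_or, List.not_mem_nil, not_false_eq_true, and_true] at hX
        simp [hX]
    · ring_nf at e₁ e₂ ⊢
      omega

end Mac

/-! ### The value of the described strategies, and the search over all advice -/

namespace Mac

variable {ι : Type} [DecidableEq ι] {S : ι → SubMachine}

open Function (update)
open Name

/-- Record with how many coin strings the best answers are accepted and rejected. -/
def evaluate (i : ι) : Mac (Var Name) S :=
  copy bestAns cur ;; copy qst cur ;; tally i ;; clear (cur, 0) ;; clear (bestAns, 0) ;;
    clear (bestScore, 0) ;; mv (pos, 0) (posSum, 0) ;; mv (neg, 0) (negSum, 0)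

theorem evaluate_runs {i : ι} {acc : List Symb → Bool} {t r L m p n : ℕ} {ws : List (List Symb)}
    {x y b : List Symb} {v : Var Name → List Symb} (hv : Idle v) (hx : v (inp, 0) = x)
    (hy : v (qst, 0) = y) (hb : v (bestAns, 0) = b) (hm : v (bestScore, 0) = List.replicate m none)
    (hp : v (posSum, 0) = List.replicate p none) (hn : v (negSum, 0) = List.replicate n none)
    (hw : v (coins, 0) = flat ws) (hL : x.length + (y ++ b).length ≤ L)
    (hr : ∀ w ∈ ws, w.length ≤ r) (hn' : ∀ w ∈ ws, none ∉ w)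
    (hs : ∀ w ∈ ws, Verifies S i acc t (x ++ (y ++ b) ++ (w ++ [none]))) :
    (evaluate i : Mac (Var Name) S).Runs v (update (update (update (update v (bestAns, 0) [])
      (bestScore, 0) []) (posSum, 0) (List.replicate (p + wins acc x ws (y ++ b)) none))
      (negSum, 0) (List.replicate (n + (ws.length - wins acc x ws (y ++ b))) none))
      ((t + 5 * L + 5 * r + 16) * ws.length + 20 * L + 2 * m + 30) := by
  have hc : (ws.countP fun w => !acc (x ++ (y ++ b) ++ (w ++ [none]))) =
      ws.length - wins acc x ws (y ++ b) := by
    have := ws.length_eq_countP_add_countP (p := fun w => acc (x ++ (y ++ b) ++ (w ++ [none])))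
    simp only [wins, Bool.not_eq_true, Bool.decide_eq_false] at this ⊢
    omega
  have hwin : wins acc x ws (y ++ b) ≤ ws.length := List.countP_le_length
  refine ((copy_runs (by simp) (hv.shadow _) (hv.shadow _)).seq ((copy_runs (by simp)
    (by simp [hv.shadow]) (by simp [hv.shadow])).seq ((tally_runs (acc := acc) (t := t) (r := r)
    (L := L) (x := x) (y := y ++ b) (ws := ws) ?_ ?_ ?_ ?_ hr hn' hs ?_ ?_ ?_ ?_ ?_).seq
    ((clear_runs _).seq ((clear_runs _).seq ((clear_runs _).seq ((mv_runs (by simp) _).seq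
      (mv_runs (by simp) _)))))))).conv rfl ?_ ?_
  · simp [hx]
  · simp [hy, hb, hv.cur]
  · simp [hw]
  · simpa using hL
  · simp [hv.shadow]
  · simp [hv.shadow]
  · simp [hv.shadow]
  · simp [hv.arg]
  · simp [hv.res]
  · rw [hc]
    refine ext_on [(cur, 0), (bestAns, 0), (bestScore, 0), (pos, 0), (neg, 0), (posSum, 0),
      (negSum, 0)] ?_ fun X hX => ?_
    · simp [hv.cur, hv.pos, hv.neg, hp, hn, wins, Nat.add_comm]
    · simp only [List.mem_cons, not_or, List.not_mem_nil, not_false_eq_true, and_true] at hX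
      simp [hX]
  · rw [hc]
    simp only [wins, List.append_assoc] at hwin ⊢
    simp only [List.length_append] at hL
    simp [hy, hb, hm, hv.cur, hv.pos, hv.neg]
    ring_nf
    omega

/-- The number of acceptances over all coin strings with the best answers to `y`. -/
def roundWins (acc : List Symb → Bool) (x : List Symb) (ws gs : List (List Symb))
    (y b : List Symb) : ℕ :=
  wins acc x ws (y ++ fill b (firstMax (fun n => scoreVal acc x ws gs (y ++ fill b n))
    (2 ^ bits b)).2)

/-- The number of acceptances over all questions and coin strings with the best answers. -/
def totalWins (acc : List Symb → Bool) (x : List Symb) (ws gs : List (List Symb))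
    (y b : List Symb) (n : ℕ) : ℕ := ∑ j ∈ Finset.range n, roundWins acc x ws gs (fill y j) b

/-- How many more acceptances than rejections there are. -/
def surplus (acc : List Symb → Bool) (x : List Symb) (ws gs : List (List Symb))
    (y b : List Symb) : ℕ :=
  totalWins acc x ws gs y b (2 ^ bits y) -
    (2 ^ bits y * ws.length - totalWins acc x ws gs y b (2 ^ bits y))

theorem totalWins_le (acc : List Symb → Bool) (x : List Symb) (ws gs : List (List Symb))
    (y b : List Symb) (n : ℕ) : totalWins acc x ws gs y b n ≤ n * ws.length := by
  refine (Finset.sum_le_sum fun j _ => List.countP_le_length).trans ?_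
  simp

/-- Try the advice at hand. -/
def tryAdvice (i : ι) : Mac (Var Name) S :=
  enum qst (choose i ;; evaluate i) ;; excess (posSum, 0) (negSum, 0) (found, 0)

/-- A bound for the time per evaluation. -/
def unitCost (t L r s : ℕ) : ℕ := (t + L + r + 1) * (s + 1)

/-- Acceptances and rejections accumulate in unary over all question tuples. Their truncated
difference is positive exactly when acceptances are in the strict majority, so no threshold has to
be computed. -/
theorem tryAdvice_runs {i : ι} {acc : List Symb → Bool} {t r L c : ℕ} {ws gs : List (List Symb)}
    {x y b : List Symb} {v : Var Name → List Symb} (hv : Idle v) (hx : v (inp, 0) = x)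
    (hy : v (qst, 0) = fill y 0) (hb : v (ans, 0) = fill b 0)
    (ha : v (adv, 0) = gs.flatMap (none :: ·))
    (hw : v (coins, 0) = flat ws) (hL : x.length + (y ++ b).length ≤ L)
    (hr : ∀ w ∈ ws, w.length ≤ r) (hn : ∀ w ∈ ws, none ∉ w)
    (hg : ∀ g ∈ gs, g.length = (y ++ b).length)
    (hs : ∀ j n, ∀ g ∈ gs, ∀ w ∈ ws,
      Verifies S i acc t (x ++ List.zipWith select (fill y j ++ fill b n) g ++ (w ++ [none])))
    (hs' : ∀ j n, ∀ w ∈ ws, Verifies S i acc t (x ++ (fill y j ++ fill b n) ++ (w ++ [none])))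
    (hf : v (ans, 2) = []) (hf' : v (qst, 2) = []) (h₁ : v (bestAns, 0) = [])
    (h₂ : v (bestScore, 0) = []) (h₃ : v (posSum, 0) = []) (h₄ : v (negSum, 0) = [])
    (h₅ : v (found, 0) = List.replicate c none) :
    (tryAdvice i : Mac (Var Name) S).Runs v (update v
      (found, 0) (List.replicate (c + surplus acc x ws gs y b) none))
      (200 * unitCost t L r ws.length * (gs.length + 1) * 2 ^ bits b * 2 ^ bits y) := by
  have hle : ∀ j, roundWins acc x ws gs (fill y j) b ≤ ws.length := fun j => List.countP_le_length
  have := enum_runs (S := S) (n := qst) (P := choose i ;; evaluate i) (z := y)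
    (fun n => update (update v (posSum, 0) (List.replicate (totalWins acc x ws gs y b n) none))
      (negSum, 0) (List.replicate (n * ws.length - totalWins acc x ws gs y b n) none))
    (t := 150 * unitCost t L r ws.length * (gs.length + 1) * 2 ^ bits b)
    ?_ ?_ ?_ ?_
  · have ht := totalWins_le acc x ws gs y b (2 ^ bits y)
    refine ((this.conv ?_ rfl le_rfl).seq (excess_runs (by simp) (by simp) (by simp) _)).conv
      rfl ?_ ?_
    · refine ext_on [(posSum, 0), (negSum, 0)] (by simp [h₃, h₄, totalWins]) fun X hX => ?_
      simp only [List.mem_cons, not_or, List.not_mem_nil, not_false_eq_true, and_true] at hX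
      simp [hX]
    · refine ext_on [(posSum, 0), (negSum, 0), (found, 0)] ?_ fun X hX => ?_
      · simp [h₃, h₄, h₅, surplus, Nat.add_comm]
      · simp only [List.mem_cons, not_or, List.not_mem_nil, not_false_eq_true, and_true] at hX
        simp [hX]
    · simp
      have hU : L + 1 + ws.length ≤ unitCost t L r ws.length := by
        unfold unitCost; ring_nf; omega
      have h1 : 1 ≤ 2 ^ bits b := Nat.one_le_two_pow
      have h2 : 1 ≤ 2 ^ bits y := Nat.one_le_two_pow
      have h3 : unitCost t L r ws.length ≤
        unitCost t L r ws.length * (gs.length + 1) * 2 ^ bits b :=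
        (Nat.le_mul_of_pos_right _ (by omega)).trans (Nat.le_mul_of_pos_right _ (by omega))
      have h4 : y.length ≤ L := by simp at hL; omega
      set A := unitCost t L r ws.length * (gs.length + 1) * 2 ^ bits b with hA
      have e1 : 150 * unitCost t L r ws.length * (gs.length + 1) * 2 ^ bits b = 150 * A := by
        rw [hA]; ring
      have e2 : 200 * unitCost t L r ws.length * (gs.length + 1) * 2 ^ bits b * 2 ^ bits y =
        200 * A * 2 ^ bits y := by rw [hA]; ring
      rw [e1, e2]
      have h5 : (150 * A + 4 * y.length + 4) + 4 + 3 * ws.length + 2 * ws.length ≤ 200 * A := by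
        omega
      have h6 := Nat.mul_le_mul_right (2 ^ bits y) h5
      have h7 : 2 ^ bits y * ws.length = ws.length * 2 ^ bits y := Nat.mul_comm _ _
      rw [h7] at ht ⊢
      ring_nf at h6 ht ⊢
      omega
  · simp [hy]
  · simp [hv.shadow]
  · simp [hf']
  · intro n hn'
    have hI : Idle (update (update (update v (posSum, 0)
        (List.replicate (totalWins acc x ws gs y b n) none)) (negSum, 0)
        (List.replicate (n * ws.length - totalWins acc x ws gs y b n) none)) (qst, 0)
          (fill y n)) :=
      ((hv.update (by simp) (by simp)).update (by simp) (by simp)).update (by simp) (by simp)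
    have e₁ := firstMax_le (fun m => scoreVal_le acc x ws gs (fill y n ++ fill b m)) (2 ^ bits b)
    have e₂ := totalWins_le acc x ws gs y b n
    have e₃ := hle n
    refine ((choose_runs (acc := acc) (t := t) (r := r) (L := L) hI (x := x) (y := fill y n) (b := b)
      (gs := gs) (ws := ws) ?_ ?_ ?_ ?_ ?_ ?_ hr hn ?_ (hs n) ?_ ?_ ?_).seq (evaluate_runs
      (acc := acc) (t := t) (r := r) (L := L) (x := x) (y := fill y n) (ws := ws)
      (b := fill b (firstMax (fun m => scoreVal acc x ws gs (fill y n ++ fill b m)) (2 ^ bits b)).2)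
      (m := (firstMax (fun m => scoreVal acc x ws gs (fill y n ++ fill b m)) (2 ^ bits b)).1)
      (p := totalWins acc x ws gs y b n)
      (n := n * ws.length - totalWins acc x ws gs y b n)
      ((hI.update (by simp) (by simp)).update (by simp) (by simp))
      ?_ ?_ ?_ ?_ ?_ ?_ ?_ ?_ hr hn (hs' n _))).conv rfl ?_ ?_
    · simp [hx]
    · simp
    · simp [hb]
    · simp [ha]
    · simp [hw]
    · simpa using hL
    · simpa using hg
    · simp [hf]
    · simp [h₁]
    · simp [h₂]
    · simp [hx]
    · simp
    · simp
    · simp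
    · simp
    · simp
    · simp [hw]
    · simpa using hL
    · have hT : totalWins acc x ws gs y b (n + 1) =
        totalWins acc x ws gs y b n + roundWins acc x ws gs (fill y n) b :=
        Finset.sum_range_succ _ _
      refine ext_on [(posSum, 0), (negSum, 0), (qst, 0), (bestAns, 0), (bestScore, 0)] ?_
        fun X hX => ?_
      · rw [hT]
        change _ ≤ ws.length at e₃
        simp only [roundWins] at e₃
        simp [h₁, h₂, roundWins]
        rw [Nat.add_mul]; omega
      · simp only [List.mem_cons, not_or, List.not_mem_nil, not_false_eq_true, and_true] at hX
        simp [hX]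
    · set f := (firstMax (fun m => scoreVal acc x ws gs (fill y n ++ fill b m)) (2 ^ bits b)).1
      have h1 : 1 ≤ 2 ^ bits b := Nat.one_le_two_pow
      set U := unitCost t L r ws.length with hU
      have u1 : (t + 5 * L + 5 * r + 26) * ws.length + 22 * L + 22 ≤ 30 * U := by
        rw [hU]; unfold unitCost; ring_nf; omega
      have u2 : 22 * L + 34 ≤ 34 * U := by rw [hU]; unfold unitCost; ring_nf; omega
      have u3 : 27 * L + 35 + (t + 5 * L + 5 * r + 16) * ws.length ≤ 40 * U := by
        rw [hU]; unfold unitCost; ring_nf; omega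
      have u4 : f ≤ U * (gs.length + 1) := e₁.trans (Nat.mul_le_mul (by
        rw [hU]; unfold unitCost; ring_nf; omega) (by omega))
      have u5 : ((t + 5 * L + 5 * r + 26) * ws.length + 22 * L + 22) * gs.length + 22 * L + 34 ≤
          34 * (U * (gs.length + 1)) := by
        have := Nat.mul_le_mul_right gs.length u1
        ring_nf at this u2 ⊢; omega
      have u6 := Nat.mul_le_mul_right (2 ^ bits b) u5
      have u7 : U * (gs.length + 1) ≤ U * (gs.length + 1) * 2 ^ bits b :=
        Nat.le_mul_of_pos_right _ (by omega)
      have u8 : U ≤ U * (gs.length + 1) := Nat.le_mul_of_pos_right _ (by omega)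
      have e : 150 * U * (gs.length + 1) * 2 ^ bits b = 150 * (U * (gs.length + 1) * 2 ^ bits b) := by
        ring
      rw [e]
      have e' : 34 * (U * (gs.length + 1)) * 2 ^ bits b =
        34 * (U * (gs.length + 1) * 2 ^ bits b) := by ring
      rw [e'] at u6
      omega

/-- Search for advice with which the answers are accepted more often than rejected. -/
def search (i : ι) : Mac (Var Name) S := enum adv (tryAdvice i)

/-- The advice stack is itself a binary counter: marks and separators stay in place while its bits
run through all values. The search has no early exit; it adds up the surpluses of all pieces of
advice. -/
theorem search_runs {i : ι} {acc : List Symb → Bool} {t r L k : ℕ} {ws : List (List Symb)}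
    {x y b z : List Symb} {gs : ℕ → List (List Symb)} {v : Var Name → List Symb} (hv : Idle v)
    (hx : v (inp, 0) = x) (hy : v (qst, 0) = fill y 0) (hb : v (ans, 0) = fill b 0)
    (ha : v (adv, 0) = fill z 0) (hz : ∀ n < 2 ^ bits z, fill z n = (gs n).flatMap (none :: ·))
    (hk : ∀ n < 2 ^ bits z, (gs n).length = k)
    (hw : v (coins, 0) = flat ws) (hL : x.length + (y ++ b).length ≤ L)
    (hr : ∀ w ∈ ws, w.length ≤ r) (hn : ∀ w ∈ ws, none ∉ w)
    (hg : ∀ n < 2 ^ bits z, ∀ g ∈ gs n, g.length = (y ++ b).length)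
    (hs : ∀ m < 2 ^ bits z, ∀ j n, ∀ g ∈ gs m, ∀ w ∈ ws,
      Verifies S i acc t (x ++ List.zipWith select (fill y j ++ fill b n) g ++ (w ++ [none])))
    (hs' : ∀ j n, ∀ w ∈ ws, Verifies S i acc t (x ++ (fill y j ++ fill b n) ++ (w ++ [none])))
    (hf : ∀ n, v (n, 2) = []) (h₁ : v (bestAns, 0) = [])
    (h₂ : v (bestScore, 0) = []) (h₃ : v (posSum, 0) = []) (h₄ : v (negSum, 0) = [])
    (h₅ : v (found, 0) = []) :
    (search i : Mac (Var Name) S).Runs v (update v (found, 0) (List.replicate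
      (∑ n ∈ Finset.range (2 ^ bits z), surplus acc x ws (gs n) y b) none))
      (300 * (unitCost t L r ws.length * (k + 1) * 2 ^ bits b * 2 ^ bits y * 2 ^ bits z)) := by
  have := enum_runs (S := S) (n := adv) (P := tryAdvice i) (z := z)
    (fun m => update v (found, 0) (List.replicate
      (∑ n ∈ Finset.range m, surplus acc x ws (gs n) y b) none))
    (t := 200 * unitCost t L r ws.length * (k + 1) * 2 ^ bits b * 2 ^ bits y)
    ?_ ?_ ?_ ?_
  · refine this.conv ?_ rfl ?_
    · refine ext_on [(found, 0)] (by simp [h₅]) fun X hX => ?_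
      simp only [List.mem_cons, not_or, List.not_mem_nil, not_false_eq_true, and_true] at hX
      simp [hX]
    · have hl : z.length = ((y ++ b).length + 1) * k := by
        have e : ∀ l : List (List Symb), (∀ g ∈ l, g.length = (y ++ b).length) →
            (l.flatMap (none :: ·)).length = ((y ++ b).length + 1) * l.length := by
          intro l hl
          induction l with
          | nil => simp
          | cons g l ih =>
            have h₁ := ih fun g hg' => hl g (by simp [hg'])
            have h₂ := hl g (by simp)
            simp only [List.flatMap_cons, List.length_append, List.length_cons] at h₁ h₂ ⊢
            rw [h₁, h₂]; ring
        rw [← length_fill z 0, hz 0 (by positivity), e _ (hg 0 (by positivity)),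
          hk 0 (by positivity)]
      have hU : L + 1 ≤ unitCost t L r ws.length := by
        unfold unitCost; ring_nf; omega
      have h4 : z.length + 1 ≤ unitCost t L r ws.length * (k + 1) := by
        rw [hl]
        have h6 : (y ++ b).length + 1 ≤ unitCost t L r ws.length := by omega
        have := Nat.mul_le_mul_right k h6
        ring_nf at this hU ⊢; omega
      have h1 : 1 ≤ 2 ^ bits b := Nat.one_le_two_pow
      have h2 : 1 ≤ 2 ^ bits y := Nat.one_le_two_pow
      have h7 : 1 ≤ 2 ^ bits z := Nat.one_le_two_pow
      have h3 : unitCost t L r ws.length * (k + 1) ≤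
        unitCost t L r ws.length * (k + 1) * 2 ^ bits b * 2 ^ bits y :=
        (Nat.le_mul_of_pos_right _ (by omega)).trans (Nat.le_mul_of_pos_right _ (by omega))
      set A := unitCost t L r ws.length * (k + 1) * 2 ^ bits b * 2 ^ bits y with hA
      have e1 : 200 * unitCost t L r ws.length * (k + 1) * 2 ^ bits b * 2 ^ bits y = 200 * A := by
        rw [hA]; ring
      rw [e1]
      have h5 : (200 * A + 4 * z.length + 4) + 2 ≤ 300 * A := by omega
      have h6 := Nat.mul_le_mul_right (2 ^ bits z) h5
      ring_nf at h6 ⊢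
      omega
  · simp [ha]
  · simp [hv.shadow]
  · simp [hf]
  · intro n hn'
    have hI : Idle (update (update v (found, 0) (List.replicate
      (∑ n ∈ Finset.range n, surplus acc x ws (gs n) y b) none)) (adv, 0) (fill z n)) :=
      (hv.update (by simp) (by simp)).update (by simp) (by simp)
    refine (tryAdvice_runs (acc := acc) (t := t) (r := r) (L := L) hI (x := x) (y := y) (b := b)
      (gs := gs n) (ws := ws) (c := ∑ n ∈ Finset.range n, surplus acc x ws (gs n) y b)
      ?_ ?_ ?_ ?_ ?_ ?_ hr hn (hg n hn') (hs n hn') hs' ?_ ?_ ?_ ?_ ?_ ?_ ?_).conv rfl ?_ ?_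
    · simp [hx]
    · simp [hy]
    · simp [hb]
    · simp [hz n hn']
    · simp [hw]
    · simpa using hL
    · simp [hf]
    · simp [hf]
    · simp [h₁]
    · simp [h₂]
    · simp [h₃]
    · simp [h₄]
    · simp
    · refine ext_on [(found, 0), (adv, 0)] (by simp [Finset.sum_range_succ]) fun X hX => ?_
      simp only [List.mem_cons, not_or, List.not_mem_nil, not_false_eq_true, and_true] at hX
      simp [hX]
    · rw [hk n hn']

end Mac

/-! ### Unary arithmetic and the templates for questions, answers, advice and coins -/

namespace Mac

variable {ι : Type} [DecidableEq ι] {S : ι → SubMachine}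

open Function (update)
open Name

/-- The symbol used for numbers in unary, and for bits that are to be filled in. -/
abbrev one : Symb := some (false, false)

/-- The body is run in the middle of a traversal of `n`, so it has to work for all stacks that agree
with `v` away from the traversed stack and the target. -/
theorem forEach_append {N : Type} [DecidableEq N] {n b : N} {f : Mac (Var N) S} {l : List Symb}
    {t c : ℕ} {v : Var N → List Symb} (hb : b ≠ n) (hn : v (n, 1) = [])
    (hc : (v (n, 0)).length = c)
    (h : ∀ u : Var N → List Symb, (∀ X, X ≠ (b, 0) → X ≠ (n, 0) → X ≠ (n, 1) → u X = v X) →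
      f.Runs u (update u (b, 0) (l ++ u (b, 0))) t) :
    (forEach n fun _ => f).Runs v (update v (b, 0) ((List.replicate c l).flatten ++ v (b, 0)))
      ((t + 4) * c + 2) := by
  have := forEach_runs (S := S) (n := n) (f := fun _ => f) (l := v (n, 0)) (t := t)
    (fun pre => update v (b, 0) ((List.replicate pre.length l).flatten ++ v (b, 0))) ?_
  · refine this.conv ?_ ?_ (by simp [hc])
    · refine ext_on [(n, 0), (n, 1), (b, 0)] (by simp [trav, hn, hb]) fun X hX => ?_
      simp only [List.mem_cons, not_or, List.not_mem_nil, not_false_eq_true, and_true] at hX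
      simp [trav, hX]
    · rw [hc]
      refine ext_on [(n, 0), (n, 1), (b, 0)] (by simp [trav, hn, hb, hb.symm]) fun X hX => ?_
      simp only [List.mem_cons, not_or, List.not_mem_nil, not_false_eq_true, and_true] at hX
      simp [trav, hX]
  · intro pre s suf hp
    refine (h _ fun X h₁ h₂ h₃ => by simp [trav, h₁, h₂, h₃]).conv rfl ?_ le_rfl
    refine ext_on [(n, 0), (n, 1), (b, 0)] (by simp [trav, hb, hb.symm, List.replicate_succ])
      fun X hX => ?_
    simp only [List.mem_cons, not_or, List.not_mem_nil, not_false_eq_true, and_true] at hX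
    simp [trav, hX]

/-- `c` blocks of `q` bits with mark `m`. -/
def blockStr (m : Bool) (q c : ℕ) : List Symb :=
  (List.replicate c (List.replicate q (some (m, false)) ++ [none])).flatten

theorem length_blockStr (m : Bool) (q c : ℕ) : (blockStr m q c).length = (q + 1) * c := by
  simp [blockStr, Nat.mul_comm]

/-- Push a block onto `b`. -/
def pushBlock (m : Bool) (q b : Name) : Mac (Var Name) S :=
  push (b, 0) none ;; copyRev q (b, 0) fun _ => some (m, false)

theorem pushBlock_runs {m : Bool} {q b : Name} {d : ℕ} {v : Var Name → List Symb} (hb : b ≠ q)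
    (h : v (q, 1) = []) (hd : v (q, 0) = List.replicate d one) :
    (pushBlock m q b : Mac (Var Name) S).Runs v
      (update v (b, 0) (List.replicate d (some (m, false)) ++ [none] ++ v (b, 0))) (5 * d + 3) := by
  refine ((push_runs _ _ _).seq (copyRev_runs (by simp [hb]) (by simp) (by simp [h]))).congr ?_ ?_
  · simp [hb.symm, hd]
  · simp [hb.symm, hd]; omega

/-- Push as many blocks onto `b` as there are symbols on `n`. -/
def pushBlocks (m : Bool) (n q b : Name) : Mac (Var Name) S := forEach n fun _ => pushBlock m q b

theorem pushBlocks_runs {m : Bool} {n q b : Name} {c d : ℕ} {v : Var Name → List Symb} (hb : b ≠ q)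
    (hb' : b ≠ n) (hn : n ≠ q) (h : v (q, 1) = []) (h' : v (n, 1) = [])
    (hc : v (n, 0) = List.replicate c one) (hd : v (q, 0) = List.replicate d one) :
    (pushBlocks m n q b : Mac (Var Name) S).Runs v
      (update v (b, 0) (blockStr m d c ++ v (b, 0))) ((5 * d + 7) * c + 2) :=
  forEach_append hb' h' (by simp [hc]) fun u hu => pushBlock_runs hb
    (by rw [hu, h] <;> simp [hn.symm]) (by rw [hu, hd] <;> simp [hn.symm, hb.symm])

/-- A block of advice in which the part of the `c`-th Merlin is marked, when there are `d` Merlins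
after him. -/
def adviceStr (q a c d : ℕ) : List Symb :=
  blockStr false q c ++ (blockStr true q 1 ++ (blockStr false q d ++
    (blockStr false a c ++ (blockStr true a 1 ++ blockStr false a d))))

/-- Push a block of advice. -/
def pushAdvice : Mac (Var Name) S :=
  pushBlocks false tmp cntA adv ;; pushBlock true cntA adv ;; pushBlocks false tmp2 cntA adv ;;
    pushBlocks false tmp cntQ adv ;; pushBlock true cntQ adv ;; pushBlocks false tmp2 cntQ adv ;;
      push (adv, 0) none

/-- The block is built from the bottom of the stack, hence backwards. The stack `cnt` is exempted in
`h` because it is being traversed when this program runs. -/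
theorem pushAdvice_runs {q a c d : ℕ} {v : Var Name → List Symb} (h : ∀ n, n ≠ cnt → v (n, 1) = [])
    (hq : v (cntQ, 0) = List.replicate q one) (ha : v (cntA, 0) = List.replicate a one)
    (hc : v (tmp2, 0) = List.replicate c one) (hd : v (tmp, 0) = List.replicate d one) :
    (pushAdvice : Mac (Var Name) S).Runs v
      (update v (adv, 0) (none :: adviceStr q a c d ++ v (adv, 0)))
      ((5 * (q + a) + 14) * (c + d + 1) + 16) := by
  refine ((pushBlocks_runs (c := d) (d := a) (by simp) (by simp) (by simp) ?_ ?_ ?_ ?_).seq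
    ((pushBlock_runs (d := a) (by simp) ?_ ?_).seq
    ((pushBlocks_runs (c := c) (d := a) (by simp) (by simp) (by simp) ?_ ?_ ?_ ?_).seq
    ((pushBlocks_runs (c := d) (d := q) (by simp) (by simp) (by simp) ?_ ?_ ?_ ?_).seq
    ((pushBlock_runs (d := q) (by simp) ?_ ?_).seq
    ((pushBlocks_runs (c := c) (d := q) (by simp) (by simp) (by simp) ?_ ?_ ?_ ?_).seq
      (push_runs _ _ _))))))).congr ?_ ?_
  all_goals try simp [h, hq, ha, hc, hd]
  · simp [adviceStr, blockStr]
  · ring_nf; omega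

/-- Multiply the number on `cnt` by the one on `n`. -/
def scale (n : Name) : Mac (Var Name) S :=
  mv (cnt, 0) (tmp, 0) ;; forEach n (fun _ => copyRev tmp (cnt, 0) id) ;; clear (tmp, 0)

theorem scale_runs {n : Name} {c m : ℕ} {v : Var Name → List Symb} (hn : n ≠ cnt) (hn' : n ≠ tmp)
    (h : ∀ n, v (n, 1) = []) (ht : v (tmp, 0) = []) (hc : v (n, 0) = List.replicate c one)
    (hm : v (cnt, 0) = List.replicate m one) :
    (scale n : Mac (Var Name) S).Runs v (update v (cnt, 0) (List.replicate (m * c) one))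
      ((5 * m + 6) * c + 4 * m + 4) := by
  refine ((mv_runs (by simp) _).seq ((forEach_append (l := List.replicate m one) (c := c)
    (t := 5 * m + 2) hn.symm ?_ ?_ fun u hu => (copyRev_runs (by simp) (by simp) ?_).congr ?_ ?_).seq
      (clear_runs _))).congr ?_ ?_
  · simp [h]
  · simp [hn, hn', hc]
  · rw [hu] <;> simp [hn'.symm, h]
  · rw [hu] <;> simp [hn'.symm, hm, ht]
  · rw [hu] <;> simp [hn'.symm, hm, ht]
  · refine ext_on [(cnt, 0), (tmp, 0)] ?_ fun X hX => ?_
    · simp [hm, ht, Nat.mul_comm]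
    · simp only [List.mem_cons, not_or, List.not_mem_nil, not_false_eq_true, and_true] at hX
      simp [hX]
  · simp [hm, ht]; ring_nf; omega

/-- Push `c` marks. -/
def pushMarks {V : Type} [DecidableEq V] (b : V) : ℕ → Mac V S
  | 0 => skip
  | c + 1 => push b one ;; pushMarks b c

theorem pushMarks_runs {V : Type} [DecidableEq V] (b : V) (c : ℕ) (v : V → List Symb) :
    (pushMarks b c : Mac V S).Runs v (update v b (List.replicate c one ++ v b)) (c + 1) := by
  induction c generalizing v with
  | zero => exact (skip_runs v).congr (by simp) le_rfl
  | succ c ih =>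
    refine ((push_runs _ _ _).seq (ih _)).congr ?_ (by omega)
    simp [List.replicate_succ']

/-- The number of blocks of advice for each Merlin. -/
def samples (c k a : ℕ) : ℕ := (c * a + c) * k * k

/-- Compute `samples`. -/
def countSamples (c : ℕ) : Mac (Var Name) S :=
  pushMarks (cnt, 0) c ;; scale cntA ;; pushMarks (cnt, 0) c ;; scale cntK ;; scale cntK

theorem countSamples_runs {c k a : ℕ} {v : Var Name → List Symb}
    (h : ∀ n, v (n, 1) = []) (ht : v (tmp, 0) = []) (hk : v (cntK, 0) = List.replicate k one)
    (ha : v (cntA, 0) = List.replicate a one) (hm : v (cnt, 0) = []) :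
    (countSamples c : Mac (Var Name) S).Runs v (update v (cnt, 0) (List.replicate (samples c k a) one))
      (100 * (c + 1) * (a + 1) * (k + 1) * (k + 1)) := by
  refine ((pushMarks_runs _ _ _).seq ((scale_runs (c := a) (m := c) (by simp) (by simp) ?_ ?_ ?_
    ?_).seq ((pushMarks_runs _ _ _).seq ((scale_runs (c := k) (m := c * a + c) (by simp)
    (by simp) ?_ ?_ ?_ ?_).seq (scale_runs (c := k) (m := (c * a + c) * k) (by simp)
    (by simp) ?_ ?_ ?_ ?_))))).congr ?_ ?_
  · simp [h]
  · simp [ht]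
  · simp [ha]
  · simp [hm]
  · simp [h]
  · simp [ht]
  · simp [hk]
  · simp [Nat.add_comm]
  · simp [h]
  · simp [ht]
  · simp [hk]
  · simp
  · simp [samples]
  · ring_nf; omega

/-- The template for the advice, for the first `j` of `k` Merlins. -/
def adviceTemplate (m k q a j : ℕ) : List Symb :=
  ((List.range j).map fun c =>
    (List.replicate m (none :: adviceStr q a c (k - 1 - c))).flatten).flatten

/-- Write down the template for the advice. -/
def pushTemplate : Mac (Var Name) S :=
  copy cntK tmp2 ;; whilePop (tmp2, 0) (fun s => forEach cnt (fun _ => pushAdvice) ;;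
    push (tmp, 0) s) ;; clear (tmp, 0)

/-- The blocks of the last Merlin are pushed first, so that those of the first one end up on top.
After each pop, `tmp2` counts the Merlins before the current one and `tmp` those after him. -/
theorem pushTemplate_loop {m k q a : ℕ} {v : Var Name → List Symb} (h : ∀ n, v (n, 1) = [])
    (hq : v (cntQ, 0) = List.replicate q one) (ha : v (cntA, 0) = List.replicate a one)
    (hm : v (cnt, 0) = List.replicate m one) (c d : ℕ) (hcd : c + d = k) (l : List Symb) :
    (whilePop (tmp2, 0) (fun s => forEach cnt (fun _ => pushAdvice) ;;
    push (tmp, 0) s) : Mac (Var Name) S).Runs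
      (update (update (update v (tmp2, 0) (List.replicate c one)) (tmp, 0) (List.replicate d one))
        (adv, 0) l)
      (update (update (update v (tmp2, 0) []) (tmp, 0) (List.replicate k one))
        (adv, 0) (adviceTemplate m k q a c ++ l))
      ((((5 * (q + a) + 14) * k + 20) * m + 4) * c + 1) := by
  induction c generalizing d l with
  | zero =>
    refine (loop_nil (by simp)).conv rfl ?_ (by omega)
    simp [adviceTemplate, ← hcd]
  | succ c ih =>
    refine (loop_cons (s := one) (l := List.replicate c one) (by simp [List.replicate_succ]) rfl
      ((forEach_append (l := none :: adviceStr q a c d) (c := m)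
      (t := (5 * (q + a) + 14) * (c + d + 1) + 16) (by simp) ?_ ?_
      fun u hu => pushAdvice_runs ?_ ?_ ?_ ?_ ?_).seq
      (push_runs _ _ _)) ((ih (d + 1) (by omega) ((List.replicate m
        (none :: adviceStr q a c d)).flatten ++ l)).conv ?_ rfl le_rfl)).conv rfl ?_ ?_
    · simp [h]
    · simp [hm]
    · intro n hn
      rw [hu] <;> simp [hn, h]
    · rw [hu] <;> simp [hq]
    · rw [hu] <;> simp [ha]
    · rw [hu] <;> simp
    · rw [hu] <;> simp
    · refine ext_on [(tmp2, 0), (tmp, 0), (adv, 0)] (by simp [List.replicate_succ]) fun X hX => ?_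
      simp only [List.mem_cons, not_or, List.not_mem_nil, not_false_eq_true, and_true] at hX
      simp [hX]
    · have : k - 1 - c = d := by omega
      simp [adviceTemplate, List.range_succ, this]
    · rw [show c + d + 1 = k by omega]
      ring_nf; omega

theorem pushTemplate_runs {m k q a : ℕ} {v : Var Name → List Symb} (h : ∀ n, v (n, 1) = [])
    (hk : v (cntK, 0) = List.replicate k one)
    (hq : v (cntQ, 0) = List.replicate q one) (ha : v (cntA, 0) = List.replicate a one)
    (hm : v (cnt, 0) = List.replicate m one) (h₁ : v (tmp, 0) = []) (h₂ : v (tmp2, 0) = [])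
    (h₃ : v (adv, 0) = []) :
    (pushTemplate : Mac (Var Name) S).Runs v (update v (adv, 0) (adviceTemplate m k q a k))
      ((((5 * (q + a) + 14) * k + 20) * m + 13) * k + 5) := by
  refine ((copy_runs (by simp) (h _) (h _)).seq (((pushTemplate_loop (k := k) (m := m) (q := q) (a := a)
    h hq ha hm k 0 (by omega) []).conv ?_ rfl le_rfl).seq (clear_runs _))).conv rfl ?_ ?_
  · refine ext_on [(tmp2, 0), (tmp, 0), (adv, 0)] (by simp [hk, h₁, h₂, h₃]) fun X hX => ?_
    simp only [List.mem_cons, not_or, List.not_mem_nil, not_false_eq_true, and_true] at hX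
    simp [hX]
  · refine ext_on [(tmp2, 0), (tmp, 0), (adv, 0)] (by simp [hk, h₁, h₂, h₃]) fun X hX => ?_
    simp only [List.mem_cons, not_or, List.not_mem_nil, not_false_eq_true, and_true] at hX
    simp [hX]
  · simp [hk]; ring_nf; omega

end Mac

theorem fill_zero {l : List Symb} (h : ∀ m, some (m, true) ∉ l) : fill l 0 = l := by
  induction l with
  | nil => rfl
  | cons s l ih =>
    have := ih fun m hm => h m (by simp [hm])
    rcases s with _ | ⟨m, _ | _⟩
    · simp [fill, this]
    · simp [fill, this]
    · exact absurd (by simp) (h m)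

@[simp] theorem bits_append (l l' : List Symb) : bits (l ++ l') = bits l + bits l' := by
  induction l with
  | nil => simp [bits]
  | cons s l ih => rcases s with _ | s <;> simp [bits, ih]; omega

@[simp] theorem bits_replicate_some (c : ℕ) (p : Bool × Bool) :
    bits (List.replicate c (some p)) = c := by
  induction c with
  | zero => rfl
  | succ c ih => simp [List.replicate_succ, bits, ih]

namespace Mac

variable {ι : Type} [DecidableEq ι] {S : ι → SubMachine}

open Function (update)
open Name

theorem bits_blockStr (m : Bool) (q c : ℕ) : bits (blockStr m q c) = q * c := by
  unfold blockStr
  induction c with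
  | zero => simp [bits]
  | succ c ih => rw [List.replicate_succ, List.flatten_cons, bits_append, ih]; simp [bits]; ring

theorem not_mem_blockStr (m m' : Bool) (q c : ℕ) : some (m', true) ∉ blockStr m q c := by
  simp [blockStr]

theorem not_mem_adviceTemplate (m k q a j : ℕ) (m' : Bool) :
    some (m', true) ∉ adviceTemplate m k q a j := by
  simp only [adviceTemplate, adviceStr]
  simp [not_mem_blockStr]

/-- All strings of `r` bits. -/
def allStrings (r n : ℕ) : List (List Symb) :=
  (List.range n).reverse.map fun j => (fill (List.replicate r one) j).reverse

/-- Write all strings of random bits onto `coins`. -/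
def enumCoins : Mac (Var Name) S :=
  enum cntR (push (coins, 0) none ;; copyRev cntR (coins, 0) id)

theorem enumCoins_runs {r : ℕ} {v : Var Name → List Symb} (h : v (cntR, 1) = [])
    (h' : v (cntR, 2) = []) (hr : v (cntR, 0) = List.replicate r one) (hc : v (coins, 0) = []) :
    (enumCoins : Mac (Var Name) S).Runs v (update v (coins, 0) (flat (allStrings r (2 ^ r))))
      ((9 * r + 7) * 2 ^ r + 2) := by
  have hz : fill (List.replicate r one) 0 = List.replicate r one := fill_zero (by simp)
  have := enum_runs (S := S) (n := cntR) (P := push (coins, 0) none ;; copyRev cntR (coins, 0) id)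
    (z := List.replicate r one)
    (fun n => update v (coins, 0) (flat (allStrings r n))) (t := 5 * r + 3) ?_ ?_ ?_ ?_
  · refine this.conv ?_ ?_ ?_
    · simp [allStrings, flat, ← hc]
    · simp
    · simp; ring_nf; omega
  · simp [hz, hr]
  · simp [h]
  · simp [h']
  · intro n _
    refine ((push_runs _ _ _).seq (copyRev_runs (by simp) (by simp) (by simp [h]))).congr ?_ ?_
    · refine ext_on [(cntR, 0), (coins, 0)] ?_ fun X hX => ?_
      · simp [allStrings, flat, List.range_succ]
      · simp only [List.mem_cons, not_or, List.not_mem_nil, not_false_eq_true, and_true] at hX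
        simp [hX]
    · simp; omega

/-- Double the number on `tmp` as many times as there are symbols on `n`. -/
def double (n : Name) : Mac (Var Name) S := forEach n fun _ => copy tmp tmp2 ;; mv (tmp2, 0) (tmp, 0)

theorem double_runs {n : Name} {c d : ℕ} {v : Var Name → List Symb} (hn : n ≠ tmp) (hn' : n ≠ tmp2)
    (h : ∀ n, v (n, 1) = []) (hc : v (tmp, 0) = List.replicate c one) (ht : v (tmp2, 0) = [])
    (hd : v (n, 0) = List.replicate d one) :
    (double n : Mac (Var Name) S).Runs v (update v (tmp, 0) (List.replicate (c * 2 ^ d) one))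
      ((9 * (c * 2 ^ d) + 8) * d + 2) := by
  have := forEach_runs (S := S) (n := n) (f := fun _ => copy tmp tmp2 ;; mv (tmp2, 0) (tmp, 0))
    (l := List.replicate d one)
    (fun pre => update v (tmp, 0) (List.replicate (c * 2 ^ pre.length) one))
    (t := 9 * (c * 2 ^ d) + 4) ?_
  · refine this.conv ?_ ?_ (by simp)
    · refine ext_on [(n, 0), (n, 1), (tmp, 0)] ?_ fun X hX => ?_
      · simp [trav, h, hn, hn.symm, hc, hd]
      · simp only [List.mem_cons, not_or, List.not_mem_nil, not_false_eq_true, and_true] at hX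
        simp [trav, hX]
    · refine ext_on [(n, 0), (n, 1), (tmp, 0)] ?_ fun X hX => ?_
      · simp [trav, h, hn, hn.symm, hc, hd]
      · simp only [List.mem_cons, not_or, List.not_mem_nil, not_false_eq_true, and_true] at hX
        simp [trav, hX]
  · intro pre s suf hp
    have hlen : pre.length + 1 ≤ d := by
      have := congrArg List.length hp
      simp at this; omega
    refine ((copy_runs (by simp) ?_ ?_).seq (mv_runs (by simp) _)).congr ?_ ?_
    · simp [trav, h, hn.symm]
    · simp [trav, h, hn'.symm]
    · refine ext_on [(n, 0), (n, 1), (tmp, 0), (tmp2, 0)] ?_ fun X hX => ?_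
      · simp [trav, hn, hn.symm, hn', hn'.symm, ht, pow_succ]; ring
      · simp only [List.mem_cons, not_or, List.not_mem_nil, not_false_eq_true, and_true] at hX
        simp [trav, hX]
    · have : c * 2 ^ pre.length ≤ c * 2 ^ d :=
        Nat.mul_le_mul_left _ (Nat.pow_le_pow_right (by norm_num) (by omega))
      simp [trav, hn.symm, hn'.symm, ht]
      omega

/-- Write down the template for the random strings. -/
def coinTemplate (c : ℕ) : Mac (Var Name) S :=
  pushMarks (tmp, 0) c ;; double cntQ ;; double cntA ;;
    forEach tmp (fun _ => copyRev cntR (tmp2, 0) id ;; push (tmp2, 0) none) ;; clear (tmp, 0)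

/-- The number of strings is written in unary by repeated doubling; this is affordable, as so many
strings have to be written anyway. Separators come first in each block because sampling will reverse
the template. -/
theorem coinTemplate_runs {c q a r : ℕ} {v : Var Name → List Symb} (h : ∀ n, v (n, 1) = [])
    (hq : v (cntQ, 0) = List.replicate q one) (ha : v (cntA, 0) = List.replicate a one)
    (hr : v (cntR, 0) = List.replicate r one) (h₁ : v (tmp, 0) = []) (h₂ : v (tmp2, 0) = []) :
    (coinTemplate c : Mac (Var Name) S).Runs v (update v (tmp2, 0)
      (List.replicate (c * 2 ^ q * 2 ^ a) (none :: List.replicate r one)).flatten)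
      ((9 * q + 9 * a + 5 * r + 11) * (c * 2 ^ q * 2 ^ a) + 8 * q + 8 * a + c + 8) := by
  have hle : c * 2 ^ q ≤ c * 2 ^ q * 2 ^ a := Nat.le_mul_of_pos_right _ (by positivity)
  refine ((pushMarks_runs _ _ _).seq ((double_runs (c := c) (d := q) (by simp) (by simp) ?_ ?_ ?_
    ?_).seq ((double_runs (c := c * 2 ^ q) (d := a) (by simp) (by simp) ?_ ?_ ?_ ?_).seq
    ((forEach_append (n := tmp) (b := tmp2) (l := none :: List.replicate r one) (c := c * 2 ^ q * 2 ^ a)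
      (t := 5 * r + 3) (by simp) ?_ ?_ fun u hu => ((copyRev_runs (by simp) (by simp) ?_).seq
      (push_runs _ _ _)).congr ?_ ?_).seq (clear_runs _))))).congr ?_ ?_
  · simp [h]
  · simp [h₁]
  · simp [h₂]
  · simp [hq]
  · simp [h]
  · simp
  · simp [h₂]
  · simp [ha]
  · simp [h]
  · simp
  · rw [hu] <;> simp [h]
  · simp [hu, hr]
  · rw [hu] <;> simp [hr]
  · refine ext_on [(tmp, 0), (tmp2, 0)] ?_ fun X hX => ?_
    · simp [h₁, h₂]
    · simp only [List.mem_cons, not_or, List.not_mem_nil, not_false_eq_true, and_true] at hX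
      simp [hX]
  · simp only [Function.update_self, Function.update_of_ne, ne_eq, Prod.mk.injEq, reduceCtorEq,
      false_and, not_false_eq_true, List.length_replicate]
    have := Nat.mul_le_mul_right q hle
    ring_nf at this ⊢
    omega

/-- The subroutine `i` computes the number `c` from the number `n`, in unary. -/
def Computes (S : ι → SubMachine) (i : ι) (n c t : ℕ) : Prop :=
  ∀ (v : Var Name → List Symb) (b : Name), v (arg, 0) = List.replicate n one →
    (call (S := S) i (arg, 0) (b, 0)).Runs v (update (update v (arg, 0) []) (b, 0)
      (List.replicate c one ++ update v (arg, 0) [] (b, 0))) t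

/-- Compute a number from the length of the input. -/
def loadNum (i : ι) (b : Name) : Mac (Var Name) S :=
  copyRev len (arg, 0) id ;; call i (arg, 0) (b, 0)

theorem loadNum_runs {i : ι} {n c t : ℕ} {b : Name} (hi : Computes S i n c t)
    {v : Var Name → List Symb} (h : v (len, 1) = []) (hn : v (len, 0) = List.replicate n one)
    (ha : v (arg, 0) = []) (hb : b ≠ arg) (hv : v (b, 0) = []) :
    (loadNum i b : Mac (Var Name) S).Runs v (update v (b, 0) (List.replicate c one))
      (5 * n + 2 + t) := by
  refine ((copyRev_runs (by simp) (by simp) h).seq (hi _ _ (by simp [hn, ha]))).congr ?_ (by simp [hn])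
  refine ext_on [(arg, 0), (b, 0)] ?_ fun X hX => ?_
  · simp [hb, hb.symm, hv, ha]
  · simp only [List.mem_cons, not_or, List.not_mem_nil, not_false_eq_true, and_true] at hX
    simp [hX]

/-- The stacks after the preparations. -/
def setupStk (x : List Bool) (m k q a r : ℕ) : Var Name → List Symb :=
  update (update (update (update (update (update (update (update (fun _ => [])
    (inp, 0) ((x.map fun b => some (false, b)) ++ [none])) (cntK, 0) (List.replicate k one))
    (cntQ, 0) (List.replicate q one)) (cntA, 0) (List.replicate a one))
    (cntR, 0) (List.replicate r one)) (qst, 0) (blockStr false q k)) (ans, 0) (blockStr false a k))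
    (adv, 0) (adviceTemplate m k q a k)

/-- Read the input. -/
def readInput : Mac (Var Name) S :=
  readTape (inp, 1) (len, 0) ;; push (inp, 0) none ;; mv (inp, 1) (inp, 0)

theorem readInput_runs (x : List Bool) :
    (readInput : Mac (Var Name) S).RunsTape x (fun _ => []) [] (update (update (fun _ => [])
      (inp, 0) ((x.map fun b => some (false, b)) ++ [none])) (len, 0) (List.replicate x.length one))
      (3 * x.length + 3) := by
  refine ((readTape_runs (by simp) x _).seq ((push_runs _ _ _).seq (mv_runs (by simp) _))).congr ?_ ?_
  · refine ext_on [(inp, 0), (inp, 1), (len, 0)] ?_ fun X hX => ?_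
    · simp
    · simp only [List.mem_cons, not_or, List.not_mem_nil, not_false_eq_true, and_true] at hX
      simp [hX]
  · simp; omega

/-- Preparations: read the input, compute the parameters, and write down the templates. -/
def setup (c : ℕ) (iK iQ iA iR : ι) : Mac (Var Name) S :=
  readInput ;; loadNum iK cntK ;; loadNum iQ cntQ ;; loadNum iA cntA ;; loadNum iR cntR ;;
    clear (len, 0) ;; pushBlocks false cntK cntQ qst ;; pushBlocks false cntK cntA ans ;;
      countSamples c ;; pushTemplate ;; clear (cnt, 0)

/-- A bound for the time that the preparations take. -/
def setupCost (c n k q a t : ℕ) : ℕ :=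
  200 * (c + 1) * (q + a + 1) * (k + 1) * (k + 1) +
    (((5 * (q + a) + 14) * k + 20) * samples c k a + 13) * k + 2 * samples c k a + 30 * n + t + 50

theorem setup_runs {c : ℕ} {iK iQ iA iR : ι} {x : List Bool} {k q a r tk tq ta tr : ℕ}
    (hk : Computes S iK x.length k tk) (hq : Computes S iQ x.length q tq)
    (ha : Computes S iA x.length a ta) (hr : Computes S iR x.length r tr) :
    (setup c iK iQ iA iR : Mac (Var Name) S).RunsTape x (fun _ => []) []
      (setupStk x (samples c k a) k q a r)
      (setupCost c x.length k q a (tk + tq + ta + tr)) := by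
  refine ((readInput_runs x).seq ((loadNum_runs hk ?_ ?_ ?_ ?_ ?_).seq
    ((loadNum_runs hq ?_ ?_ ?_ ?_ ?_).seq ((loadNum_runs ha ?_ ?_ ?_ ?_ ?_).seq
    ((loadNum_runs hr ?_ ?_ ?_ ?_ ?_).seq ((clear_runs _).seq
    ((pushBlocks_runs (c := k) (d := q) ?_ ?_ ?_ ?_ ?_ ?_ ?_).seq
    ((pushBlocks_runs (c := k) (d := a) ?_ ?_ ?_ ?_ ?_ ?_ ?_).seq
    ((countSamples_runs (c := c) (k := k) (a := a) ?_ ?_ ?_ ?_ ?_).seq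
    ((pushTemplate_runs (m := samples c k a) (k := k) (q := q) (a := a) ?_ ?_ ?_ ?_ ?_ ?_ ?_ ?_).seq
    (clear_runs _))))))))))).congr ?_ ?_
  rotate_right 2
  · refine ext_on [(len, 0), (cnt, 0), (inp, 0), (cntK, 0), (cntQ, 0), (cntA, 0), (cntR, 0),
      (qst, 0), (ans, 0), (adv, 0)] ?_ fun X hX => ?_
    · simp [setupStk]
    · simp only [List.mem_cons, not_or, List.not_mem_nil, not_false_eq_true, and_true] at hX
      simp [setupStk, hX]
  · simp only [Function.update_self, Function.update_of_ne, ne_eq, Prod.mk.injEq, reduceCtorEq,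
      false_and, not_false_eq_true, List.length_replicate, setupCost]
    ring_nf
    omega
  all_goals simp

/-! ### Delivering the answer -/

/-- Empty the stacks in a list. -/
def clearAll {V : Type} [DecidableEq V] : List V → Mac V S
  | [] => skip
  | a :: l => clear a ;; clearAll l

theorem clearAll_runs {V : Type} [DecidableEq V] (l : List V) (v : V → List Symb) :
    (clearAll l : Mac V S).Runs v (fun X => if X ∈ l then [] else v X)
      ((l.map fun X => 2 * (v X).length + 1).sum + 1) := by
  induction l generalizing v with
  | nil => exact (skip_runs v).congr (by simp) le_rfl
  | cons a l ih =>
    refine ((clear_runs v).seq (ih _)).congr ?_ ?_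
    · funext X
      by_cases h : X = a <;> simp [h]
    · have : (l.map fun X => 2 * (update v a [] X).length + 1).sum ≤
          (l.map fun X => 2 * (v X).length + 1).sum := by
        refine List.sum_le_sum fun X _ => ?_
        by_cases h : X = a
        · subst h; simp
        · simp [h]
      simp only [List.map_cons, List.sum_cons]
      omega

/-- Search for advice, and answer whether there is any. -/
def answer (i : ι) : Mac (Var Name) S :=
  search i ;; pop (found, 0) fun o => clearAll [(inp, 0), (cntK, 0), (cntQ, 0), (cntA, 0), (cntR, 0),
    (qst, 0), (ans, 0), (adv, 0), (coins, 0), (found, 0)] ;; pushTape o.isSome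

theorem length_flatMap_cons {l : List (List Symb)} {n : ℕ} (hl : ∀ g ∈ l, g.length = n) :
    (l.flatMap (none :: ·)).length = (n + 1) * l.length := by
  induction l with
  | nil => simp
  | cons g l ih =>
    have h₁ := ih fun g hg' => hl g (by simp [hg'])
    have h₂ := hl g (by simp)
    simp only [List.flatMap_cons, List.length_append, List.length_cons] at h₁ h₂ ⊢
    rw [h₁, h₂]; ring

/-- A Turing machine counts as having answered only if all stacks except the output are empty. The
time for clearing them is absorbed by the time of the search. -/
theorem answer_runs {i : ι} {acc : List Symb → Bool} {t L m k q a r g : ℕ} {ws : List (List Symb)}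
    {x : List Bool} {y : List Symb} {gs : ℕ → List (List Symb)}
    (hy : y = (x.map fun b => some (false, b)) ++ [none])
    (hz : ∀ n < 2 ^ bits (adviceTemplate m k q a k),
      fill (adviceTemplate m k q a k) n = (gs n).flatMap (none :: ·))
    (hk : ∀ n < 2 ^ bits (adviceTemplate m k q a k), (gs n).length = g)
    (hL : x.length + 1 + (q + 1) * k + (a + 1) * k ≤ L)
    (hr : ∀ w ∈ ws, w.length ≤ r) (hn : ∀ w ∈ ws, none ∉ w)
    (hg : ∀ n < 2 ^ bits (adviceTemplate m k q a k), ∀ g ∈ gs n,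
      g.length = (q + 1) * k + (a + 1) * k)
    (hs : ∀ l < 2 ^ bits (adviceTemplate m k q a k), ∀ j n, ∀ g ∈ gs l, ∀ w ∈ ws,
      Verifies S i acc t (y ++ List.zipWith select (fill (blockStr false q k) j ++
        fill (blockStr false a k) n) g ++ (w ++ [none])))
    (hs' : ∀ j n, ∀ w ∈ ws, Verifies S i acc t (y ++ (fill (blockStr false q k) j ++
      fill (blockStr false a k) n) ++ (w ++ [none]))) :
    (answer i : Mac (Var Name) S).RunsTape [] (update (setupStk x m k q a r) (coins, 0) (flat ws))
      [decide (∃ n < 2 ^ bits (adviceTemplate m k q a k),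
        0 < surplus acc y ws (gs n) (blockStr false q k) (blockStr false a k))] (fun _ => [])
      (400 * (unitCost t L r ws.length * (g + 1) * 2 ^ (a * k) * 2 ^ (q * k) *
        2 ^ bits (adviceTemplate m k q a k)) + 2 * (k + q + a + r) + 30) := by
  set z := adviceTemplate m k q a k with hz'
  set T := ∑ n ∈ Finset.range (2 ^ bits z),
    surplus acc y ws (gs n) (blockStr false q k) (blockStr false a k) with hT
  have hsearch := search_runs (S := S) (i := i) (acc := acc) (t := t) (r := r) (L := L) (k := g)
    (ws := ws) (x := y) (y := blockStr false q k) (b := blockStr false a k) (z := z) (gs := gs)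
    (v := update (setupStk x m k q a r) (coins, 0) (flat ws)) ?_ ?_ ?_ ?_ ?_ hz hk ?_ ?_ hr hn ?_ hs
    hs' ?_ ?_ ?_ ?_ ?_ ?_
  · have hd : decide (∃ n < 2 ^ bits z,
        0 < surplus acc y ws (gs n) (blockStr false q k) (blockStr false a k)) =
        (List.replicate T (none : Symb)).head?.isSome := by
      -- Surpluses are natural numbers, so nothing cancels: the total vanishes only if every summand
      -- does.
      have : T = 0 ↔ ¬ ∃ n < 2 ^ bits z,
          0 < surplus acc y ws (gs n) (blockStr false q k) (blockStr false a k) := by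
        simp [hT, Finset.sum_eq_zero_iff]
      by_cases h : T = 0
      · rw [h, decide_eq_false (this.1 h)]; rfl
      · rw [decide_eq_true (by by_contra h'; exact h (this.2 h'))]
        obtain ⟨n, hn⟩ := Nat.exists_eq_succ_of_ne_zero h
        rw [hn]; rfl
    rw [hd]
    refine (hsearch.seq (pop_runs ((clearAll_runs _ _).seq (pushTape_runs _ _ _)))).conv rfl ?_ ?_
    · refine funext fun X => ?_
      split_ifs with hX
      · rfl
      · simp only [List.mem_cons, not_or, List.not_mem_nil, not_false_eq_true, and_true] at hX
        simp [hX, setupStk]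
    · have hz1 : z.length = ((q + 1) * k + (a + 1) * k + 1) * g := by
        rw [← length_fill z 0, hz 0 (by positivity), length_flatMap_cons (hg 0 (by positivity)),
          hk 0 (by positivity)]
      set Z := 2 ^ bits z with hZ
      have hT' : T ≤ Z * (2 ^ (q * k) * ws.length) := by
        refine (Finset.sum_le_card_nsmul _ _ (2 ^ (q * k) * ws.length) fun n _ => ?_).trans (by simp [hZ])
        refine (Nat.sub_le _ _).trans ((totalWins_le ..).trans ?_)
        rw [bits_blockStr]
      have hf := length_flat_le hr
      rw [← hT]
      simp only [List.map_cons, List.map_nil, List.sum_cons, List.sum_nil, setupStk,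
        Function.update_self, Function.update_of_ne, ne_eq, Prod.mk.injEq, reduceCtorEq, false_and,
        not_false_eq_true, List.length_replicate, List.length_tail, List.length_append,
        List.length_map, List.length_cons, List.length_nil, length_blockStr, bits_blockStr, ← hz',
        hz1]
      set U := unitCost t L r ws.length with hU
      have e : U = (t + L + r + 1) * (ws.length + 1) := rfl
      have hA : 0 < 2 ^ (a * k) := by positivity
      have hQ : 0 < 2 ^ (q * k) := by positivity
      have hZ0 : 0 < Z := by positivity
      generalize 2 ^ (a * k) = A at *
      generalize 2 ^ (q * k) = Q at *
      have h₁ : U * (g + 1) ≤ U * (g + 1) * A * Q * Z := by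
        rw [mul_assoc, mul_assoc]; exact Nat.le_mul_of_pos_right _ (by positivity)
      have h₂ : T ≤ U * (g + 1) * A * Q * Z := by
        refine hT'.trans ?_
        have : ws.length ≤ U * (g + 1) * A := by
          rw [e]
          calc ws.length ≤ 1 * (ws.length + 1) * 1 * 1 := by omega
            _ ≤ _ := by gcongr <;> omega
        calc Z * (Q * ws.length) = ws.length * Q * Z := by ring
          _ ≤ _ := by gcongr
      have h₃ : L + 1 ≤ U := by
        rw [e]; calc L + 1 = (L + 1) * 1 := by ring
          _ ≤ _ := by gcongr <;> omega
      have h₄ : (r + 1) * ws.length ≤ U := by rw [e]; gcongr <;> omega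
      have h₅ : ((q + 1) * k + (a + 1) * k + 1) * g ≤ U * (g + 1) := by gcongr <;> omega
      have h₆ : U ≤ U * (g + 1) := Nat.le_mul_of_pos_right _ (by positivity)
      omega
  · constructor <;> simp [setupStk]
  · simp [setupStk, hy]
  · rw [fill_zero fun m' => not_mem_blockStr _ m' _ _]; simp [setupStk]
  · rw [fill_zero fun m' => not_mem_blockStr _ m' _ _]; simp [setupStk]
  · rw [fill_zero fun m' => not_mem_adviceTemplate _ _ _ _ _ m']; simp [setupStk, hz']
  · simp
  · simp [hy, length_blockStr]; linarith
  · simpa [length_blockStr] using hg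
  all_goals simp [setupStk]

end Mac

/-! ### From programs to deterministic and probabilistic Turing machines -/

namespace Mac

variable {V : Type} [DecidableEq V] {ι : Type} [DecidableEq ι] {S : ι → SubMachine}

/-- Clear the register. -/
def reset : Mac V S := basic (.load (fun r => (none, r.2)) .halt)

/-- A final configuration must carry the initial internal state, so the register that programs use
as scratch space has to be cleared at the very end. -/
theorem reset_reachC (g : Option Symb) (io : List Bool) (v : V → List Symb) (c : Bool) :
    (reset : Mac V S).ReachC [c] (cfg (some (reset : Mac V S).entry) g io v) (cfg none none io v) :=
  ⟨by simp [cfg], by simp [reset, basic, step, cfg, ReachC]⟩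

variable [Fintype V] [Fintype ι]

/-- The Turing machine that runs a program, with the coins all equal to `false`. -/
def toTM2 (P : Mac V S) : FinTM2 where
  K := Key V S
  k₀ := none
  k₁ := none
  Γ := keyAlphabet V S
  Λ := P.Λ
  main := P.entry
  ΛFin := P.fin
  σ := Reg S
  initialState := (none, fun i => (S i).tm.initialState)
  Γk₀Fin := inferInstanceAs (Fintype Bool)
  m := P.m false

/-- The probabilistic Turing machine that runs a program. -/
def toProbTM (P : Mac V S) : ProbTM where
  tm := P.toTM2
  inputAlphabet := Equiv.refl Bool
  outputAlphabet := Equiv.refl Bool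
  m' := P.m true

theorem initList_toTM2 (P : Mac V S) (x : List Bool) :
    initList P.toTM2 x = (cfg (some P.entry) none x (fun _ => []) : MCfg V S P.Λ) := by
  have h := initList_stk P.toTM2 x
  have e : (initList P.toTM2 x).stk = stk x (fun _ => []) := by
    rw [h]
    funext k
    rcases k with _ | k | k
    · exact Function.update_self ..
    · exact Function.update_of_ne (by exact Option.some_ne_none _) ..
    · exact Function.update_of_ne (by exact Option.some_ne_none _) ..
  exact congrArg (Cfg.mk _ _) e

theorem haltList_toTM2 (P : Mac V S) (x : List Bool) :
    haltList P.toTM2 x = (cfg none none x (fun _ => []) : MCfg V S P.Λ) := by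
  have h := haltList_stk P.toTM2 x
  have e : (haltList P.toTM2 x).stk = stk x (fun _ => []) := by
    rw [h]
    funext k
    rcases k with _ | k | k
    · exact Function.update_self ..
    · exact Function.update_of_ne (by exact Option.some_ne_none _) ..
    · exact Function.update_of_ne (by exact Option.some_ne_none _) ..
  exact congrArg (Cfg.mk _ _) e

theorem iterate_step_toTM2 (P : Mac V S) (n : ℕ) (a b : MCfg V S P.Λ)
    (h : P.ReachC (List.replicate n false) a b) :
    (flip bind P.toTM2.step)^[n] (some a) = some b := by
  induction n generalizing a with
  | zero => exact congrArg some h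
  | succ n ih =>
    obtain ⟨_ | l, s, T⟩ := a
    · exact absurd rfl h.1
    · rw [Function.iterate_succ_apply]
      exact ih _ h.2

theorem foldl_coinStep (P : Mac V S) (cs : List Bool) (a b : MCfg V S P.Λ)
    (h : P.ReachC cs a b) : cs.foldl P.toProbTM.coinStep a = b := by
  induction cs generalizing a with
  | nil => exact h
  | cons c cs ih =>
    obtain ⟨_ | l, s, T⟩ := a
    · exact absurd rfl h.1
    · refine Eq.trans ?_ (ih _ h.2)
      exact congrArg (fun a => cs.foldl P.toProbTM.coinStep a) (by cases c <;> rfl)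

theorem foldl_coinStep_halted (P : Mac V S) (cs : List Bool) (s : Reg S)
    (T : ∀ k, List (keyAlphabet V S k)) :
    cs.foldl P.toProbTM.coinStep (⟨none, s, T⟩ : MCfg V S P.Λ) = (⟨none, s, T⟩ : MCfg V S P.Λ) := by
  induction cs with
  | nil => rfl
  | cons c cs ih =>
    refine Eq.trans ?_ ih
    exact congrArg (fun a => cs.foldl P.toProbTM.coinStep a) (by cases c <;> rfl)

/-- `RunsTape` covers every coin sequence of the right length, in particular the constant one that
the deterministic machine follows. -/
theorem toTM2_outputs {P : Mac V S} {x : List Bool} {o : Bool} {n : ℕ}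
    (h : P.RunsTape x (fun _ => []) [o] (fun _ => []) n) :
    Nonempty (TM2OutputsInTime (P ;; reset).toTM2 x (some [o]) (n + 1)) := by
  obtain ⟨g, k, hk, h⟩ := h none
  refine ⟨⟨⟨k + 1, ?_⟩, by simpa using hk⟩⟩
  have h₁ := reachC_seq_left (Q := reset) (h (List.replicate k false) (by simp))
  have h₂ := reachC_seq_right (P := P) (reset_reachC g [o] (fun _ => []) false)
  have := iterate_step_toTM2 (P ;; reset) (k + 1) _ _
    (by rw [List.replicate_succ']; exact h₁.trans h₂)
  rw [initList_toTM2]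
  exact this.trans (congrArg some (haltList_toTM2 (P ;; reset) [o]).symm)

theorem haltsWith_of_reachC {P : Mac V S} {x : List Bool} {o : Bool} {t : ℕ} {c : Bits t}
    {cs ds : List Bool} (hc : List.ofFn c = cs ++ ds)
    (h : P.ReachC cs (cfg (some P.entry) none x (fun _ => [])) (cfg none none [o] (fun _ => []))) :
    P.toProbTM.HaltsWith x c o := by
  unfold ProbTM.HaltsWith ProbTM.run
  rw [hc, List.foldl_append]
  have e₁ : initList P.toProbTM.tm (x.map P.toProbTM.inputAlphabet.invFun) =
      (cfg (some P.entry) none x (fun _ => []) : MCfg V S P.Λ) := by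
    rw [← initList_toTM2 P x]
    exact congrArg (initList P.toTM2) (List.map_id x)
  rw [e₁, foldl_coinStep P cs _ _ h]
  exact (foldl_coinStep_halted P ds _ _).trans (haltList_toTM2 P [o]).symm

/-- The first program takes the same number `k₁` of steps for all coins, so the `j`-th sampled
symbol sees coin number `k₁ + j`. Coins left over after halting have no effect. The injection `e`
lets probabilities over all coins be reduced to probabilities over the sampled ones. -/
theorem haltsWith_sample {A B : Mac V S} {D E : V} (hDE : D ≠ E) {x : List Bool}
    {v : V → List Symb} {n₁ n₂ t : ℕ} {ans : List Bool → Bool} {l : List Symb}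
    (hA : A.RunsTape x (fun _ => []) [] v n₁) (hD : v D = l)
    (hB : ∀ cs : List Bool, cs.length = l.length → B.RunsTape [] (Function.update
      (Function.update v D []) E ((List.zipWith (fun s c => Option.map (fun _ => (false, c)) s)
        l cs).reverse ++ v E)) [ans cs] (fun _ => []) n₂)
    (ht : n₁ + l.length + n₂ + 2 ≤ t) :
    ∃ e : Fin l.length → Fin t, Function.Injective e ∧ ∀ c : Bits t,
      (A ;; sample D E ;; B ;; reset).toProbTM.HaltsWith x c
        (ans (List.ofFn fun j => c (e j))) := by
  obtain ⟨g₁, k₁, hk₁, h₁⟩ := hA none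
  refine ⟨fun j => ⟨k₁ + j, by omega⟩, fun i j h => by simpa [Fin.ext_iff] using h, fun c => ?_⟩
  set cs : List Bool := List.ofFn fun j : Fin l.length => c ⟨k₁ + j, by omega⟩ with hcs
  have hlen : cs.length = l.length := by simp [hcs]
  have hcs' : ((List.ofFn c).drop k₁).take l.length = cs := by
    refine List.ext_getElem (by simp [hcs]; omega) fun j h₁ h₂ => ?_
    simp [hcs]
  obtain ⟨g₂, h₂⟩ := sample_runs (S := S) hDE l cs hlen (c ⟨k₁ + l.length, by omega⟩) [] v hD g₁
  obtain ⟨g₃, k₃, hk₃, h₃⟩ := hB cs hlen g₂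
  have e : List.ofFn c = ((List.ofFn c).take k₁ ++ ((cs ++ [c ⟨k₁ + l.length, by omega⟩]) ++
      (((List.ofFn c).drop (k₁ + l.length + 1)).take k₃ ++
      [c ⟨k₁ + l.length + 1 + k₃, by omega⟩]))) ++
      (List.ofFn c).drop (k₁ + l.length + 1 + k₃ + 1) := by
    refine List.ext_getElem (by simp [hcs]; omega) fun j h₁ h₂ => ?_
    simp only [List.length_ofFn] at h₁
    simp only [hcs, List.getElem_append, List.getElem_ofFn, List.getElem_take, List.getElem_drop,
      List.length_append, List.length_take, List.length_ofFn, List.length_drop, List.length_cons,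
      List.length_nil, List.getElem_singleton]
    split_ifs <;> congr 2 <;> omega
  refine haltsWith_of_reachC (P := A ;; sample D E ;; B ;; reset) e ?_
  have h₃' := reachC_seq_left (Q := (reset : Mac V S)) (h₃ (((List.ofFn c).drop (k₁ + l.length + 1)).take k₃)
    (by simp; omega))
  have h₄ := reachC_seq_right (P := B) (reset_reachC (S := S) g₃ [ans cs] (fun _ => [])
    (c ⟨k₁ + l.length + 1 + k₃, by omega⟩))
  have h₂' := reachC_seq_left (Q := B ;; reset) h₂
  have h₁' := reachC_seq_left (Q := sample D E ;; B ;; reset)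
    (h₁ ((List.ofFn c).take k₁) (by simp; omega))
  exact h₁'.trans (reachC_seq_right (h₂'.trans (reachC_seq_right (h₃'.trans h₄))))

end Mac

/-! ### Strings as functions on their bit positions -/

namespace Mac

section Template

variable {J : Type}

/-- Fill the slots of a template with bits, with given marks. -/
def inst (τ : List (Option J)) (mk u : J → Bool) : List Symb :=
  τ.map (Option.map fun j => (mk j, u j))

theorem inst_append (τ τ' : List (Option J)) (mk u : J → Bool) :
    inst (τ ++ τ') mk u = inst τ mk u ++ inst τ' mk u := List.map_append

theorem inst_map {J' : Type} (f : J' → J) (τ : List (Option J')) (mk u : J → Bool) :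
    inst (τ.map (Option.map f)) mk u = inst τ (mk ∘ f) (u ∘ f) := by
  simp [inst, Function.comp_def]

theorem bits_inst (τ : List (Option J)) (mk mk' u u' : J → Bool) :
    bits (inst τ mk u) = bits (inst τ mk' u') := by
  induction τ with
  | nil => rfl
  | cons o τ ih => cases o <;> simp_all [inst, bits]

theorem num_lt (l : List Symb) : num l < 2 ^ bits l := by
  fun_induction num l with
  | case1 => simp [bits]
  | case2 l ih => simpa [bits] using ih
  | case3 m b l ih => cases b <;> simp [bits, pow_succ] <;> omega

theorem fill_num (τ : List (Option J)) (mk u u' : J → Bool) :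
    fill (inst τ mk u) (num (inst τ mk u')) = inst τ mk u' := by
  induction τ with
  | nil => rfl
  | cons o τ ih =>
    cases o with
    | none => simpa [inst, fill, num] using ih
    | some j =>
      simp only [inst, List.map_cons, Option.map_some, num, fill, List.cons.injEq] at ih ⊢
      cases h : u' j
      · simp [ih]
      · have : (1 + 2 * num (τ.map (Option.map fun j => (mk j, u' j)))) / 2 =
          num (τ.map (Option.map fun j => (mk j, u' j))) := by omega
        simp [ih, this]

theorem fill_fill (l : List Symb) (n : ℕ) : fill l (num (fill l n)) = fill l n := by
  fun_induction fill l n with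
  | case1 n => rfl
  | case2 l n ih => simpa [fill, num] using ih
  | case3 m b l n ih =>
    simp only [num, fill, List.cons.injEq]
    by_cases h : n % 2 = 1
    · simp only [h, decide_true, Bool.toNat_true]
      rw [show (1 + 2 * num (fill l (n / 2))) / 2 = num (fill l (n / 2)) by omega]
      simp [ih]
    · simp [h, ih]

/-- The coded number is linear in the bits. For answer tuples it therefore splits into a sum over
the Merlins, which makes tie-breaking by this number compatible with a choice for each Merlin
separately. -/
theorem exists_num_inst (τ : List (Option J)) (mk : J → Bool) [Fintype J] [DecidableEq J] :
    ∃ wt : J → ℕ, ∀ u, num (inst τ mk u) = ∑ j, wt j * (u j).toNat := by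
  induction τ with
  | nil => exact ⟨fun _ => 0, fun u => by simp [inst, num]⟩
  | cons o τ ih =>
    obtain ⟨wt, h⟩ := ih
    cases o with
    | none => exact ⟨wt, fun u => by simpa [inst, num] using h u⟩
    | some j =>
      refine ⟨fun i => 2 * wt i + if i = j then 1 else 0, fun u => ?_⟩
      simp only [inst, List.map_cons, Option.map_some, num] at h ⊢
      rw [h u]
      simp [add_mul, Finset.sum_add_distrib, Finset.mul_sum, mul_assoc, add_comm]

theorem inst_injective {τ : List (Option J)} (h : ∀ j, some j ∈ τ) (mk : J → Bool) :
    Function.Injective (inst τ mk) := by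
  intro u u' huu
  funext j
  have := List.map_inj_left.1 huu (some j) (h j)
  simpa using this

theorem num_inst_injective {τ : List (Option J)} (h : ∀ j, some j ∈ τ) (mk : J → Bool) :
    Function.Injective fun u => num (inst τ mk u) := by
  intro u u' huu
  refine inst_injective h mk ?_
  rw [← fill_num τ mk u u, ← fill_num τ mk u u']
  exact congrArg _ huu

variable [Fintype J] [DecidableEq J]

/-- A counting argument: coding is injective because every position occurs, and there are as many
bit assignments as numbers below the bound. -/
theorem exists_num_inst_eq {τ : List (Option J)} (h : ∀ j, some j ∈ τ) (mk u : J → Bool)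
    (hB : bits (inst τ mk u) = Fintype.card J) {n : ℕ} (hn : n < 2 ^ bits (inst τ mk u)) :
    ∃ u', num (inst τ mk u') = n := by
  have hlt : ∀ u', num (inst τ mk u') < 2 ^ bits (inst τ mk u) := fun u' => by
    rw [bits_inst τ mk mk u u']; exact num_lt _
  have hinj : Function.Injective fun u' : J → Bool =>
      (⟨num (inst τ mk u'), hlt u'⟩ : Fin (2 ^ bits (inst τ mk u))) := fun u₁ u₂ h₁₂ =>
    num_inst_injective h mk (by simpa using h₁₂)
  have hbij := (Fintype.bijective_iff_injective_and_card _).2 ⟨hinj, by simp [hB]⟩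
  obtain ⟨u', hu'⟩ := hbij.2 ⟨n, hn⟩
  exact ⟨u', by simpa using hu'⟩

theorem exists_fill_eq {τ : List (Option J)} (h : ∀ j, some j ∈ τ) (mk u : J → Bool)
    (hB : bits (inst τ mk u) = Fintype.card J) (n : ℕ) :
    ∃ u', fill (inst τ mk u) n = inst τ mk u' := by
  obtain ⟨u', hu'⟩ := exists_num_inst_eq h mk u hB (n := num (fill (inst τ mk u) n))
    (by rw [← bits_fill _ n]; exact num_lt _)
  exact ⟨u', by rw [← fill_fill, ← hu', fill_num]⟩

theorem sum_range_fill {τ : List (Option J)} (h : ∀ j, some j ∈ τ) (mk u : J → Bool)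
    (hB : bits (inst τ mk u) = Fintype.card J) (F : List Symb → ℕ) :
    ∑ n ∈ Finset.range (2 ^ bits (inst τ mk u)), F (fill (inst τ mk u) n) =
      ∑ u', F (inst τ mk u') := by
  symm
  refine Finset.sum_bij (fun u' _ => num (inst τ mk u')) (fun u' _ => ?_) (fun u₁ _ u₂ _ h₁₂ =>
    num_inst_injective h mk h₁₂) (fun n hn => ?_) fun u' _ => by rw [fill_num]
  · rw [Finset.mem_range, bits_inst τ mk mk u u']; exact num_lt _
  · obtain ⟨u', hu'⟩ := exists_num_inst_eq h mk u hB (Finset.mem_range.1 hn)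
    exact ⟨u', Finset.mem_univ _, hu'⟩

end Template

theorem zipWith_select_inst {J : Type} (τ : List (Option J)) (mk u u' : J → Bool) :
    List.zipWith select (inst τ (fun _ => false) u) (inst τ mk u') =
      inst τ (fun _ => false) fun j => if mk j then u j else u' j := by
  simp only [inst, List.zipWith_map, List.zipWith_self]
  refine List.map_congr_left fun o _ => ?_
  cases o with
  | none => rfl
  | some j => cases h : mk j <;> simp [select, h]

/-- The template for `k` blocks of `q` bits. -/
def blocks (k q : ℕ) : List (Option (Fin k × Fin q)) :=
  (List.ofFn fun i => (List.ofFn fun j => some (i, j)) ++ [none]).flatten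

theorem mem_blocks {k q : ℕ} (p : Fin k × Fin q) : some p ∈ blocks k q := by
  simp [blocks, List.mem_flatten, List.mem_ofFn]

theorem inst_blocks (k q : ℕ) (mk u : Fin k × Fin q → Bool) : inst (blocks k q) mk u =
    (List.ofFn fun i => (List.ofFn fun j => some (mk (i, j), u (i, j))) ++ [none]).flatten := by
  simp [inst, blocks, List.map_flatten, List.map_ofFn, Function.comp_def]

theorem inst_blocks_false (m : Bool) (k q : ℕ) :
    inst (blocks k q) (fun _ => m) (fun _ => false) = blockStr m q k := by
  simp [inst_blocks, blockStr, List.ofFn_const]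

/-- The template for a question and an answer of each Merlin. -/
def pair (k q a : ℕ) : List (Option ((Fin k × Fin q) ⊕ (Fin k × Fin a))) :=
  (blocks k q).map (Option.map Sum.inl) ++ (blocks k a).map (Option.map Sum.inr)

/-- The marks in the advice for the `c`-th Merlin. -/
def mark {k q a : ℕ} (c : Fin k) : (Fin k × Fin q) ⊕ (Fin k × Fin a) → Bool :=
  Sum.elim (fun p => decide (p.1 = c)) fun p => decide (p.1 = c)

/-- The template for the advice. -/
def adviceTmpl (k m q a : ℕ) :
    List (Option (Fin k × Fin m × ((Fin k × Fin q) ⊕ (Fin k × Fin a)))) :=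
  (List.ofFn fun c => (List.ofFn fun j =>
    none :: (pair k q a).map (Option.map fun p => (c, j, p))).flatten).flatten

theorem mem_adviceTmpl {k m q a : ℕ} (p : Fin k × Fin m × ((Fin k × Fin q) ⊕ (Fin k × Fin a))) :
    some p ∈ adviceTmpl k m q a := by
  obtain ⟨c, j, p | p⟩ := p <;>
    simp [adviceTmpl, pair, List.mem_flatten, List.mem_ofFn, mem_blocks]

theorem blocks_mark (k q : ℕ) (c : Fin k) :
    inst (blocks k q) (fun p => decide (p.1 = c)) (fun _ => false) =
      blockStr false q c ++ (blockStr true q 1 ++ blockStr false q (k - 1 - c)) := by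
  have h : ∀ G : ℕ → List Symb, (List.ofFn fun i : Fin k => G i) = (List.range k).map G := by
    intro G
    refine List.ext_getElem (by simp) fun j _ _ => by simp
  -- The Merlins before `c`, Merlin `c` himself, and those after him.
  have hk : k = c + (1 + (k - 1 - c)) := by omega
  have e := h fun i => List.replicate q (some (decide (i = c), false)) ++ [none]
  rw [inst_blocks]
  simp only [List.ofFn_const, Fin.ext_iff]
  rw [e, show List.range k = List.range (c + (1 + (k - 1 - c))) from congrArg _ hk,
    List.range_add, List.range_add]
  simp only [List.map_append, List.map_map, List.flatten_append, blockStr]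
  have e₁ : ((List.range c).map fun i => List.replicate q (some (decide (i = (c : ℕ)), false)) ++
      [(none : Symb)]) = List.replicate c (List.replicate q (some (false, false)) ++ [none]) := by
    refine List.ext_getElem (by simp) fun j h₁ _ => ?_
    have : j ≠ c := by simp at h₁; omega
    simp [this]
  rw [e₁]
  congr 2
  · simp
  · congr 1
    refine List.ext_getElem (by simp) fun j h₁ _ => ?_
    simp
    omega

theorem inst_adviceTmpl (k m q a : ℕ)
    (mk u : Fin k × Fin m × ((Fin k × Fin q) ⊕ (Fin k × Fin a)) → Bool) :
    inst (adviceTmpl k m q a) mk u = ((List.ofFn fun c => List.ofFn fun j =>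
      inst (pair k q a) (fun p => mk (c, j, p)) fun p => u (c, j, p)).flatten).flatMap (none :: ·) := by
  simp only [inst, adviceTmpl, List.map_flatten, List.map_ofFn, Function.comp_def, List.flatMap_def,
    List.flatten_flatten, List.map_cons, Option.map_none, List.map_map, Option.map_map]

theorem inst_adviceTmpl_false (k m q a : ℕ) :
    inst (adviceTmpl k m q a) (fun p => mark p.1 p.2.2) (fun _ => false) =
      adviceTemplate m k q a k := by
  have h : ∀ G : ℕ → List Symb, (List.ofFn fun i : Fin k => G i) = (List.range k).map G := by
    intro G
    refine List.ext_getElem (by simp) fun j _ _ => by simp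
  rw [adviceTemplate, ← h]
  have e : ∀ c : Fin k, inst (pair k q a) (mark c) (fun _ => false) =
      adviceStr q a c (k - 1 - c) := by
    intro c
    have h₁ := blocks_mark k q c
    have h₂ := blocks_mark k a c
    rw [pair, inst_append, inst_map, inst_map]
    simp only [Function.comp_def, mark, Sum.elim_inl, Sum.elim_inr]
    rw [h₁, h₂]
    simp [adviceStr]
  simp [inst_adviceTmpl, e, List.flatMap_def, List.map_flatten, List.map_ofFn, Function.comp_def,
    List.ofFn_const, List.flatten_flatten]

theorem bits_flatten_replicate (n : ℕ) (l : List Symb) :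
    bits (List.replicate n l).flatten = n * bits l := by
  induction n with
  | zero => simp [bits]
  | succ n ih => rw [List.replicate_succ, List.flatten_cons, bits_append, ih]; ring

theorem bits_adviceTemplate (m k q a : ℕ) :
    bits (adviceTemplate m k q a k) = k * (m * (k * (q + a))) := by
  -- The induction has to stay below `k`: only for `j < k` does a block with `k - 1 - j` later
  -- Merlins contain `k` questions and answers.
  have : ∀ j ≤ k, bits (adviceTemplate m k q a j) = j * (m * (k * (q + a))) := by
    intro j hj
    induction j with
    | zero => simp [adviceTemplate, bits]
    | succ j ih =>
      have e : bits (none :: adviceStr q a j (k - 1 - j)) = k * (q + a) := by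
        have hk : k = j + (1 + (k - 1 - j)) := by omega
        simp only [bits, adviceStr, bits_append, bits_blockStr]
        conv_rhs => rw [hk]
        ring
      rw [adviceTemplate, List.range_succ, List.map_append, List.flatten_append, bits_append,
        ← adviceTemplate, ih (by omega)]
      simp only [List.map_cons, List.map_nil, List.flatten_cons, List.flatten_nil,
        List.append_nil, bits_flatten_replicate, e]
      ring
  exact this k le_rfl

end Mac

/-! ### Lexicographic optima of separable functions -/

/-- `α` maximises `s`, and minimises `N` among the maximisers. -/
def IsBest {A : Type} (s N : A → ℕ) (α : A) : Prop :=
  ∀ α', s α' < s α ∨ s α' = s α ∧ N α ≤ N α'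

theorem exists_isBest {A : Type} [Finite A] [Nonempty A] (s N : A → ℕ) : ∃ α, IsBest s N α := by
  obtain ⟨α, h⟩ := Finite.exists_max fun α => toLex (s α, OrderDual.toDual (N α))
  refine ⟨α, fun α' => ?_⟩
  rcases Prod.Lex.toLex_le_toLex.1 (h α') with h | h
  · exact Or.inl h
  · exact Or.inr ⟨h.1, h.2⟩

theorem IsBest.eq {A : Type} {s N : A → ℕ} (hN : Function.Injective N) {α α' : A}
    (h : IsBest s N α) (h' : IsBest s N α') : α = α' := by
  refine hN ?_
  have := h α'
  have := h' α
  omega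

/-- Changing a single coordinate of `b` changes a single summand of each sum, and the common rest
cancels from both comparisons. -/
theorem IsBest.apply {I A : Type} [Fintype I] [DecidableEq I] {s N : I → A → ℕ} {b : I → A}
    (h : IsBest (fun b => ∑ i, s i (b i)) (fun b => ∑ i, N i (b i)) b) (i : I) :
    IsBest (s i) (N i) (b i) := by
  intro α'
  have e : ∀ F : I → A → ℕ, ∀ c : I → A, (∀ j, j ≠ i → c j = b j) →
      ∑ j, F j (c j) = F i (c i) + ∑ j ∈ Finset.univ.erase i, F j (b j) := by
    intro F c hc
    rw [← Finset.add_sum_erase _ _ (Finset.mem_univ i)]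
    congr 1
    exact Finset.sum_congr rfl fun j hj => by rw [hc j (Finset.ne_of_mem_erase hj)]
  have hb := h (Function.update b i α')
  simp only [] at hb
  have hu : ∀ j, j ≠ i → Function.update b i α' j = b j := fun j hj => by simp [hj]
  rw [e s _ hu, e N _ hu, e s b fun _ _ => rfl, e N b fun _ _ => rfl] at hb
  simp only [Function.update_self] at hb
  omega

/-! ### What the search computes, in terms of strategies -/

namespace Mac

theorem firstMax_spec (f : ℕ → ℕ) (n : ℕ) :
    (∀ j < n, f j < (firstMax f n).1 ∨ f j = (firstMax f n).1 ∧ (firstMax f n).2 ≤ j) ∧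
      (0 < n → (firstMax f n).1 = f (firstMax f n).2 ∧ (firstMax f n).2 < n) := by
  induction n with
  | zero => simp
  | succ n ih =>
    simp only [firstMax]
    split_ifs with h
    · refine ⟨fun j hj => ?_, fun _ => ⟨rfl, by simp⟩⟩
      rcases Nat.lt_succ_iff_lt_or_eq.1 hj with hj | rfl
      · have := ih.1 j hj
        simp only; omega
      · exact Or.inr ⟨rfl, le_rfl⟩
    -- The initial pair `(0, 0)` need not be a value of `f`. If it survives the first step, then `f
    -- 0 = 0` and it has become correct.
    · rcases Nat.eq_zero_or_pos n with rfl | hn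
      · simp only [firstMax] at h ⊢
        refine ⟨fun j hj => ?_, fun _ => ⟨by omega, by omega⟩⟩
        obtain rfl : j = 0 := by omega
        omega
      · obtain ⟨h₁, h₂⟩ := ih.2 hn
        refine ⟨fun j hj => ?_, fun _ => ⟨h₁, by omega⟩⟩
        rcases Nat.lt_succ_iff_lt_or_eq.1 hj with hj | rfl
        · exact ih.1 j hj
        · omega

/-- The string for a tuple of questions or answers. -/
def encB {k q : ℕ} (y : Fin k → Bits q) : List Symb :=
  inst (blocks k q) (fun _ => false) (Function.uncurry y)

/-- The string for random bits. -/
def encW {r : ℕ} (w : Bits r) : List Symb := (List.ofFn w).map fun b => some (false, b)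

/-- Tuples of questions and answers, `m` for each Merlin. -/
abbrev Advice (k q a m : ℕ) : Type := Fin k → Fin m → (Fin k → Bits q) × (Fin k → Bits a)

/-- The bits of a piece of advice. -/
def adviceBits {k q a m : ℕ} (d : Advice k q a m)
    (p : Fin k × Fin m × ((Fin k × Fin q) ⊕ (Fin k × Fin a))) : Bool :=
  p.2.2.elim (fun p' => (d p.1 p.2.1).1 p'.1 p'.2) fun p' => (d p.1 p.2.1).2 p'.1 p'.2

theorem adviceBits_surjective {k q a m : ℕ} :
    Function.Surjective (adviceBits : Advice k q a m → _) := fun u =>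
  ⟨fun c j => (fun i l => u (c, j, Sum.inl (i, l)), fun i l => u (c, j, Sum.inr (i, l))), by
    funext p
    obtain ⟨c, j, p | p⟩ := p <;> rfl⟩

/-- The blocks of advice. -/
def segments {k q a m : ℕ} (d : Advice k q a m) : List (List Symb) :=
  (List.ofFn fun c => List.ofFn fun j =>
    inst (pair k q a) (mark c) fun p => adviceBits d (c, j, p)).flatten

/-- How many acceptances the answer `α` of the `c`-th Merlin to the question `η` yields in the
situations given by the advice. -/
def localScore {k q a m r : ℕ} (V : (Fin k → Bits q) → (Fin k → Bits a) → Bits r → Bool)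
    (ω : List (Bits r)) (d : Advice k q a m) (c : Fin k) (η : Bits q) (α : Bits a) : ℕ :=
  ∑ j, ω.countP (V (Function.update (d c j).1 c η) (Function.update (d c j).2 c α))

theorem encB_append {k q a : ℕ} (y : Fin k → Bits q) (b : Fin k → Bits a) :
    encB y ++ encB b = inst (pair k q a) (fun _ => false)
      (Sum.elim (Function.uncurry y) (Function.uncurry b)) := by
  rw [pair, inst_append, inst_map, inst_map]
  rfl

/-- The marks of a block for Merlin `c` cover exactly his question and his answer, so merging
amounts to overwriting these two entries of the recorded situation. -/
theorem zipWith_select_segment {k q a m : ℕ} (d : Advice k q a m) (y : Fin k → Bits q)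
    (b : Fin k → Bits a) (c : Fin k) (j : Fin m) :
    List.zipWith select (encB y ++ encB b)
      (inst (pair k q a) (mark c) fun p => adviceBits d (c, j, p)) =
      encB (Function.update (d c j).1 c (y c)) ++ encB (Function.update (d c j).2 c (b c)) := by
  rw [encB_append, encB_append, zipWith_select_inst]
  congr 1
  funext p
  rcases p with ⟨i, l⟩ | ⟨i, l⟩ <;> by_cases h : i = c <;>
    simp [mark, adviceBits, Function.uncurry, h]

section Semantics

variable {k q a m r : ℕ} {acc : List Symb → Bool} {x : List Symb}
  {V : (Fin k → Bits q) → (Fin k → Bits a) → Bits r → Bool}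

theorem wins_eq (h : ∀ y b w, acc (x ++ (encB y ++ encB b) ++ (encW w ++ [none])) = V y b w)
    (ω : List (Bits r)) (y : Fin k → Bits q) (b : Fin k → Bits a) :
    wins acc x (ω.map encW) (encB y ++ encB b) = ω.countP (V y b) := by
  simp only [wins, List.countP_map, Function.comp_def, h]

/-- Separability: a block for Merlin `c` sees only his part of the current transcript, so the total
score splits into terms in `y c` and `b c`. -/
theorem scoreVal_eq (h : ∀ y b w, acc (x ++ (encB y ++ encB b) ++ (encW w ++ [none])) = V y b w)
    (ω : List (Bits r)) (d : Advice k q a m) (y : Fin k → Bits q) (b : Fin k → Bits a) :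
    scoreVal acc x (ω.map encW) (segments d) (encB y ++ encB b) =
      ∑ c, localScore V ω d c (y c) (b c) := by
  simp only [scoreVal, segments, List.map_flatten, List.sum_flatten, List.map_ofFn,
    Function.comp_def, List.sum_ofFn, zipWith_select_segment, wins_eq h, localScore]

/-- The machine maximises over whole answer tuples, breaking ties by the coded number. Both
quantities are sums over the Merlins, so the unique optimum is found coordinate by coordinate, and
each answer depends on the Merlin's own question only. The rule `opt` is fixed before the verifier,
the coin strings and the advice. -/
theorem exists_choice (k q a : ℕ) : ∃ opt : Fin k → (Bits a → ℕ) → Bits a,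
    (∀ i (s : Bits a → ℕ) α, s α ≤ s (opt i s)) ∧ ∀ {m r : ℕ} {acc : List Symb → Bool} {x : List Symb}
    {V : (Fin k → Bits q) → (Fin k → Bits a) → Bits r → Bool}
    (_ : ∀ y b w, acc (x ++ (encB y ++ encB b) ++ (encW w ++ [none])) = V y b w)
    (ω : List (Bits r)) (d : Advice k q a m) (y : Fin k → Bits q),
    roundWins acc x (ω.map encW) (segments d) (encB y) (blockStr false a k) =
      ω.countP (V y fun i => opt i (localScore V ω d i (y i))) := by
  obtain ⟨wt, hwt⟩ := exists_num_inst (blocks k a) fun _ => false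
  set N : Fin k → Bits a → ℕ := fun i α => ∑ l, wt (i, l) * (α l).toNat with hN
  have hnum : ∀ b : Fin k → Bits a, num (encB b) = ∑ i, N i (b i) := by
    intro b
    rw [encB, hwt, Fintype.sum_prod_type]
    rfl
  have hinj : Function.Injective fun b : Fin k → Bits a => num (encB b) := fun b b' hb =>
    Function.uncurry_injective (num_inst_injective mem_blocks _ hb)
  have hNinj : ∀ i, Function.Injective (N i) := by
    intro i α α' hα
    -- The weights of one Merlin are tested on tuples in which all other answers are zero.
    have : Function.update (fun _ _ => false) i α = Function.update (fun _ _ => false) i α' := by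
      refine hinj ?_
      simp only [hnum]
      refine Finset.sum_congr rfl fun j _ => ?_
      by_cases hj : j = i
      · subst hj; simpa using hα
      · simp [hj]
    simpa using congrFun this i
  have hbits : bits (blockStr false a k) = Fintype.card (Fin k × Fin a) := by
    simp [bits_blockStr, mul_comm]
  choose opt hopt using fun i s => exists_isBest (A := Bits a) s (N i)
  refine ⟨opt, fun i s α => ?_, ?_⟩
  · have := hopt i s α; omega
  intro m r acc x V h ω d y
  have hspec := firstMax_spec (fun n => scoreVal acc x (ω.map encW) (segments d)
    (encB y ++ fill (blockStr false a k) n)) (2 ^ bits (blockStr false a k))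
  obtain ⟨h₁, h₂⟩ := hspec
  obtain ⟨h₃, h₄⟩ := h₂ (by positivity)
  rw [roundWins]
  set n₀ := (firstMax (fun n => scoreVal acc x (ω.map encW) (segments d)
    (encB y ++ fill (blockStr false a k) n)) (2 ^ bits (blockStr false a k))).2 with hn₀
  rw [h₃] at h₁
  have hfill : ∀ b : Fin k → Bits a, fill (blockStr false a k) (num (encB b)) = encB b := fun b => by
    rw [← inst_blocks_false, encB, fill_num]
  have hlt : ∀ b : Fin k → Bits a, num (encB b) < 2 ^ bits (blockStr false a k) := fun b => by
    rw [← inst_blocks_false, bits_inst _ _ (fun _ => false) _ (Function.uncurry b)]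
    exact num_lt _
  obtain ⟨u, hu⟩ := exists_num_inst_eq (τ := blocks k a) mem_blocks (fun _ => false)
    (fun _ => false) (by rw [inst_blocks_false, hbits]) (n := n₀) (by rwa [inst_blocks_false])
  obtain ⟨b, rfl⟩ : ∃ b : Fin k → Bits a, Function.uncurry b = u := ⟨fun i l => u (i, l), rfl⟩
  change num (encB b) = n₀ at hu
  have hbest : IsBest (fun b : Fin k → Bits a => ∑ i, localScore V ω d i (y i) (b i))
      (fun b => ∑ i, N i (b i)) b := by
    intro b'
    have := h₁ _ (hlt b')
    simp only [← hu, hfill, scoreVal_eq h] at this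
    simpa only [hnum] using this
  have hb : b = fun i => opt i (localScore V ω d i (y i)) :=
    funext fun i => (hbest.apply i).eq (hNinj i) (hopt i _)
  rw [← hu, hfill, wins_eq h, hb]

theorem totalWins_eq {opt : Fin k → (Bits a → ℕ) → Bits a}
    (hopt : ∀ (ω : List (Bits r)) (d : Advice k q a m) (y : Fin k → Bits q),
      roundWins acc x (ω.map encW) (segments d) (encB y) (blockStr false a k) =
        ω.countP (V y fun i => opt i (localScore V ω d i (y i))))
    (ω : List (Bits r)) (d : Advice k q a m) :
    totalWins acc x (ω.map encW) (segments d) (blockStr false q k) (blockStr false a k)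
      (2 ^ bits (blockStr false q k)) =
      ∑ y : Fin k → Bits q, ω.countP (V y fun i => opt i (localScore V ω d i (y i))) := by
  rw [totalWins, ← inst_blocks_false false k q]
  rw [sum_range_fill mem_blocks (fun _ => false) (fun _ => false)
    (by rw [inst_blocks_false, bits_blockStr]; simp [mul_comm])
    fun l => roundWins acc x (ω.map encW) (segments d) l (blockStr false a k)]
  refine (Fintype.sum_equiv (Equiv.curry (Fin k) (Fin q) Bool).symm _ _ fun y => ?_).symm
  rw [← hopt]
  rfl

end Semantics

variable {ι : Type} [DecidableEq ι] {S : ι → SubMachine}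

theorem exists_advice {k q a m : ℕ} {n : ℕ} (hn : n < 2 ^ bits (adviceTemplate m k q a k)) :
    ∃ d : Advice k q a m, num (inst (adviceTmpl k m q a) (fun p => mark p.1 p.2.2) (adviceBits d)) =
      n := by
  rw [← inst_adviceTmpl_false] at hn
  obtain ⟨u, hu⟩ := exists_num_inst_eq mem_adviceTmpl _ _
    (by rw [inst_adviceTmpl_false, bits_adviceTemplate]; simp only [Fintype.card_prod, Fintype.card_sum, Fintype.card_fin]; ring) hn
  obtain ⟨d, rfl⟩ := adviceBits_surjective u
  exact ⟨d, hu⟩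

theorem answer_runs_of_verifies {i : ι} (k q a : ℕ) :
    ∃ opt : Fin k → (Bits a → ℕ) → Bits a, (∀ i (s : Bits a → ℕ) α, s α ≤ s (opt i s)) ∧
    ∀ {m r t L : ℕ} {acc : List Symb → Bool} {x : List Bool}
    {V : (Fin k → Bits q) → (Fin k → Bits a) → Bits r → Bool} (ω : List (Bits r))
    (_ : ∀ y b w, acc (((x.map fun b => some (false, b)) ++ [none]) ++ (encB y ++ encB b) ++
      (encW w ++ [none])) = V y b w)
    (_ : ∀ (y : Fin k → Bits q) (b : Fin k → Bits a) (w : Bits r), Verifies S i acc t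
      (((x.map fun b => some (false, b)) ++ [none]) ++ (encB y ++ encB b) ++ (encW w ++ [none])))
    (_ : x.length + 1 + (q + 1) * k + (a + 1) * k ≤ L),
    (answer i : Mac (Var Name) S).RunsTape []
      (Function.update (setupStk x m k q a r) (.coins, 0) (flat (ω.map encW)))
      [decide (∃ d : Advice k q a m, 2 ^ (q * k) * ω.length <
        2 * ∑ y : Fin k → Bits q, ω.countP (V y fun i => opt i (localScore V ω d i (y i))))]
      (fun _ => [])
      (400 * (unitCost t L r ω.length * (k * m + 1) * 2 ^ (a * k) * 2 ^ (q * k) *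
        2 ^ (k * (m * (k * (q + a))))) + 2 * (k + q + a + r) + 30) := by
  obtain ⟨opt, hopt₁, hopt₂⟩ := exists_choice k q a
  refine ⟨opt, hopt₁, fun {m r t L acc x V} ω hacc hver hL => ?_⟩
  have hdec : ∀ n, ∃ d : Advice k q a m, n < 2 ^ bits (adviceTemplate m k q a k) →
      num (inst (adviceTmpl k m q a) (fun p => mark p.1 p.2.2) (adviceBits d)) = n := by
    intro n
    by_cases hn : n < 2 ^ bits (adviceTemplate m k q a k)
    · exact (exists_advice hn).imp fun d hd _ => hd
    -- Numbers out of range are decoded to arbitrary advice; they never occur in the enumeration.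
    · exact ⟨fun _ _ => (fun _ _ => false, fun _ _ => false), fun h => absurd h hn⟩
  choose dec hdec using hdec
  have hseg : ∀ d : Advice k q a m, ∀ g ∈ segments d,
      ∃ c j, g = inst (pair k q a) (mark c) fun p => adviceBits d (c, j, p) := by
    intro d g hg
    simp only [segments, List.mem_flatten, List.mem_ofFn, Set.mem_range] at hg
    obtain ⟨l, ⟨c, rfl⟩, hg⟩ := hg
    obtain ⟨j, rfl⟩ := List.mem_ofFn.1 hg
    exact ⟨c, j, rfl⟩
  have hq : ∀ n, ∃ y : Fin k → Bits q, fill (blockStr false q k) n = encB y := by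
    intro n
    rw [← inst_blocks_false]
    obtain ⟨u, hu⟩ := exists_fill_eq (τ := blocks k q) mem_blocks (fun _ => false) (fun _ => false)
      (by rw [inst_blocks_false, bits_blockStr]; simp [mul_comm]) n
    exact ⟨fun i l => u (i, l), hu⟩
  have ha : ∀ n, ∃ b : Fin k → Bits a, fill (blockStr false a k) n = encB b := by
    intro n
    rw [← inst_blocks_false]
    obtain ⟨u, hu⟩ := exists_fill_eq (τ := blocks k a) mem_blocks (fun _ => false) (fun _ => false)
      (by rw [inst_blocks_false, bits_blockStr]; simp [mul_comm]) n
    exact ⟨fun i l => u (i, l), hu⟩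
  have hlen : ∀ k q (mk u : Fin k × Fin q → Bool), (inst (blocks k q) mk u).length = (q + 1) * k := by
    intro k q mk u
    rw [inst, List.length_map, ← length_blockStr false q k, ← inst_blocks_false, inst, List.length_map]
  have := answer_runs (S := S) (i := i) (acc := acc) (t := t) (L := L) (m := m) (k := k) (q := q)
    (a := a) (r := r) (g := k * m) (ws := ω.map encW) (x := x) (gs := fun n => segments (dec n))
    rfl ?_ ?_ hL ?_ ?_ ?_ ?_ ?_
  · rw [bits_adviceTemplate, List.length_map] at this
    have hs : ∀ d : Advice k q a m, 0 < surplus acc ((x.map fun b => some (false, b)) ++ [none])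
        (ω.map encW) (segments d) (blockStr false q k) (blockStr false a k) ↔
        2 ^ (q * k) * ω.length < 2 * ∑ y : Fin k → Bits q,
          ω.countP (V y fun i => opt i (localScore V ω d i (y i))) := by
      intro d
      have hle := totalWins_le acc ((x.map fun b => some (false, b)) ++ [none]) (ω.map encW)
        (segments d) (blockStr false q k) (blockStr false a k) (2 ^ bits (blockStr false q k))
      rw [surplus]
      rw [totalWins_eq (V := V) (fun ω d y => hopt₂ hacc ω d y)] at hle ⊢
      simp only [bits_blockStr, List.length_map] at hle ⊢
      omega
    have he : (∃ n < 2 ^ (k * (m * (k * (q + a)))), 0 < surplus acc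
        ((x.map fun b => some (false, b)) ++ [none]) (ω.map encW) (segments (dec n))
        (blockStr false q k) (blockStr false a k)) ↔ ∃ d : Advice k q a m, 2 ^ (q * k) * ω.length <
        2 * ∑ y : Fin k → Bits q, ω.countP (V y fun i => opt i (localScore V ω d i (y i))) := by
      constructor
      · rintro ⟨n, _, hn⟩
        exact ⟨dec n, (hs _).1 hn⟩
      · rintro ⟨d, hd⟩
        have hlt : num (inst (adviceTmpl k m q a) (fun p => mark p.1 p.2.2) (adviceBits d)) <
            2 ^ bits (adviceTemplate m k q a k) := by
          rw [← inst_adviceTmpl_false, bits_inst _ _ (fun p => mark p.1 p.2.2) _ (adviceBits d)]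
          exact num_lt _
        have e : adviceBits (dec _) = adviceBits d :=
          num_inst_injective mem_adviceTmpl _ (hdec _ hlt)
        rw [bits_adviceTemplate] at hlt
        refine ⟨_, hlt, ?_⟩
        rw [show segments (dec _) = segments d by simp only [segments, e], hs]
        exact hd
    rw [decide_eq_decide.2 he] at this
    exact this
  · intro n hn
    have := hdec n hn
    conv_lhs => rw [← this, ← inst_adviceTmpl_false, fill_num]
    rw [inst_adviceTmpl]
    rfl
  · intro n _
    simp [segments, List.length_flatten, List.map_ofFn, Function.comp_def, List.sum_ofFn]
  · simp [encW]
  · simp [encW]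
  · intro n _ g hg
    obtain ⟨c, j, rfl⟩ := hseg _ g hg
    rw [pair, inst_append, inst_map, inst_map, List.length_append, hlen, hlen]
  · intro l _ j n g hg w hw
    obtain ⟨c, i, rfl⟩ := hseg _ g hg
    obtain ⟨y, hy⟩ := hq j
    obtain ⟨b, hb⟩ := ha n
    obtain ⟨w, _, rfl⟩ := List.mem_map.1 hw
    rw [hy, hb, zipWith_select_segment]
    exact hver _ _ _
  · intro j n w hw
    obtain ⟨y, hy⟩ := hq j
    obtain ⟨b, hb⟩ := ha n
    obtain ⟨w, _, rfl⟩ := List.mem_map.1 hw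
    rw [hy, hb]
    exact hver _ _ _

end Mac

/-! ### Exponential moments and sampling -/

section Concentration

open Real Finset
open scoped BigOperators

variable {Y A : Type} [Fintype Y] [Nonempty Y]

/-- For |z| ≤ 1 one has exp z ≤ 1 + z + z². The linear term averages to zero. -/
theorem expect_exp_le {F : Y → ℝ} (h₀ : 𝔼 y, F y = 0) (h₁ : ∀ y, |F y| ≤ 1) {θ : ℝ} (hθ : 0 ≤ θ)
    (hθ' : θ ≤ 1) : 𝔼 y, exp (θ * F y) ≤ exp (θ ^ 2) := by
  have h : ∀ y, exp (θ * F y) ≤ 1 + θ * F y + θ ^ 2 := fun y => by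
    have hy := abs_le.1 (h₁ y)
    have hle : |θ * F y| ≤ 1 := by
      rw [abs_mul, abs_of_nonneg hθ]; nlinarith [abs_nonneg (F y), h₁ y]
    have := (abs_le.1 (abs_exp_sub_one_sub_id_le hle)).2
    have : (θ * F y) ^ 2 ≤ θ ^ 2 := by
      rw [mul_pow]; exact mul_le_of_le_one_right (sq_nonneg _) ((sq_le_one_iff_abs_le_one _).2 (h₁ y))
    linarith
  calc 𝔼 y, exp (θ * F y) ≤ 𝔼 y, (1 + θ * F y + θ ^ 2) := expect_le_expect fun y _ => h y
    _ = 1 + θ ^ 2 := by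
      rw [expect_add_distrib, expect_add_distrib, ← mul_expect, h₀]; simp
    _ ≤ exp (θ ^ 2) := by linarith [add_one_le_exp (θ ^ 2)]

theorem expect_exp_sum_le {F : Y → ℝ} (h₀ : 𝔼 y, F y = 0) (h₁ : ∀ y, |F y| ≤ 1) {θ : ℝ}
    (hθ : 0 ≤ θ) (hθ' : θ ≤ 1) (m : ℕ) :
    𝔼 s : Fin m → Y, exp (θ * ∑ j, F (s j)) ≤ exp (m * θ ^ 2) := by
  have h := Finset.expect_pow univ (fun y => exp (θ * F y)) m
  simp only [Fintype.piFinset_univ] at h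
  simp only [mul_sum, exp_sum]
  rw [← h, exp_nat_mul]
  exact pow_le_pow_left₀ (expect_nonneg fun y _ => (exp_pos _).le) (expect_exp_le h₀ h₁ hθ hθ') m

/-- Chernoff's method: Markov's inequality for the exponential moment of a sum of independent
samples. -/
theorem card_lt_sum_le {F : Y → ℝ} (h₀ : 𝔼 y, F y = 0) (h₁ : ∀ y, |F y| ≤ 1) {θ : ℝ}
    (hθ : 0 ≤ θ) (hθ' : θ ≤ 1) (m : ℕ) (D : ℝ) :
    ((univ.filter fun s : Fin m → Y => D < ∑ j, F (s j)).card : ℝ) ≤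
      exp (m * θ ^ 2 - θ * D) * Fintype.card (Fin m → Y) := by
  have h := expect_exp_sum_le h₀ h₁ hθ hθ' m
  rw [Fintype.expect_eq_sum_div_card, div_le_iff₀ (by exact_mod_cast Fintype.card_pos)] at h
  have h₂ : ((univ.filter fun s : Fin m → Y => D < ∑ j, F (s j)).card : ℝ) * exp (θ * D) ≤
      ∑ s : Fin m → Y, exp (θ * ∑ j, F (s j)) := by
    rw [← nsmul_eq_mul, ← sum_const]
    refine (sum_le_sum (f := fun _ => exp (θ * D)) fun s hs => ?_).trans
      (sum_le_sum_of_subset_of_nonneg (filter_subset _ _) fun s _ _ => (exp_pos _).le)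
    exact exp_le_exp.2 (mul_le_mul_of_nonneg_left (mem_filter.1 hs).2.le hθ)
  rw [sub_eq_add_neg, exp_add, exp_neg]
  have := exp_pos (θ * D)
  rw [mul_right_comm, ← div_eq_mul_inv, le_div_iff₀ this]
  exact h₂.trans h

/-- A maximal inequality: the function may be selected after the sample is seen, at the price of log
|A| / θ. The exponential of the selected sum is at most the sum of the exponentials over all `α`. -/
theorem expect_sum_select_le [Fintype A] [Nonempty A] {F : A → Y → ℝ} (h₀ : ∀ α, 𝔼 y, F α y = 0)
    (h₁ : ∀ α y, |F α y| ≤ 1) {θ : ℝ} (hθ : 0 < θ) (hθ' : θ ≤ 1) (m : ℕ) (sel : (Fin m → Y) → A) :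
    𝔼 s : Fin m → Y, ∑ j, F (sel s) (s j) ≤ log (Fintype.card A) / θ + m * θ := by
  -- The tangent bound z ≤ exp(z - c) + c - 1 takes the place of Jensen's inequality; this `c` makes
  -- the expectation of the exponential part at most 1.
  set c : ℝ := log (Fintype.card A) + m * θ ^ 2 with hc
  have h : ∀ s : Fin m → Y, θ * ∑ j, F (sel s) (s j) ≤
      (∑ α, exp (θ * ∑ j, F α (s j))) * exp (-c) + (c - 1) := fun s => by
    have h₂ := add_one_le_exp (θ * ∑ j, F (sel s) (s j) - c)
    rw [sub_eq_add_neg _ c, exp_add] at h₂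
    have h₃ : exp (θ * ∑ j, F (sel s) (s j)) ≤ ∑ α, exp (θ * ∑ j, F α (s j)) :=
      single_le_sum (f := fun α => exp (θ * ∑ j, F α (s j))) (fun α _ => (exp_pos _).le)
        (mem_univ (sel s))
    nlinarith [mul_le_mul_of_nonneg_right h₃ (exp_pos (-c)).le]
  have hA : (0 : ℝ) < Fintype.card A := by exact_mod_cast Fintype.card_pos
  have h₄ : θ * 𝔼 s : Fin m → Y, ∑ j, F (sel s) (s j) ≤ c := by
    rw [mul_expect]
    refine (expect_le_expect fun s _ => h s).trans ?_
    rw [expect_add_distrib, Fintype.expect_const, ← expect_mul, expect_sum_comm]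
    have : ∑ α, 𝔼 s : Fin m → Y, exp (θ * ∑ j, F α (s j)) ≤ Fintype.card A * exp (m * θ ^ 2) :=
      (sum_le_sum fun α _ => expect_exp_sum_le (h₀ α) (h₁ α) hθ.le hθ' m).trans (by simp)
    have e : Fintype.card A * exp (m * θ ^ 2) * exp (-c) = 1 := by
      nth_rewrite 1 [← exp_log hA]
      rw [← exp_add, ← exp_add, hc]; simp
    nlinarith [mul_le_mul_of_nonneg_right this (exp_pos (-c)).le]
  rw [div_add' _ _ _ hθ.ne', le_div_iff₀ hθ]
  nlinarith

/-- The best answers on a sample are nearly the best answers on average. -/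
theorem exists_sample {H : Type} [Fintype H] [Nonempty H] [Fintype A] [Nonempty A]
    {g : H → Y → A → ℝ} (hg : ∀ η y α, 0 ≤ g η y α) (hg' : ∀ η y α, g η y α ≤ 1) (h : H → A)
    {m : ℕ} (sel : H → (Fin m → Y) → A)
    (hsel : ∀ η s α, ∑ j, g η (s j) α ≤ ∑ j, g η (s j) (sel η s)) {θ : ℝ} (hθ : 0 < θ)
    (hθ' : θ ≤ 1) :
    ∃ s : Fin m → Y, m * 𝔼 η, 𝔼 y, g η y (h η) ≤
      m * 𝔼 η, 𝔼 y, g η y (sel η s) + (log (Fintype.card A) / θ + 2 * m * θ) := by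
  set μ : H → A → ℝ := fun η α => 𝔼 y, g η y α with hμ
  have hμ₀ : ∀ η α, 0 ≤ μ η α := fun η α => expect_nonneg fun y _ => hg η y α
  have hμ₁ : ∀ η α, μ η α ≤ 1 := fun η α => expect_le univ_nonempty fun y _ => hg' η y α
  have key : ∀ η, 𝔼 s : Fin m → Y, (m * μ η (h η) - m * μ η (sel η s)) ≤
      log (Fintype.card A) / θ + 2 * m * θ := by
    intro η
    have e₁ := expect_sum_select_le (F := fun α y => g η y α - μ η α) (fun α => by
      rw [expect_sub_distrib, Fintype.expect_const, sub_self]) (fun α y => by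
      rw [abs_le]; constructor <;> linarith [hg η y α, hg' η y α, hμ₀ η α, hμ₁ η α]) hθ hθ' m (sel η)
    -- The comparison answer `h η` does not depend on the sample, so a one-element index set
    -- suffices and no logarithm appears.
    have e₂ := expect_sum_select_le (A := Unit) (F := fun _ y => μ η (h η) - g η y (h η)) (fun α => by
      rw [expect_sub_distrib, Fintype.expect_const, sub_self]) (fun α y => by
      rw [abs_le]
      constructor <;> linarith [hg η y (h η), hg' η y (h η), hμ₀ η (h η), hμ₁ η (h η)]) hθ hθ' m
      fun _ => ()
    simp only [Fintype.card_unit, Nat.cast_one, log_one, zero_div, zero_add] at e₂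
    have : 𝔼 s : Fin m → Y, (m * μ η (h η) - m * μ η (sel η s)) ≤
        𝔼 s : Fin m → Y, (∑ j, (g η (s j) (sel η s) - μ η (sel η s)) +
          ∑ j, (μ η (h η) - g η (s j) (h η))) := by
      refine expect_le_expect fun s _ => ?_
      have := hsel η s (h η)
      simp only [sum_sub_distrib, sum_const, card_univ, Fintype.card_fin, nsmul_eq_mul]
      linarith
    rw [expect_add_distrib] at this
    linarith
  -- Exchanging the averages gives one sample that is good on average over `η`, without a union
  -- bound over `η`.
  have key₂ : 𝔼 s : Fin m → Y, 𝔼 η, (m * μ η (h η) - m * μ η (sel η s)) ≤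
      log (Fintype.card A) / θ + 2 * m * θ := by
    rw [expect_comm]
    exact expect_le univ_nonempty fun η _ => key η
  obtain ⟨s, _, hs⟩ := exists_le_of_expect_le univ_nonempty key₂
  refine ⟨s, ?_⟩
  rw [expect_sub_distrib, ← mul_expect, ← mul_expect] at hs
  linarith

end Concentration

/-! ### The hybrid argument: good advice exists -/

namespace Mac

section Hybrid

open Finset Function
open scoped BigOperators

/-- Resampling one coordinate preserves the uniform distribution: exchanging the fresh value with
the old one is an involution. -/
theorem expect_update {I Q : Type} [Fintype I] [DecidableEq I] [Fintype Q] [DecidableEq Q]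
    [Nonempty Q] (i : I) (F : (I → Q) → ℝ) : 𝔼 η, 𝔼 y, F (update y i η) = 𝔼 y, F y := by
  let swap : Q × (I → Q) ≃ Q × (I → Q) := ⟨fun p => (p.2 i, update p.2 i p.1),
    fun p => (p.2 i, update p.2 i p.1), fun p => by simp, fun p => by simp⟩
  have e : 𝔼 p : Q × (I → Q), F (update p.2 i p.1) = 𝔼 p : Q × (I → Q), F p.2 :=
    Fintype.expect_equiv swap _ _ fun p => rfl
  rw [← univ_product_univ, expect_product, expect_product] at e
  simpa using e

variable {k q a r : ℕ} {V : (Fin k → Bits q) → (Fin k → Bits a) → Bits r → Bool}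

/-- The strategies in which the first `n` Merlins follow the advice. -/
def hybrid {m : ℕ} (V : (Fin k → Bits q) → (Fin k → Bits a) → Bits r → Bool) (ω : List (Bits r))
    (opt : Fin k → (Bits a → ℕ) → Bits a) (β : Fin k → Bits q → Bits a) (d : Advice k q a m) (n : ℕ)
    (i : Fin k) (η : Bits q) : Bits a :=
  if (i : ℕ) < n then opt i (localScore V ω d i η) else β i η

/-- One Merlin at a time is switched from `β` to answers computed from advice. The other Merlins
form a fixed environment `B`, in which a best answer on sampled questions is nearly a best response;
in particular it is nearly as good as his answer in `B`. -/
theorem exists_good_hybrid {ω : List (Bits r)} (hω : ω ≠ []) {opt : Fin k → (Bits a → ℕ) → Bits a}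
    (hopt : ∀ i (s : Bits a → ℕ) α, s α ≤ s (opt i s)) (β : Fin k → Bits q → Bits a) {n : ℕ}
    (hn : n ≤ k) : ∃ d : Advice k q a (samples 5000 k a),
      𝔼 y : Fin k → Bits q, (ω.countP (V y fun i => β i (y i)) / ω.length : ℝ) ≤
      𝔼 y : Fin k → Bits q, (ω.countP (V y fun i => hybrid V ω opt β d n i (y i)) / ω.length : ℝ) +
        n / (24 * k) := by
  set m := samples 5000 k a with hm
  induction n with
  | zero => exact ⟨fun _ _ => (fun _ _ => false, fun _ _ => false), by simp [hybrid]⟩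
  | succ n ih =>
    obtain ⟨d, hd⟩ := ih (by omega)
    set i : Fin k := ⟨n, by omega⟩ with hi
    set B := hybrid V ω opt β d n with hB
    have hω' : (0 : ℝ) < ω.length := by exact_mod_cast List.length_pos_of_ne_nil hω
    have hk : (1 : ℝ) ≤ k := by exact_mod_cast (by omega : 1 ≤ k)
    let f (y : Fin k → Bits q) (b : Fin k → Bits a) : ℝ := ω.countP (V y b) / ω.length
    let g (η : Bits q) (y : Fin k → Bits q) (α : Bits a) : ℝ :=
      f (update y i η) (update (fun i' => B i' (y i')) i α)
    let sel (η : Bits q) (s : Fin m → Fin k → Bits q) : Bits a :=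
      opt i fun α => ∑ j, ω.countP (V (update (s j) i η) (update (fun i' => B i' (s j i')) i α))
    -- With θ = 1/(96k) the term 2mθ is m/(48k), half of the permitted loss m/(24k). The other half,
    -- 5000(a+1)k/48, covers log |A| / θ ≤ 96ak.
    obtain ⟨s, hs⟩ := exists_sample (g := g) (fun η y α => by positivity) (fun η y α => by
      refine div_le_one_of_le₀ ?_ hω'.le
      exact_mod_cast List.countP_le_length) (B i) sel (fun η s α => by
      have := hopt i (fun α => ∑ j, ω.countP
        (V (update (s j) i η) (update (fun i' => B i' (s j i')) i α))) α
      simp only [g, f, ← Finset.sum_div]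
      refine div_le_div_of_nonneg_right ?_ hω'.le
      exact_mod_cast this) (θ := 1 / (96 * k)) (by positivity)
      ((div_le_one (by positivity)).2 (by linarith))
    -- The sampled questions are recorded with the answers of the current hybrid. Only the part of
    -- Merlin `i` changes, so the Merlins switched before keep their strategies; his own recorded
    -- question and answer are overwritten whenever they are used.
    refine ⟨update d i fun j => (s j, fun i' => B i' (s j i')), ?_⟩
    set d' : Advice k q a m := update d i fun j => (s j, fun i' => B i' (s j i')) with hd'
    have hloc : ∀ i' : Fin k, i' ≠ i → localScore V ω d' i' = localScore V ω d i' := by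
      intro i' hne
      funext η α
      simp [localScore, hd', hne]
    have hsel : ∀ η, hybrid V ω opt β d' (n + 1) i η = sel η s := by
      intro η
      simp only [hybrid, hi, Nat.lt_succ_self, if_true, sel]
      congr 1
      funext α
      simp only [localScore]
      rw [← hi, hd']
      simp only [update_self]
    have hne : ∀ i' : Fin k, i' ≠ i → hybrid V ω opt β d' (n + 1) i' = B i' := by
      intro i' hne
      have : (i' : ℕ) < n + 1 ↔ (i' : ℕ) < n := by
        have : (i' : ℕ) ≠ n := fun h => hne (Fin.ext h)
        omega
      funext η
      simp only [hB, hybrid, this, hloc i' hne]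
    -- Drawing the question of Merlin `i` separately from the other questions turns `exists_sample`
    -- into a statement about acceptance rates.
    have e : ∀ C : Fin k → Bits q → Bits a, (∀ i', i' ≠ i → C i' = B i') →
        𝔼 η, 𝔼 y, g η y (C i η) = 𝔼 y, f y fun i' => C i' (y i') := by
      intro C hC
      rw [← expect_update i fun y => f y fun i' => C i' (y i')]
      refine expect_congr rfl fun η _ => expect_congr rfl fun y _ => ?_
      simp only [g]
      congr 1
      funext i'
      by_cases h : i' = i
      · subst h; simp
      · simp [h, hC]
    have e₁ := e B fun _ _ => rfl
    have e₂ := e _ hne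
    simp only [hsel] at e₂
    rw [e₁, e₂] at hs
    have hlog : Real.log (Fintype.card (Bits a)) ≤ a := by
      have : (Fintype.card (Bits a) : ℝ) = 2 ^ a := by simp
      rw [this, Real.log_pow]
      have := Real.log_two_lt_d9
      nlinarith [(Nat.cast_nonneg a : (0 : ℝ) ≤ a)]
    have hmR : (m : ℝ) = 5000 * (a + 1) * k ^ 2 := by
      rw [hm, samples]; push_cast; ring
    have hm0 : (0 : ℝ) < m := by rw [hmR]; positivity
    have herr : Real.log (Fintype.card (Bits a)) / (1 / (96 * (k : ℝ))) + 2 * m * (1 / (96 * k)) ≤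
        m * (1 / (24 * k)) := by
      have h₁ : Real.log (Fintype.card (Bits a)) / (1 / (96 * (k : ℝ))) ≤ a * (96 * k) := by
        rw [div_div_eq_mul_div, div_one]
        exact mul_le_mul_of_nonneg_right hlog (by positivity)
      have h₂ : (m : ℝ) * (1 / (24 * k)) - 2 * m * (1 / (96 * k)) = 5000 * (a + 1) * k / 48 := by
        rw [hmR]; field_simp; ring
      have h₃ : (a : ℝ) * (96 * k) ≤ 5000 * (a + 1) * k / 48 := by
        have : (0 : ℝ) ≤ a * k := by positivity
        nlinarith
      linarith
    have hfin : 𝔼 y, f y (fun i' => B i' (y i')) ≤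
        𝔼 y, f y (fun i' => hybrid V ω opt β d' (n + 1) i' (y i')) + 1 / (24 * k) := by
      refine le_of_mul_le_mul_left ?_ hm0
      linarith
    have : ((n + 1 : ℕ) : ℝ) / (24 * k) = n / (24 * k) + 1 / (24 * k) := by push_cast; ring
    rw [this]
    simp only [f] at hfin
    linarith

/-- Switching all `k` Merlins costs at most 1/24, and 7/12 - 1/24 = 13/24 is a strict majority. -/
theorem exists_good_advice {ω : List (Bits r)} (hω : ω ≠ []) {opt : Fin k → (Bits a → ℕ) → Bits a}
    (hopt : ∀ i (s : Bits a → ℕ) α, s α ≤ s (opt i s)) (β : Fin k → Bits q → Bits a)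
    (hβ : 7 * (2 ^ (q * k) * ω.length) ≤
      12 * ∑ y : Fin k → Bits q, ω.countP (V y fun i => β i (y i))) :
    ∃ d : Advice k q a (samples 5000 k a), 2 ^ (q * k) * ω.length <
      2 * ∑ y : Fin k → Bits q, ω.countP (V y fun i => opt i (localScore V ω d i (y i))) := by
  obtain ⟨d, hd⟩ := exists_good_hybrid (V := V) hω hopt β le_rfl
  refine ⟨d, ?_⟩
  have hω' : (0 : ℝ) < ω.length := by exact_mod_cast List.length_pos_of_ne_nil hω
  have hh : ∀ i η, hybrid V ω opt β d k i η = opt i (localScore V ω d i η) := fun i η => by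
    simp [hybrid]
  simp only [hh, ← expect_div] at hd
  rw [Fintype.expect_eq_sum_div_card, Fintype.expect_eq_sum_div_card] at hd
  have hcard : (Fintype.card (Fin k → Bits q) : ℝ) = 2 ^ (q * k) := by simp [pow_mul]
  rw [hcard] at hd
  have hQ : (0 : ℝ) < 2 ^ (q * k) := by positivity
  have hkk : (k : ℝ) / (24 * k) ≤ 1 / 24 := by
    rcases Nat.eq_zero_or_pos k with rfl | hk
    · simp
    · have : (0 : ℝ) < k := by exact_mod_cast hk
      rw [mul_comm, ← div_div, div_self this.ne']
  have hβ' : (7 : ℝ) * (2 ^ (q * k) * ω.length) ≤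
      12 * ∑ y : Fin k → Bits q, (ω.countP (V y fun i => β i (y i)) : ℝ) := by exact_mod_cast hβ
  have goal : (2 : ℝ) ^ (q * k) * ω.length < 2 * ∑ y : Fin k → Bits q,
      (ω.countP (V y fun i => opt i (localScore V ω d i (y i))) : ℝ) := by
    rw [div_div, div_div] at hd
    have hP : (0 : ℝ) < 2 ^ (q * k) * ω.length := by positivity
    have h₁ := (hd.trans (add_le_add_right hkk _))
    rw [div_add' _ _ _ hP.ne', div_le_div_iff_of_pos_right hP] at h₁
    linarith
  exact_mod_cast goal

end Hybrid

end Mac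

/-! ### Lists of coin strings -/

namespace Mac

section Coins

open Finset Function

theorem ofFn_reverse {α : Type} {n : ℕ} (f : Fin n → α) :
    (List.ofFn f).reverse = List.ofFn fun i => f i.rev := by
  refine List.ext_getElem (by simp) fun i h₁ h₂ => ?_
  simp only [List.getElem_reverse, List.getElem_ofFn, List.length_ofFn]
  congr 1
  simp [Fin.ext_iff, Fin.rev]
  omega

theorem zipWith_flatten_ofFn {α β γ : Type} (f : α → β → γ) {n : ℕ} (A : Fin n → List α)
    (B : Fin n → List β) (h : ∀ i, (A i).length = (B i).length) :
    List.zipWith f (List.ofFn A).flatten (List.ofFn B).flatten =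
      (List.ofFn fun i => List.zipWith f (A i) (B i)).flatten := by
  induction n with
  | zero => simp
  | succ n ih =>
    simp only [List.ofFn_succ, List.flatten_cons]
    rw [List.zipWith_append (h 0), ih _ _ fun i => h i.succ]

/-- Each block of `r + 1` coins begins with the one spent on the separator, which `succ` skips. The
stack reverses both the blocks and the bits inside them, whence the two uses of `rev`. -/
theorem reverse_zipWith_sample (N r : ℕ) (c : Fin (N * (r + 1)) → Bool) :
    (List.zipWith (fun (s : Symb) c => Option.map (fun _ => (false, c)) s)
      (List.replicate N (none :: List.replicate r one)).flatten (List.ofFn c)).reverse =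
      flat ((List.ofFn fun j : Fin N => fun i : Fin r =>
        c (finProdFinEquiv (j.rev, i.rev.succ))).map encW) := by
  rw [List.ofFn_mul, ← List.ofFn_const, zipWith_flatten_ofFn _ _ _ fun i => by simp,
    List.reverse_flatten, List.map_ofFn, ofFn_reverse, flat, List.map_ofFn, List.flatMap_def,
    List.map_ofFn]
  congr 2
  funext j
  have e : List.replicate r one = List.ofFn fun _ : Fin r => one := (List.ofFn_const ..).symm
  simp only [Function.comp_def, List.ofFn_succ, List.zipWith_cons_cons, List.reverse_cons,
    Option.map_none, encW]
  congr 1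
  rw [← ofFn_reverse (n := r) fun i => c (finProdFinEquiv (j.rev, i.succ)), List.map_reverse]
  congr 1
  refine List.ext_getElem (by simp) fun i h₁ h₂ => ?_
  simp only [List.getElem_zipWith, List.getElem_replicate, List.getElem_ofFn, List.getElem_map,
    Option.map_some]
  congr 3
  simp [Fin.ext_iff, finProdFinEquiv]
  ring

theorem exists_allStrings (r : ℕ) : ∃ ω : List (Bits r), allStrings r (2 ^ r) = ω.map encW ∧
    ω.length = 2 ^ r ∧ ∀ p : Bits r → Bool, ω.countP p = (univ.filter fun w => p w = true).card := by
  have hinst : ∀ u : Bits r, inst (List.ofFn fun i : Fin r => some i) (fun _ => false) u =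
      encW u := fun u => by simp [inst, encW, List.map_ofFn, Function.comp_def]
  have hone : encW (fun _ : Fin r => false) = List.replicate r one := by
    simp [encW, List.ofFn_const]
  have hmem : ∀ j : Fin r, some j ∈ List.ofFn fun i : Fin r => some i := fun j => by
    simp [List.mem_ofFn]
  have hbits : bits (inst (List.ofFn fun i : Fin r => some i) (fun _ => false) fun _ => false) =
      Fintype.card (Fin r) := by simp [hinst, hone]
  choose u hu using fun n => exists_fill_eq hmem (fun _ => false) (fun _ => false) hbits n
  simp only [hinst, hone] at hu
  refine ⟨(List.range (2 ^ r)).reverse.map fun n i => u n i.rev, ?_, by simp, fun p => ?_⟩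
  · rw [allStrings, List.map_map]
    refine List.map_congr_left fun n _ => ?_
    rw [hu, encW, ← List.map_reverse, ofFn_reverse]
    rfl
  · have h := sum_range_fill hmem (fun _ => false) (fun _ => false) hbits
      fun l => if ∃ w : Bits r, l = encW w ∧ p (fun i => w i.rev) = true then 1 else 0
    have hinj : Function.Injective (encW : Bits r → _) := fun w w' h =>
      inst_injective hmem (fun _ => false) (by rw [hinst, hinst, h])
    simp only [hinst, hone, hu, hinj.eq_iff, exists_eq_left', bits_replicate_some] at h
    rw [List.map_reverse, List.countP_reverse, List.countP_map, card_filter]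
    have e₁ : (List.range (2 ^ r)).countP (p ∘ fun n i => u n i.rev) =
        ∑ n ∈ range (2 ^ r), if p (fun i => u n i.rev) = true then 1 else 0 := by
      rw [List.countP_eq_length_filter, ← card_filter, card_def]
      simp [Multiset.range, Function.comp_def]
    rw [e₁, h]
    exact Fintype.sum_equiv (Equiv.arrowCongr Fin.revPerm (Equiv.refl Bool)) _ _ fun w => by
      simp [Equiv.arrowCongr, Function.comp_def]

/-- An event that depends only on the coins at the positions `e j` has the same density among all
coin sequences: the remaining coins are a free factor. -/
theorem card_filter_comp {J : Type} [Fintype J] [DecidableEq J] {T : ℕ} {e : J → Fin T}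
    (he : Injective e) (P : (J → Bool) → Prop) [DecidablePred P] :
    (univ.filter fun c : Bits T => P (c ∘ e)).card * 2 ^ Fintype.card J =
      (univ.filter P).card * 2 ^ T := by
  classical
  let E : (Fin T → Bool) ≃ (J → Bool) × (↥(Set.range e)ᶜ → Bool) :=
    (Equiv.arrowCongr ((Equiv.sumCongr (Equiv.ofInjective e he) (Equiv.refl _)).trans
      (Equiv.Set.sumCompl (Set.range e))).symm (Equiv.refl Bool)).trans
      (Equiv.sumArrowEquivProdArrow _ _ _)
  have hE : ∀ c, (E c).1 = c ∘ e := fun c => by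
    funext j
    simp [E, Equiv.sumArrowEquivProdArrow, Equiv.arrowCongr]
  have h₁ : (univ.filter fun c : Bits T => P (c ∘ e)).card =
      ((univ.filter P) ×ˢ (univ : Finset (↥(Set.range e)ᶜ → Bool))).card := by
    refine card_equiv E fun c => ?_
    simp [hE]
  have h₂ := Fintype.card_congr E
  rw [Fintype.card_prod] at h₂
  simp only [Fintype.card_fun, Fintype.card_bool, Fintype.card_fin] at h₂
  rw [h₁, card_product, h₂, card_univ, Fintype.card_fun, Fintype.card_bool]
  ring

end Coins

end Mac

theorem Polynomial.eval_mono_nat (p : Polynomial ℕ) {m n : ℕ} (h : m ≤ n) : p.eval m ≤ p.eval n := by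
  simp only [Polynomial.eval_eq_sum, Polynomial.sum]
  exact Finset.sum_le_sum fun i _ => Nat.mul_le_mul_left _ (Nat.pow_le_pow_left h i)

/-! ### Outputs of polynomial-time machines are short -/

section Growth

/-- A bound for the number of symbols that a statement pushes. -/
def pushes {K Λ σ : Type} {Γ : K → Type} : Stmt Γ Λ σ → ℕ
  | .push _ _ q => pushes q + 1
  | .peek _ _ q => pushes q
  | .pop _ _ q => pushes q
  | .load _ q => pushes q
  | .branch _ q₁ q₂ => pushes q₁ + pushes q₂
  | .goto _ => 0
  | .halt => 0

theorem length_stepAux_le {K Λ σ : Type} {Γ : K → Type} [DecidableEq K] (q : Stmt Γ Λ σ) (v : σ)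
    (T : ∀ k, List (Γ k)) (k : K) : ((stepAux q v T).stk k).length ≤ (T k).length + pushes q := by
  induction q generalizing v T with
  | push k' f q ih =>
    refine (ih _ _).trans ?_
    by_cases h : k = k'
    · subst h; simp [pushes]; omega
    · simp [pushes, h]
  | peek k' f q ih => exact ih _ _
  | pop k' f q ih =>
    refine (ih _ _).trans ?_
    by_cases h : k = k'
    · subst h; simp [pushes]
    · simp [pushes, h]
  | load f q ih => exact ih _ _
  | branch f q₁ q₂ h₁ h₂ =>
    simp only [stepAux, pushes]
    cases f v
    · exact (h₂ _ _).trans (by omega)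
    · exact (h₁ _ _).trans (by omega)
  | goto f => simp [pushes]
  | halt => simp [pushes]

/-- One step may push several symbols, but there are finitely many labels, so a constant bounds the
growth per step. -/
theorem length_output_le (tm : FinTM2) : ∃ D : ℕ, ∀ (inp : List (tm.Γ tm.k₀))
    (out : List (tm.Γ tm.k₁)) (t : ℕ), Nonempty (TM2OutputsInTime tm inp (some out) t) →
    out.length ≤ inp.length + D * t := by
  obtain ⟨D, hD⟩ : ∃ D, ∀ l, pushes (tm.m l) ≤ D :=
    ⟨Finset.univ.sup fun l => pushes (tm.m l), fun l =>
      Finset.le_sup (f := fun l => pushes (tm.m l)) (Finset.mem_univ l)⟩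
  refine ⟨D, fun inp out t ⟨⟨⟨n, hn⟩, hnt⟩⟩ => ?_⟩
  have key : ∀ (n : ℕ) (c d : tm.Cfg), (flip bind tm.step)^[n] (some c) = some d →
      ∀ k, (d.stk k).length ≤ (c.stk k).length + D * n := by
    intro n
    induction n with
    | zero =>
      intro c d h k
      obtain rfl := Option.some.inj h
      simp
    | succ n ih =>
      intro c d h k
      obtain ⟨_ | l, s, T⟩ := c
      · rw [Function.iterate_succ_apply] at h
        have e : flip bind tm.step (some ⟨none, s, T⟩) = none := rfl
        rw [e, Mac.iterate_bind_none] at h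
        exact absurd h (by simp)
      · rw [Function.iterate_succ_apply] at h
        refine (ih _ _ h k).trans ?_
        have := length_stepAux_le (tm.m l) s T k
        have := hD l
        simp only [Nat.mul_succ]
        omega
  have h := key n _ _ hn tm.k₁
  rw [Mac.haltList_stk, Mac.initList_stk] at h
  have h' : ((Function.update (fun _ => []) tm.k₀ inp : ∀ k, List (tm.Γ k)) tm.k₁).length ≤
      inp.length := by
    -- The output stack may coincide with the input stack, in which case it starts out with the
    -- input on it.
    by_cases e : tm.k₁ = tm.k₀
    · generalize tm.k₁ = k at e; subst e; simp
    · rw [Function.update_of_ne e]; simp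
  rw [Function.update_self] at h
  have : D * n ≤ D * t := Nat.mul_le_mul_left _ hnt
  omega

theorem unaryEncodeNat_eq (n : ℕ) : Computability.unaryEncodeNat n = List.replicate n true := by
  induction n with
  | zero => rfl
  | succ n ih => rw [Computability.unaryEncodeNat, ih, List.replicate_succ]

theorem PolyTimeConstructible.exists_le {f : ℕ → ℕ} (h : PolyTimeConstructible f) :
    ∃ s : Polynomial ℕ, ∀ n, f n ≤ s.eval n := by
  obtain ⟨M⟩ := h
  obtain ⟨D, hD⟩ := length_output_le M.tm
  refine ⟨Polynomial.X + Polynomial.C D * M.time, fun n => ?_⟩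
  have := hD _ _ _ ⟨M.outputsFun n⟩
  simpa [unaryEncodeNat_eq] using this

end Growth

/-! ### The machines of a protocol as subroutines -/

namespace Mac

variable {ι : Type} [DecidableEq ι] {S : ι → SubMachine}

theorem Verifies.mono {i : ι} {acc : List Symb → Bool} {t t' : ℕ} {s : List Symb}
    (h : Verifies S i acc t s) (ht : t ≤ t') : Verifies S i acc t' s :=
  fun v h₁ h₂ => (h v h₁ h₂).mono ht

theorem Computes.mono {i : ι} {n c t t' : ℕ} (h : Computes S i n c t) (ht : t ≤ t') :
    Computes S i n c t' :=
  fun v b h₁ => (h v b h₁).mono ht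

theorem computes_of_outputs {i : ι} {n c t : ℕ} {out : List ((S i).tm.Γ (S i).tm.k₁)}
    (h : Nonempty (TM2OutputsInTime (S i).tm (List.replicate n ((S i).enc one)) (some out) t))
    (hout : out.map (S i).dec = List.replicate c one) : Computes S i n c (n + t + c + 2) := by
  intro v b hv
  have hlen : out.length = c := by simpa using congrArg List.length hout
  refine (call_runs (A := (Name.arg, (0 : Fin 3))) (B := (b, 0)) (v := v)
    (inp := List.replicate n ((S i).enc one)) ?_ h).congr ?_ ?_
  · simp [hv]
  · simp [hout]
  · simp [hv, hlen]

theorem verifies_of_outputs {i : ι} {acc : List Symb → Bool} {t : ℕ} {s : List Symb}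
    {o : (S i).tm.Γ (S i).tm.k₁}
    (h : Nonempty (TM2OutputsInTime (S i).tm (s.map (S i).enc) (some [o]) t))
    (ho : (S i).dec o = some (false, acc s)) : Verifies S i acc (s.length + t + 3) s := by
  intro v hv hv'
  refine (call_runs (A := (Name.arg, (0 : Fin 3))) (B := (Name.res, 0)) (v := v)
    (inp := s.map (S i).enc) ?_ h).congr ?_ ?_
  · simp [hv]
  · simp [ho, hv']
  · simp [hv]

end Mac

/-- A machine computing a number in unary, as a subroutine. -/
def unarySub (M : TM2ComputableAux Bool Bool) : SubMachine :=
  ⟨M.tm, fun _ => M.inputAlphabet.invFun true, fun _ => Mac.one⟩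

/-- A machine for a verification procedure, as a subroutine. -/
def boolSub (M : TM2ComputableAux (Option Bool) Bool) : SubMachine :=
  ⟨M.tm, fun s => M.inputAlphabet.invFun (s.map Prod.snd), fun g => some (false, M.outputAlphabet g)⟩

namespace AMProtocol

open Mac

/-- The string that is given to the verification procedure. -/
def verifStr (x : List Bool) {k q a r : ℕ} (y : Fin k → Bits q) (b : Fin k → Bits a) (w : Bits r) :
    List Symb :=
  ((x.map fun b => some (false, b)) ++ [none]) ++ (encB y ++ encB b) ++ (encW w ++ [none])

theorem length_inst_blocks (k q : ℕ) (mk u : Fin k × Fin q → Bool) :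
    (inst (blocks k q) mk u).length = (q + 1) * k := by
  rw [inst, List.length_map, ← length_blockStr false q k, ← inst_blocks_false, inst, List.length_map]

theorem length_verifStr (x : List Bool) {k q a r : ℕ} (y : Fin k → Bits q) (b : Fin k → Bits a)
    (w : Bits r) :
    (verifStr x y b w).length = x.length + 1 + ((q + 1) * k + (a + 1) * k) + (r + 1) := by
  simp [verifStr, encB, encW, length_inst_blocks]; ring

theorem verifStr_inj {x : List Bool} {k q a r : ℕ} {y y' : Fin k → Bits q} {b b' : Fin k → Bits a}
    {w w' : Bits r} (h : verifStr x y b w = verifStr x y' b' w') : y = y' ∧ b = b' ∧ w = w' := by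
  have hB : ∀ {k q : ℕ}, Function.Injective (encB : (Fin k → Bits q) → _) := fun {k q} y y' h =>
    Function.uncurry_injective (inst_injective mem_blocks _ h)
  unfold verifStr at h
  obtain ⟨h₁, h₂⟩ := List.append_inj h (by simp [encB, length_inst_blocks])
  obtain ⟨h₃, h₄⟩ := List.append_inj (List.append_cancel_left h₁) (by simp [encB, length_inst_blocks])
  refine ⟨hB h₃, hB h₄, ?_⟩
  have := List.append_cancel_right h₂
  rw [encW, encW, (List.map_injective_iff.2 fun b b' h => by simpa using h).eq_iff] at this
  exact List.ofFn_injective this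

/-- Forgetting the marks gives exactly the encoding that the verification machine expects. -/
theorem map_verifStr {k q a r : ℕ → ℕ} (T : Transcript k q a r) :
    (verifStr T.x T.y T.b T.w).map (Option.map Prod.snd) = T.encode := by
  have hB : ∀ {k q : ℕ} (y : Fin k → Bits q), (encB y).map (Option.map Prod.snd) =
      ((List.ofFn fun i => List.ofFn (y i)).flatMap fun s => s.map some ++ [none]) := by
    intro k q y
    rw [encB, inst_blocks]
    simp [List.map_flatten, List.map_ofFn, Function.comp_def, List.flatMap_def, Function.uncurry]
  simp only [verifStr, Transcript.encode, List.map_append, hB, List.flatMap_cons, List.flatMap_append]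
  simp [encW, Function.comp_def, List.map_ofFn]

variable {k : ℕ → ℕ} (P : AMProtocol k)

/-- Everything the search needs from a protocol, with a single polynomial that bounds all parameters
and all calls. Subroutine `none` verifies; the other four compute the parameters. -/
theorem exists_machines : ∃ (S : Option (Fin 4) → SubMachine) (τ : Polynomial ℕ),
    ∀ x : List Bool, ∃ acc : List Symb → Bool,
      (k x.length ≤ τ.eval x.length ∧ P.q x.length ≤ τ.eval x.length ∧
        P.a x.length ≤ τ.eval x.length ∧ P.r x.length ≤ τ.eval x.length ∧
        x.length ≤ τ.eval x.length) ∧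
      Computes S (some 0) x.length (k x.length) (τ.eval x.length) ∧
      Computes S (some 1) x.length (P.q x.length) (τ.eval x.length) ∧
      Computes S (some 2) x.length (P.a x.length) (τ.eval x.length) ∧
      Computes S (some 3) x.length (P.r x.length) (τ.eval x.length) ∧
      ∀ y b w, acc (verifStr x y b w) = P.V ⟨x, y, b, w⟩ ∧
        Verifies S none acc (τ.eval x.length) (verifStr x y b w) := by
  classical
  obtain ⟨sk, hsk⟩ := P.k_constructible.exists_le
  obtain ⟨sq, hsq⟩ := P.q_constructible.exists_le
  obtain ⟨sa, hsa⟩ := P.a_constructible.exists_le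
  obtain ⟨sr, hsr⟩ := P.r_constructible.exists_le
  obtain ⟨Mk⟩ := P.k_constructible
  obtain ⟨Mq⟩ := P.q_constructible
  obtain ⟨Ma⟩ := P.a_constructible
  obtain ⟨Mr⟩ := P.r_constructible
  obtain ⟨MV⟩ := P.V_polyTime
  let S : Option (Fin 4) → SubMachine
    | none => boolSub MV.toTM2ComputableAux
    | some 0 => unarySub Mk.toTM2ComputableAux
    | some 1 => unarySub Mq.toTM2ComputableAux
    | some 2 => unarySub Ma.toTM2ComputableAux
    | some 3 => unarySub Mr.toTM2ComputableAux
  let len : Polynomial ℕ := Polynomial.X + 1 + ((sq + 1) * sk + (sa + 1) * sk) + (sr + 1)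
  let τ : Polynomial ℕ := Polynomial.X + sk + sq + sa + sr + Mk.time + Mq.time + Ma.time + Mr.time +
    len + MV.time.comp len + 3
  have hτ : ∀ n, τ.eval n = n + sk.eval n + sq.eval n + sa.eval n + sr.eval n + Mk.time.eval n +
      Mq.time.eval n + Ma.time.eval n + Mr.time.eval n + len.eval n + MV.time.eval (len.eval n) + 3 :=
    fun n => by simp [τ, Polynomial.eval_comp]
  have hun : ∀ (f : ℕ → ℕ) (i : Option (Fin 4)) (M : TM2ComputableInPolyTime
      Computability.unaryEncodeNat Computability.unaryEncodeNat f), S i = unarySub M.toTM2ComputableAux →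
      ∀ n, Computes S i n (f n) (n + M.time.eval n + f n + 2) := by
    intro f i M hi n
    have := M.outputsFun n
    simp only [unaryEncodeNat_eq, List.map_replicate, List.length_replicate] at this
    have h' : ∀ s : SubMachine, s = unarySub M.toTM2ComputableAux →
        ∃ out : List (s.tm.Γ s.tm.k₁), out.map s.dec = List.replicate (f n) one ∧
          Nonempty (TM2OutputsInTime s.tm (List.replicate n (s.enc one)) (some out) (M.time.eval n)) := by
      rintro _ rfl
      exact ⟨_, by simp [unarySub], ⟨this⟩⟩
    obtain ⟨out, h₁, h₂⟩ := h' (S i) hi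
    exact computes_of_outputs h₂ h₁
  -- The verdict is turned into a function of strings; it is well defined because a string
  -- determines its transcript (`verifStr_inj`).
  refine ⟨S, τ, fun x => ⟨fun s => decide (∃ y b w, verifStr x y b w = s ∧ P.V ⟨x, y, b, w⟩ = true),
    ⟨?_, ?_, ?_, ?_, ?_⟩, (hun k (some 0) Mk rfl _).mono ?_, (hun P.q (some 1) Mq rfl _).mono ?_,
    (hun P.a (some 2) Ma rfl _).mono ?_, (hun P.r (some 3) Mr rfl _).mono ?_, fun y b w => ?_⟩⟩
  iterate 9
    · have := hτ x.length
      have := hsk x.length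
      have := hsq x.length
      have := hsa x.length
      have := hsr x.length
      omega
  have hacc : decide (∃ y' b' w', verifStr x y' b' w' = verifStr x y b w ∧
      P.V ⟨x, y', b', w'⟩ = true) = P.V ⟨x, y, b, w⟩ := by
    by_cases h : P.V ⟨x, y, b, w⟩ = true
    · rw [h]; exact decide_eq_true ⟨y, b, w, rfl, h⟩
    · rw [Bool.not_eq_true] at h
      rw [h]
      refine decide_eq_false ?_
      rintro ⟨y', b', w', e, h'⟩
      obtain ⟨rfl, rfl, rfl⟩ := verifStr_inj e
      simp [h] at h'
  refine ⟨hacc, ?_⟩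
  have hlen : (verifStr x y b w).length ≤ len.eval x.length := by
    rw [length_verifStr]
    simp only [len, Polynomial.eval_add, Polynomial.eval_mul, Polynomial.eval_X, Polynomial.eval_one]
    gcongr
    exacts [hsq _, hsk _, hsa _, hsk _, hsr _]
  have hout := MV.outputsFun ⟨x, y, b, w⟩
  have hl : (Transcript.encode (⟨x, y, b, w⟩ : Transcript k P.q P.a P.r)).length =
      (verifStr x y b w).length := by
    rw [← map_verifStr, List.length_map]
  rw [hl, ← map_verifStr, List.map_map] at hout
  refine (verifies_of_outputs (S := S) (i := none) (t := MV.time.eval (verifStr x y b w).length)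
    (o := MV.outputAlphabet.invFun (P.V ⟨x, y, b, w⟩)) ⟨hout⟩ ?_).mono ?_
  · exact congrArg (fun b => some (false, b)) ((MV.outputAlphabet.right_inv _).trans hacc.symm)
  · have := hτ x.length
    have := MV.time.eval_mono_nat hlen
    change (verifStr x y b w).length + _ + 3 ≤ _
    omega

end AMProtocol

/-! ### Sampling the auxiliary randomness -/

namespace Mac

section Sampling

open Finset
open scoped BigOperators

/-- A union bound: each `β` deviates upwards by more than N/12 with probability at most exp(-N/576),
and there are at most exp(N/576)/3 of them. -/
theorem card_good_le {W B : Type} [Fintype W] [Nonempty W] [Fintype B] {F : B → W → ℝ}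
    (h₀ : ∀ β w, 0 ≤ F β w) (h₁ : ∀ β w, F β w ≤ 1) {N : ℕ}
    (hN : 3 * (Fintype.card B : ℝ) ≤ Real.exp (N / 576)) (G : (Fin N → W) → Prop) [DecidablePred G]
    (hG : ∀ ω : Fin N → W, (∀ β, ∑ j, F β (ω j) ≤ N * (𝔼 w, F β w) + N / 12) → G ω) :
    2 * Fintype.card (Fin N → W) ≤ 3 * (univ.filter G).card := by
  classical
  set μ : B → ℝ := fun β => 𝔼 w, F β w with hμ
  have hμ₀ : ∀ β, 0 ≤ μ β := fun β => expect_nonneg fun w _ => h₀ β w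
  have hμ₁ : ∀ β, μ β ≤ 1 := fun β => expect_le univ_nonempty fun w _ => h₁ β w
  have hbad : ∀ β, ((univ.filter fun ω : Fin N → W =>
      (N / 12 : ℝ) < ∑ j, (F β (ω j) - μ β)).card : ℝ) ≤
      Real.exp (-(N / 576)) * Fintype.card (Fin N → W) := fun β => by
    -- The value 1/24 minimises the exponent Nθ² - θN/12, which becomes -N/576.
    refine (card_lt_sum_le (θ := 1 / 24) (F := fun w => F β w - μ β) ?_ (fun w => ?_) (by norm_num)
      (by norm_num) N (N / 12)).trans (le_of_eq ?_)
    · rw [expect_sub_distrib, Fintype.expect_const, sub_self]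
    · rw [abs_le]; constructor <;> linarith [h₀ β w, h₁ β w, hμ₀ β, hμ₁ β]
    · congr 2; ring
  have hsub : (univ.filter fun ω : Fin N → W => ¬ G ω) ⊆
      univ.biUnion fun β => univ.filter fun ω : Fin N → W =>
        (N / 12 : ℝ) < ∑ j, (F β (ω j) - μ β) := by
    intro ω hω
    by_contra hcon
    simp only [mem_biUnion, mem_univ, mem_filter, true_and, not_exists, not_lt, sum_sub_distrib,
      sum_const, card_univ, Fintype.card_fin, nsmul_eq_mul] at hcon hω
    exact hω (hG ω fun β => by linarith [hcon β])
  have hle : ((univ.filter fun ω : Fin N → W => ¬ G ω).card : ℝ) * 3 ≤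
      Fintype.card (Fin N → W) := by
    have h₂ : ((univ.filter fun ω : Fin N → W => ¬ G ω).card : ℝ) ≤
        Fintype.card B * (Real.exp (-(N / 576)) * Fintype.card (Fin N → W)) := by
      have := (card_le_card hsub).trans card_biUnion_le
      calc ((univ.filter fun ω : Fin N → W => ¬ G ω).card : ℝ) ≤ _ := Nat.cast_le.2 this
        _ ≤ ∑ β : B, Real.exp (-(N / 576)) * Fintype.card (Fin N → W) := by
          push_cast; exact sum_le_sum fun β _ => hbad β
        _ = _ := by simp
    have h₃ : Fintype.card B * Real.exp (-(N / 576 : ℝ)) * 3 ≤ 1 := by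
      rw [Real.exp_neg, mul_right_comm, ← div_eq_mul_inv, div_le_one (Real.exp_pos _)]
      linarith
    have h₄ : (0 : ℝ) ≤ Fintype.card (Fin N → W) := Nat.cast_nonneg _
    nlinarith
  have hle' : (univ.filter fun ω : Fin N → W => ¬ G ω).card * 3 ≤ Fintype.card (Fin N → W) := by
    exact_mod_cast hle
  have := card_filter_add_card_filter_not (s := (univ : Finset (Fin N → W))) G
  rw [card_univ] at this
  omega

/-- The number of acceptances over all questions and the given coin strings. -/
def winCount {k q a r : ℕ} (V : (Fin k → Bits q) → (Fin k → Bits a) → Bits r → Bool)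
    (ω : List (Bits r)) (β : Fin k → Bits q → Bits a) : ℕ :=
  ∑ y : Fin k → Bits q, ω.countP (V y fun i => β i (y i))

variable {k q a r : ℕ} {V : (Fin k → Bits q) → (Fin k → Bits a) → Bits r → Bool}

theorem winCount_ofFn {N : ℕ} (ω : Fin N → Bits r) (β : Fin k → Bits q → Bits a) :
    winCount V (List.ofFn ω) β = ∑ j, winCount V [ω j] β := by
  have : ∀ (p : Bits r → Bool), (List.ofFn ω).countP p = ∑ j, [ω j].countP p := by
    intro p
    have h : ∀ l : List (Bits r), l.countP p = (l.map fun w => [w].countP p).sum := by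
      intro l
      induction l with
      | nil => rfl
      | cons w l ih => rw [List.map_cons, List.sum_cons, ← ih, ← List.countP_append]; rfl
    rw [h, List.map_ofFn, List.sum_ofFn]
    rfl
  simp only [winCount, this]
  exact sum_comm

theorem winCount_le (ω : List (Bits r)) (β : Fin k → Bits q → Bits a) :
    winCount V ω β ≤ 2 ^ (q * k) * ω.length := by
  refine (sum_le_card_nsmul _ _ ω.length fun y _ => List.countP_le_length).trans ?_
  simp [pow_mul]

theorem expect_winCount (β : Fin k → Bits q → Bits a) :
    𝔼 w : Bits r, (winCount V [w] β / 2 ^ (q * k) : ℝ) =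
      ((univ.filter fun yw : (Fin k → Bits q) × Bits r =>
        V yw.1 (fun i => β i (yw.1 i)) yw.2 = true).card : ℝ) /
        Fintype.card ((Fin k → Bits q) × Bits r) := by
  have : (univ.filter fun yw : (Fin k → Bits q) × Bits r =>
      V yw.1 (fun i => β i (yw.1 i)) yw.2 = true).card = ∑ w : Bits r, winCount V [w] β := by
    rw [card_filter, ← univ_product_univ, sum_product, sum_comm]
    refine sum_congr rfl fun w _ => sum_congr rfl fun y _ => ?_
    simp [List.countP_singleton]
  rw [this, Fintype.expect_eq_sum_div_card, ← sum_div, div_div]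
  simp [pow_mul]

/-- The search finds suitable advice. -/
def Found (V : (Fin k → Bits q) → (Fin k → Bits a) → Bits r → Bool)
    (opt : Fin k → (Bits a → ℕ) → Bits a) (m : ℕ) (ω : List (Bits r)) : Prop :=
  ∃ d : Advice k q a m, 2 ^ (q * k) * ω.length <
    2 * ∑ y : Fin k → Bits q, ω.countP (V y fun i => opt i (localScore V ω d i (y i)))

/-- Soundness of the search: whatever the advice, the answers it induces are legitimate strategies.
-/
theorem not_found {opt : Fin k → (Bits a → ℕ) → Bits a} {m : ℕ} {ω : List (Bits r)}
    (h : ∀ β, 2 * winCount V ω β ≤ 2 ^ (q * k) * ω.length) : ¬ Found V opt m ω := by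
  rintro ⟨d, hd⟩
  have := h fun i η => opt i (localScore V ω d i η)
  rw [winCount] at this
  omega

/-- There are 2^(2a·2^q) pairs of strategies. Replacing 2 and 3 by powers of e leaves 2 + 2a·2^q ≤
2(a+1)·2^q ≤ 2·2^a·2^q, and 2·576 ≤ 2048. -/
theorem three_mul_card_le {q a N : ℕ} (hN : N = 2048 * 2 ^ q * 2 ^ a) :
    3 * (Fintype.card (Fin 2 → Bits q → Bits a) : ℝ) ≤ Real.exp (N / 576) := by
  have h₁ : (Fintype.card (Fin 2 → Bits q → Bits a) : ℝ) = 2 ^ (2 * (a * 2 ^ q)) := by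
    simp [← pow_mul]; ring_nf
  have h₂ : (2 : ℝ) ≤ Real.exp 1 := by have := Real.add_one_le_exp (1 : ℝ); linarith
  have h₃ : (3 : ℝ) ≤ Real.exp 2 := by have := Real.add_one_le_exp (2 : ℝ); linarith
  have h₄ : (2 : ℝ) ^ (2 * (a * 2 ^ q)) ≤ Real.exp ((2 * (a * 2 ^ q) : ℕ) : ℝ) := by
    rw [← mul_one ((2 * (a * 2 ^ q) : ℕ) : ℝ), Real.exp_nat_mul]
    exact pow_le_pow_left₀ (by norm_num) h₂ _
  rw [h₁]
  calc 3 * (2 : ℝ) ^ (2 * (a * 2 ^ q)) ≤ Real.exp 2 * Real.exp ((2 * (a * 2 ^ q) : ℕ) : ℝ) := by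
        gcongr
    _ = Real.exp (2 + ((2 * (a * 2 ^ q) : ℕ) : ℝ)) := (Real.exp_add _ _).symm
    _ ≤ _ := by
      refine Real.exp_le_exp.2 ?_
      rw [le_div_iff₀ (by norm_num), hN]
      have h₅ : (a + 1 : ℝ) ≤ 2 ^ a := by
        have := Nat.lt_two_pow_self (n := a)
        exact_mod_cast this
      have h₆ : (1 : ℝ) ≤ 2 ^ q := one_le_pow₀ (by norm_num)
      have h₇ : (0 : ℝ) ≤ a := Nat.cast_nonneg a
      push_cast
      have h₈ : (2 : ℝ) ^ q * (a + 1) ≤ 2 ^ q * 2 ^ a := by gcongr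
      have h₉ : (0 : ℝ) ≤ 2 ^ q * a := by positivity
      nlinarith

/-- Only one pair of strategies has to survive the sampling. The rejection rate is used, so that an
upward deviation is what must be excluded; 2/3 - 1/12 = 7/12 remains. -/
theorem card_yes_le {V : (Fin 2 → Bits q) → (Fin 2 → Bits a) → Bits r → Bool} {N : ℕ}
    (hN : N = 2048 * 2 ^ q * 2 ^ a) (β : Fin 2 → Bits q → Bits a)
    (hβ : (2 / 3 : ℝ) ≤ 𝔼 w : Bits r, (winCount V [w] β / 2 ^ (q * 2) : ℝ))
    {G : (Fin N → Bits r) → Prop} [DecidablePred G]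
    (hG : ∀ ω, 7 * (2 ^ (q * 2) * N) ≤ 12 * winCount V (List.ofFn ω) β → G ω) :
    2 * Fintype.card (Fin N → Bits r) ≤ 3 * (univ.filter G).card := by
  have hQ : (0 : ℝ) < 2 ^ (q * 2) := by positivity
  refine card_good_le (B := Unit) (F := fun _ w => 1 - winCount V [w] β / 2 ^ (q * 2))
    (fun _ w => ?_) (fun _ w => ?_) ((three_mul_card_le hN).trans' ?_) G fun ω hω => hG ω ?_
  · rw [sub_nonneg, div_le_one hQ]
    have := winCount_le (V := V) [w] β
    simp only [List.length_singleton, mul_one] at this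
    exact_mod_cast this
  · have : (0 : ℝ) ≤ winCount V [w] β / 2 ^ (q * 2) := by positivity
    linarith
  · have : (1 : ℝ) ≤ Fintype.card (Fin 2 → Bits q → Bits a) := by
      exact_mod_cast Fintype.card_pos
    simpa using this
  · have h := hω ()
    rw [expect_sub_distrib, Fintype.expect_const, sum_sub_distrib, ← sum_div] at h
    simp only [sum_const, card_univ, Fintype.card_fin, nsmul_eq_mul, mul_one] at h
    have hN0 : (0 : ℝ) ≤ N := Nat.cast_nonneg N
    have h' : (7 / 12 : ℝ) * N ≤ (∑ j, (winCount V [ω j] β : ℝ)) / 2 ^ (q * 2) := by nlinarith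
    rw [le_div_iff₀ hQ] at h'
    have : (7 : ℝ) * (2 ^ (q * 2) * N) ≤ 12 * ∑ j, (winCount V [ω j] β : ℝ) := by linarith
    rw [winCount_ofFn]
    exact_mod_cast this

/-- All pairs of strategies have to be controlled at once, since the advice is chosen after the coin
strings. Every rate stays below 1/3 + 1/12 < 1/2. -/
theorem card_no_le {V : (Fin 2 → Bits q) → (Fin 2 → Bits a) → Bits r → Bool} {N : ℕ}
    (hN : N = 2048 * 2 ^ q * 2 ^ a)
    (hV : ∀ β, 𝔼 w : Bits r, (winCount V [w] β / 2 ^ (q * 2) : ℝ) ≤ 1 / 3)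
    {G : (Fin N → Bits r) → Prop} [DecidablePred G]
    (hG : ∀ ω, (∀ β, 2 * winCount V (List.ofFn ω) β ≤ 2 ^ (q * 2) * N) → G ω) :
    2 * Fintype.card (Fin N → Bits r) ≤ 3 * (univ.filter G).card := by
  have hQ : (0 : ℝ) < 2 ^ (q * 2) := by positivity
  refine card_good_le (F := fun (β : Fin 2 → Bits q → Bits a) w => winCount V [w] β / 2 ^ (q * 2))
    (fun β w => by positivity) (fun β w => ?_) (three_mul_card_le hN) G fun ω hω => hG ω fun β => ?_
  · rw [div_le_one hQ]
    have := winCount_le (V := V) [w] β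
    simp only [List.length_singleton, mul_one] at this
    exact_mod_cast this
  · have h := hω β
    have h₁ := hV β
    rw [← sum_div] at h
    have hN0 : (0 : ℝ) ≤ N := Nat.cast_nonneg N
    have h' : (∑ j, (winCount V [ω j] β : ℝ)) / 2 ^ (q * 2) ≤ 1 / 2 * N := by nlinarith
    rw [div_le_iff₀ hQ] at h'
    have : 2 * ∑ j, (winCount V [ω j] β : ℝ) ≤ 2 ^ (q * 2) * (N : ℝ) := by linarith
    rw [winCount_ofFn]
    exact_mod_cast this

end Sampling

end Mac

open Mac

/-! ### The deterministic algorithm -/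

section Deterministic

open Finset
open scoped BigOperators Classical

variable {k : ℕ → ℕ} (P : AMProtocol k)

namespace AMProtocol

/-- The verification procedure on a fixed input. -/
def verdict (x : List Bool) (y : Fin (k x.length) → Bits (P.q x.length))
    (b : Fin (k x.length) → Bits (P.a x.length)) (w : Bits (P.r x.length)) : Bool :=
  P.V ⟨x, y, b, w⟩

theorem acceptProb_eq (x : List Bool) (β : P.Strategies x.length) :
    (P.acceptProb x β : ℝ) = 𝔼 w : Bits (P.r x.length),
      (winCount (P.verdict x) [w] β / 2 ^ (P.q x.length * k x.length) : ℝ) := by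
  rw [expect_winCount, acceptProb]
  push_cast
  rfl

variable {P} {L : Language Bool}

theorem Decides.yes (h : P.Decides L) {x : List Bool} (hx : x ∈ L) :
    ∃ β : P.Strategies x.length, (2 / 3 : ℝ) ≤ 𝔼 w : Bits (P.r x.length),
      (winCount (P.verdict x) [w] β / 2 ^ (P.q x.length * k x.length) : ℝ) := by
  obtain ⟨β, hβ⟩ := (h x).1 hx
  refine ⟨β, ?_⟩
  rw [← acceptProb_eq]
  have := (Rat.cast_le (K := ℝ)).2 hβ
  push_cast at this
  exact this

theorem Decides.no (h : P.Decides L) {x : List Bool} (hx : x ∉ L) (β : P.Strategies x.length) :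
    𝔼 w : Bits (P.r x.length),
      (winCount (P.verdict x) [w] β / 2 ^ (P.q x.length * k x.length) : ℝ) ≤ 1 / 3 := by
  rw [← acceptProb_eq]
  have := (Rat.cast_le (K := ℝ)).2 ((h x).2 hx β)
  push_cast at this
  exact this

/-- With every auxiliary string listed once, rates over `ω` are the exact acceptance probabilities:
2/3 is above the 7/12 needed for good advice, and 1/3 is below 1/2. -/
theorem Decides.found_iff (h : P.Decides L) (x : List Bool)
    {opt : Fin (k x.length) → (Bits (P.a x.length) → ℕ) → Bits (P.a x.length)}
    (hopt : ∀ i (s : Bits (P.a x.length) → ℕ) α, s α ≤ s (opt i s)) {ω : List (Bits (P.r x.length))}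
    (hω : ω.length = 2 ^ P.r x.length)
    (hω' : ∀ p : Bits (P.r x.length) → Bool, ω.countP p = (univ.filter fun w => p w = true).card) :
    Found (P.verdict x) opt (samples 5000 (k x.length) (P.a x.length)) ω ↔ x ∈ L := by
  have hne : ω ≠ [] := by
    rintro rfl
    exact (Nat.two_pow_pos _).ne hω
  have hQ : (0 : ℝ) < 2 ^ (P.q x.length * k x.length) * 2 ^ P.r x.length := by positivity
  have e : ∀ β : P.Strategies x.length, 𝔼 w : Bits (P.r x.length),
      (winCount (P.verdict x) [w] β / 2 ^ (P.q x.length * k x.length) : ℝ) =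
      winCount (P.verdict x) ω β / (2 ^ (P.q x.length * k x.length) * 2 ^ P.r x.length) := by
    intro β
    have : winCount (P.verdict x) ω β = ∑ w, winCount (P.verdict x) [w] β := by
      simp only [winCount, hω']
      rw [sum_comm]
      refine sum_congr rfl fun y _ => ?_
      rw [card_filter]
      exact sum_congr rfl fun w _ => by simp [List.countP_singleton]
    rw [this, Fintype.expect_eq_sum_div_card, ← sum_div, div_div]
    simp
  by_cases hx : x ∈ L
  · refine iff_of_true ?_ hx
    obtain ⟨β, hβ⟩ := h.yes hx
    rw [e, le_div_iff₀ hQ] at hβ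
    refine exists_good_advice hne hopt β ?_
    rw [hω]
    have : (7 : ℝ) * (2 ^ (P.q x.length * k x.length) * 2 ^ P.r x.length) ≤
        12 * winCount (P.verdict x) ω β := by linarith
    exact_mod_cast this
  · refine iff_of_false (not_found fun β => ?_) hx
    have hβ := h.no hx β
    rw [e, div_le_iff₀ hQ] at hβ
    rw [hω]
    have : 2 * (winCount (P.verdict x) ω β : ℝ) ≤
        2 ^ (P.q x.length * k x.length) * 2 ^ P.r x.length := by linarith
    exact_mod_cast this

end AMProtocol

/-- The part of the running time that does not depend on the number of random strings. -/
def baseCost (n k q a r τ : ℕ) : ℕ :=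
  setupCost 5000 n k q a (τ + τ + τ + τ) + 2 * (k + q + a + r) + 30

/-- The exponent in the running time of the search. -/
def exponent (k q a : ℕ) : ℕ := a * k + q * k + k * (samples 5000 k a * (k * (q + a)))

/-- The cost of a single evaluation, up to the number of random strings. -/
def evalCost (n k q a r τ : ℕ) : ℕ :=
  (τ + (n + 1 + (q + 1) * k + (a + 1) * k) + r + 1) * (k * samples 5000 k a + 1)

/-- Bounds for the parameters of a protocol. -/
def ParamsLE (τ : Polynomial ℕ) : Prop := ∀ n, k n ≤ τ.eval n ∧ P.q n ≤ τ.eval n ∧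
  P.a n ≤ τ.eval n ∧ P.r n ≤ τ.eval n ∧ n ≤ τ.eval n

theorem exists_mem_DTIME {L : Language Bool} (h : P.Decides L) : ∃ τ : Polynomial ℕ,
    ParamsLE P τ ∧ ∀ T : ℕ → ℕ, (∀ n, baseCost n (k n) (P.q n) (P.a n) (P.r n) (τ.eval n) +
      (9 * P.r n + 7) * 2 ^ P.r n + 3 + 400 * (evalCost n (k n) (P.q n) (P.a n) (P.r n) (τ.eval n) *
        (2 ^ P.r n + 1) * 2 ^ exponent (k n) (P.q n) (P.a n)) ≤ T n) → L ∈ DTIME T := by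
  obtain ⟨S, τ, hS⟩ := P.exists_machines
  refine ⟨τ, fun n => ?_, fun T hT => ⟨⟨⟨((setup 5000 (some 0) (some 1) (some 2) (some 3) ;;
    enumCoins ;; answer none : Mac (Var Name) S) ;; reset).toTM2, Equiv.refl Bool, Equiv.refl Bool⟩, T,
    fun x => Classical.choice ?_⟩, fun n => le_rfl⟩⟩
  · obtain ⟨acc, hle, -⟩ := hS (List.replicate n false)
    simpa using hle
  obtain ⟨acc, -, hk, hq, ha, hr, hacc⟩ := hS x
  obtain ⟨ω, hω₁, hω₂, hω₃⟩ := exists_allStrings (P.r x.length)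
  obtain ⟨opt, hopt, hans⟩ := answer_runs_of_verifies (S := S) (i := none) (k x.length) (P.q x.length)
    (P.a x.length)
  have h₁ := setup_runs (c := 5000) (r := P.r x.length) hk hq ha hr
  have h₂ := enumCoins_runs (S := S) (r := P.r x.length)
    (v := setupStk x (samples 5000 (k x.length) (P.a x.length)) (k x.length) (P.q x.length)
      (P.a x.length) (P.r x.length)) (by simp [setupStk]) (by simp [setupStk]) (by simp [setupStk])
    (by simp [setupStk])
  rw [hω₁] at h₂
  have h₃ := hans (m := samples 5000 (k x.length) (P.a x.length)) (V := P.verdict x) ω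
    (fun y b w => (hacc y b w).1) (fun y b w => (hacc y b w).2) le_rfl
  have e := h.found_iff x hopt hω₂ hω₃
  rw [Found] at e
  rw [decide_eq_decide.2 e] at h₃
  obtain ⟨out⟩ := toTM2_outputs (h₁.seq (h₂.seq h₃))
  refine ⟨⟨⟨out.steps, ?_⟩, out.steps_le_m.trans ((le_of_eq ?_).trans (hT x.length))⟩⟩
  · refine Eq.trans ?_ out.evals_in_steps
    exact congrArg (fun l => (flip bind _)^[out.steps] (some (initList _ l))) (List.map_id x)
  · rw [hω₂, unitCost, baseCost, evalCost, exponent, pow_add, pow_add]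
    ring

end Deterministic

/-! ### The probabilistic algorithm for two Merlins -/

section Randomized

open Finset
open scoped BigOperators Classical

variable {P : AMProtocol fun _ => 2} {L : Language Bool}

theorem AMProtocol.Decides.card_found_le (h : P.Decides L) (x : List Bool)
    {opt : Fin 2 → (Bits (P.a x.length) → ℕ) → Bits (P.a x.length)}
    (hopt : ∀ i (s : Bits (P.a x.length) → ℕ) α, s α ≤ s (opt i s)) {N : ℕ}
    (hN : N = 2048 * 2 ^ P.q x.length * 2 ^ P.a x.length) :
    2 * Fintype.card (Fin N → Bits (P.r x.length)) ≤
      3 * (univ.filter fun ω : Fin N → Bits (P.r x.length) =>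
        decide (Found (P.verdict x) opt (samples 5000 2 (P.a x.length)) (List.ofFn ω)) =
          decide (x ∈ L)).card := by
  have hN0 : 0 < N := by rw [hN]; positivity
  by_cases hx : x ∈ L
  · obtain ⟨β, hβ⟩ := h.yes hx
    refine card_yes_le (V := P.verdict x) hN β hβ fun ω hω => decide_eq_decide.2 (iff_of_true ?_ hx)
    refine exists_good_advice (fun h0 => ?_) hopt β ?_
    · have := congrArg List.length h0
      simp only [List.length_ofFn, List.length_nil] at this
      omega
    · simpa [winCount] using hω
  · refine card_no_le (V := P.verdict x) hN (h.no hx) fun ω hω =>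
      decide_eq_decide.2 (iff_of_false (not_found fun β => ?_) hx)
    simpa using hω β

theorem exists_mem_BPTIME (h : P.Decides L) : ∃ τ : Polynomial ℕ,
    ParamsLE P τ ∧ ∀ T : ℕ → ℕ, (∀ n, baseCost n 2 (P.q n) (P.a n) (P.r n) (τ.eval n) +
      (9 * P.q n + 9 * P.a n + 6 * P.r n + 12) * (2048 * 2 ^ P.q n * 2 ^ P.a n) +
      8 * P.q n + 8 * P.a n + 2058 + 400 * (evalCost n 2 (P.q n) (P.a n) (P.r n) (τ.eval n) *
        (2048 * 2 ^ P.q n * 2 ^ P.a n + 1) * 2 ^ exponent 2 (P.q n) (P.a n)) ≤ T n) →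
      L ∈ BPTIME T := by
  obtain ⟨S, τ, hS⟩ := P.exists_machines
  let M : ProbTM := ((setup 5000 (some 0) (some 1) (some 2) (some 3) ;;
    coinTemplate 2048 : Mac (Var Name) S) ;; sample (.tmp2, 0) (.coins, 0) ;; answer none ;;
    reset).toProbTM
  refine ⟨τ, fun n => ?_, fun T hT => ⟨M, fun x => ?_⟩⟩
  · obtain ⟨acc, hle, -⟩ := hS (List.replicate n false)
    simpa using hle
  obtain ⟨acc, -, hk, hq, ha, hr, hacc⟩ := hS x
  obtain ⟨opt, hopt, hans⟩ := answer_runs_of_verifies (S := S) (i := none) 2 (P.q x.length)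
    (P.a x.length)
  set N := 2048 * 2 ^ P.q x.length * 2 ^ P.a x.length with hN
  set l : List Symb := (List.replicate N (none :: List.replicate (P.r x.length) one)).flatten with hl
  have hlen : l.length = N * (P.r x.length + 1) := by simp [hl]
  -- The strings read off from the coins; the default value of `getD` is never used for lists of the
  -- right length.
  let str (cs : List Bool) : List (Bits (P.r x.length)) := List.ofFn fun j : Fin N => fun i =>
    cs.getD (finProdFinEquiv (j.rev, i.rev.succ) : Fin (N * (P.r x.length + 1))) false
  have h₁ := setup_runs (c := 5000) (r := P.r x.length) hk hq ha hr
  have h₂ := coinTemplate_runs (S := S) (c := 2048) (q := P.q x.length) (a := P.a x.length)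
    (r := P.r x.length) (v := setupStk x (samples 5000 2 (P.a x.length)) 2 (P.q x.length)
      (P.a x.length) (P.r x.length)) (by simp [setupStk]) (by simp [setupStk]) (by simp [setupStk])
    (by simp [setupStk]) (by simp [setupStk]) (by simp [setupStk])
  rw [← hN, ← hl] at h₂
  set n₂ := 400 * (evalCost x.length 2 (P.q x.length) (P.a x.length) (P.r x.length)
    (τ.eval x.length) * (N + 1) * 2 ^ exponent 2 (P.q x.length) (P.a x.length)) +
    2 * (2 + P.q x.length + P.a x.length + P.r x.length) + 30 with hn₂
  have hB : ∀ cs : List Bool, cs.length = l.length → (answer none : Mac (Var Name) S).RunsTape []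
      (Function.update (Function.update (Function.update (setupStk x (samples 5000 2 (P.a x.length)) 2
        (P.q x.length) (P.a x.length) (P.r x.length)) (.tmp2, 0) l) (.tmp2, 0) []) (.coins, 0)
        ((List.zipWith (fun s c => Option.map (fun _ => (false, c)) s) l cs).reverse ++
        Function.update (setupStk x (samples 5000 2 (P.a x.length)) 2
        (P.q x.length) (P.a x.length) (P.r x.length)) (.tmp2, 0) l (.coins, 0)))
      [decide (Found (P.verdict x) opt (samples 5000 2 (P.a x.length)) (str cs))] (fun _ => []) n₂ := by
    intro cs hcs
    obtain ⟨c, rfl⟩ : ∃ c : Fin (N * (P.r x.length + 1)) → Bool, cs = List.ofFn c :=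
      ⟨fun i => cs[(i : ℕ)]'(by rw [hcs, hlen]; exact i.2), by
        refine List.ext_getElem (by simp [hcs, hlen]) fun i _ _ => by simp⟩
    have h₃ := hans (m := samples 5000 2 (P.a x.length)) (V := P.verdict x) (str (List.ofFn c))
      (fun y b w => (hacc y b w).1) (fun y b w => (hacc y b w).2) le_rfl
    have e := Iff.refl (Found (P.verdict x) opt (samples 5000 2 (P.a x.length)) (str (List.ofFn c)))
    nth_rewrite 1 [Found] at e
    rw [decide_eq_decide.2 e] at h₃
    refine h₃.conv ?_ rfl (le_of_eq ?_)
    · have hs : str (List.ofFn c) = List.ofFn fun j : Fin N => fun i : Fin (P.r x.length) =>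
          c (finProdFinEquiv (j.rev, i.rev.succ)) := by
        refine congrArg List.ofFn (funext fun j => funext fun i => ?_)
        rw [List.getD_eq_getElem _ _ (by rw [List.length_ofFn]; exact Fin.is_lt _),
          List.getElem_ofFn]
      rw [hs, ← reverse_zipWith_sample N (P.r x.length) c, ← hl]
      refine ext_on [(.tmp2, 0), (.coins, 0)] (by simp [setupStk]) fun X hX => ?_
      simp only [List.mem_cons, not_or, List.not_mem_nil, not_false_eq_true, and_true] at hX
      simp [hX]
    · simp only [hn₂, str, List.length_ofFn, unitCost, evalCost, exponent, pow_add]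
      ring
  obtain ⟨e, he, hout⟩ := haltsWith_sample (A := setup 5000 (some 0) (some 1) (some 2) (some 3) ;;
    coinTemplate 2048) (B := answer none) (D := (Name.tmp2, (0 : Fin 3))) (E := (Name.coins, 0))
    (by simp) (ans := fun cs => decide (Found (P.verdict x) opt (samples 5000 2 (P.a x.length))
      (str cs))) (l := l) (t := T x.length) (h₁.seq h₂) (by simp) hB (by
    refine le_trans (le_of_eq ?_) (hT x.length)
    rw [hlen, baseCost, ← hN]
    ring)
  have hstr : ∀ c : Bits (T x.length), str (List.ofFn fun j => c (e j)) =
      List.ofFn fun j : Fin N => fun i => c (e (Fin.cast hlen.symm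
        (finProdFinEquiv (j.rev, i.rev.succ)))) := by
    intro c
    refine congrArg List.ofFn (funext fun j => funext fun i => ?_)
    have hlt : ((finProdFinEquiv (j.rev, i.rev.succ) : Fin (N * (P.r x.length + 1))) : ℕ) <
        (List.ofFn fun j => c (e j)).length := by
      rw [List.length_ofFn, hlen]; exact Fin.is_lt _
    rw [List.getD_eq_getElem _ _ hlt, List.getElem_ofFn]
    rfl
  refine ⟨fun c => ⟨_, hout c⟩, ?_⟩
  -- The positions of the coins that enter the strings, without those spent on separators. They are
  -- distinct, so the sampled strings are independent and uniform.
  let e' : Fin N × Fin (P.r x.length) → Fin (T x.length) := fun p =>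
    e (Fin.cast hlen.symm (finProdFinEquiv (p.1.rev, p.2.rev.succ)))
  have he' : Function.Injective e' := fun p p' hp => by
    have := finProdFinEquiv.injective (Fin.cast_injective _ (he hp))
    simp only [Prod.mk.injEq, Fin.rev_inj, Fin.succ_inj] at this
    exact Prod.ext this.1 this.2
  have hgood := h.card_found_le x hopt hN
  have hcomp := card_filter_comp he' fun d => decide (Found (P.verdict x) opt
    (samples 5000 2 (P.a x.length)) (List.ofFn fun j i => d (j, i))) = decide (x ∈ L)
  have hsub : (univ.filter fun c : Bits (T x.length) => decide (Found (P.verdict x) opt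
      (samples 5000 2 (P.a x.length)) (List.ofFn fun j i => (c ∘ e') (j, i))) = decide (x ∈ L)) ⊆
      univ.filter fun c : Bits (T x.length) => M.HaltsWith x c (decide (x ∈ L)) := by
    intro c hc
    simp only [mem_filter, mem_univ, true_and] at hc ⊢
    rw [← hc]
    have := hout c
    rw [hstr] at this
    exact this
  have hcard := card_le_card hsub
  have hcur : (univ.filter fun d : Fin N × Fin (P.r x.length) → Bool =>
      decide (Found (P.verdict x) opt (samples 5000 2 (P.a x.length))
        (List.ofFn fun j i => d (j, i))) = decide (x ∈ L)).card =
      (univ.filter fun ω : Fin N → Bits (P.r x.length) =>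
        decide (Found (P.verdict x) opt (samples 5000 2 (P.a x.length)) (List.ofFn ω)) =
        decide (x ∈ L)).card :=
    card_equiv (Equiv.curry _ _ _) fun d => by
      simp only [mem_filter, mem_univ, true_and]
      rfl
  rw [hcur] at hcomp
  rw [le_div_iff₀ (by exact_mod_cast Fintype.card_pos)]
  refine le_trans ?_ (Nat.cast_le.2 hcard)
  have hc₁ : Fintype.card (Fin N → Bits (P.r x.length)) =
      2 ^ Fintype.card (Fin N × Fin (P.r x.length)) := by
    simp only [Fintype.card_fun, Fintype.card_bool, Fintype.card_fin, Fintype.card_prod, ← pow_mul]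
    rw [mul_comm]
  have hc₂ : Fintype.card (Bits (T x.length)) = 2 ^ T x.length := by simp
  rw [hc₁] at hgood
  rw [hc₂]
  have hmul := Nat.mul_le_mul_right (2 ^ T x.length) hgood
  rw [mul_assoc 3, ← hcomp] at hmul
  have hpos : 0 < 2 ^ Fintype.card (Fin N × Fin (P.r x.length)) := by positivity
  have hfin : 2 * 2 ^ T x.length ≤ 3 * (univ.filter fun c : Bits (T x.length) =>
      decide (Found (P.verdict x) opt (samples 5000 2 (P.a x.length))
        (List.ofFn fun j i => (c ∘ e') (j, i))) = decide (x ∈ L)).card := by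
    refine Nat.le_of_mul_le_mul_left ?_ hpos
    linarith
  have hfin' : (2 : ℚ) * 2 ^ T x.length ≤ 3 * ((univ.filter fun c : Bits (T x.length) =>
      decide (Found (P.verdict x) opt (samples 5000 2 (P.a x.length))
        (List.ofFn fun j i => (c ∘ e') (j, i))) = decide (x ∈ L)).card : ℚ) := by
    exact_mod_cast hfin
  push_cast
  linarith

end Randomized

/-! ### Polynomial bounds for the costs -/

section Bounds

/-- `f` is bounded by a polynomial. -/
def PolyBounded (f : ℕ → ℕ) : Prop := ∃ s : Polynomial ℕ, ∀ n, f n ≤ s.eval n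

theorem PolyBounded.const (c : ℕ) : PolyBounded fun _ => c := ⟨Polynomial.C c, fun n => by simp⟩

theorem PolyBounded.eval (s : Polynomial ℕ) : PolyBounded fun n => s.eval n := ⟨s, fun _ => le_rfl⟩

theorem PolyBounded.add {f g : ℕ → ℕ} (hf : PolyBounded f) (hg : PolyBounded g) :
    PolyBounded fun n => f n + g n := by
  obtain ⟨s, hs⟩ := hf
  obtain ⟨t, ht⟩ := hg
  exact ⟨s + t, fun n => by rw [Polynomial.eval_add]; exact Nat.add_le_add (hs n) (ht n)⟩

theorem PolyBounded.mul {f g : ℕ → ℕ} (hf : PolyBounded f) (hg : PolyBounded g) :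
    PolyBounded fun n => f n * g n := by
  obtain ⟨s, hs⟩ := hf
  obtain ⟨t, ht⟩ := hg
  exact ⟨s * t, fun n => by rw [Polynomial.eval_mul]; exact Nat.mul_le_mul (hs n) (ht n)⟩

variable {k q a r τ : ℕ → ℕ}

theorem polyBounded_samples (hk : PolyBounded k) (ha : PolyBounded a) :
    PolyBounded fun n => samples 5000 (k n) (a n) :=
  ((((PolyBounded.const 5000).mul ha).add (.const 5000)).mul hk).mul hk

theorem polyBounded_exponent (hk : PolyBounded k) (hq : PolyBounded q) (ha : PolyBounded a) :
    PolyBounded fun n => exponent (k n) (q n) (a n) :=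
  ((ha.mul hk).add (hq.mul hk)).add (hk.mul ((polyBounded_samples hk ha).mul (hk.mul (hq.add ha))))

theorem polyBounded_evalCost (hn : PolyBounded fun n => n) (hk : PolyBounded k) (hq : PolyBounded q)
    (ha : PolyBounded a) (hr : PolyBounded r) (hτ : PolyBounded τ) :
    PolyBounded fun n => evalCost n (k n) (q n) (a n) (r n) (τ n) :=
  (((hτ.add (((hn.add (.const 1)).add ((hq.add (.const 1)).mul hk)).add
    ((ha.add (.const 1)).mul hk))).add hr).add (.const 1)).mul
    ((hk.mul (polyBounded_samples hk ha)).add (.const 1))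

theorem polyBounded_baseCost (hn : PolyBounded fun n => n) (hk : PolyBounded k) (hq : PolyBounded q)
    (ha : PolyBounded a) (hr : PolyBounded r) (hτ : PolyBounded τ) :
    PolyBounded fun n => baseCost n (k n) (q n) (a n) (r n) (τ n) := by
  have hm := polyBounded_samples hk ha
  have hc := PolyBounded.const
  have h₁ : PolyBounded fun n => 200 * (5000 + 1) * (q n + a n + 1) * (k n + 1) * (k n + 1) :=
    (((hc _).mul ((hq.add ha).add (hc 1))).mul (hk.add (hc 1))).mul (hk.add (hc 1))
  have h₂ : PolyBounded fun n =>
      (((5 * (q n + a n) + 14) * k n + 20) * samples 5000 (k n) (a n) + 13) * k n :=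
    ((((((((hc 5).mul (hq.add ha)).add (hc 14)).mul hk).add (hc 20)).mul hm).add (hc 13)).mul hk)
  have h₃ : PolyBounded fun n => setupCost 5000 n (k n) (q n) (a n) (τ n + τ n + τ n + τ n) :=
    ((((h₁.add h₂).add ((hc 2).mul hm)).add ((hc 30).mul hn)).add
      (((hτ.add hτ).add hτ).add hτ)).add (hc 50)
  exact (h₃.add ((hc 2).mul (((hk.add hq).add ha).add hr))).add (hc 30)

theorem cost_le {c₁ c₂ c₃ u R X : ℕ} (hR : 1 ≤ R) (hX : 1 ≤ X) :
    c₁ + c₂ * R + c₃ + 400 * (u * (R + 1) * X) ≤ R * X * (c₁ + c₂ + c₃ + 800 * u) := by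
  have h₁ : 1 ≤ R * X := Nat.mul_pos hR hX
  have h₂ : R ≤ R * X := Nat.le_mul_of_pos_right _ hX
  have h₃ : u * (R + 1) * X ≤ 2 * (R * X * u) := by
    calc u * (R + 1) * X ≤ u * (R + R) * X := by gcongr
      _ = _ := by ring
  have h₄ : c₁ ≤ R * X * c₁ := Nat.le_mul_of_pos_left _ h₁
  have h₅ : c₂ * R ≤ R * X * c₂ := by rw [mul_comm]; gcongr
  have h₆ : c₃ ≤ R * X * c₃ := Nat.le_mul_of_pos_left _ h₁
  calc _ ≤ R * X * c₁ + R * X * c₂ + R * X * c₃ + 400 * (2 * (R * X * u)) := by gcongr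
    _ = _ := by ring

/-- The quadratic growth comes from the advice: O(a + 1) situations of 2(q + a) bits each. Linear
terms are absorbed by p ≤ p². -/
theorem exponent_two_le {q a p : ℕ} (hq : q ≤ p) (ha : a ≤ p) : exponent 2 q a ≤ 400000 * p ^ 2 := by
  have hp : p ≤ p ^ 2 := by nlinarith [Nat.zero_le p, Nat.le_self_pow (n := 2) (by norm_num) p]
  unfold exponent samples
  calc a * 2 + q * 2 + 2 * ((5000 * a + 5000) * 2 * 2 * (2 * (q + a)))
      ≤ p * 2 + p * 2 + 2 * ((5000 * p + 5000) * 2 * 2 * (2 * (p + p))) := by gcongr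
    _ = 160000 * p ^ 2 + 160004 * p := by ring
    _ ≤ _ := by omega

end Bounds

/-! ### The two assertions -/

section Main

variable {k : ℕ → ℕ} {P : AMProtocol k} {L : Language Bool}

theorem ParamsLE.polyBounded {τ : Polynomial ℕ} (h : ParamsLE P τ) : PolyBounded k ∧
    PolyBounded P.q ∧ PolyBounded P.a ∧ PolyBounded P.r ∧ PolyBounded fun n => n :=
  ⟨⟨τ, fun n => (h n).1⟩, ⟨τ, fun n => (h n).2.1⟩, ⟨τ, fun n => (h n).2.2.1⟩,
    ⟨τ, fun n => (h n).2.2.2.1⟩, ⟨τ, fun n => (h n).2.2.2.2⟩⟩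

theorem AMProtocol.Decides.mem_DTIME (h : P.Decides L) : ∃ s : Polynomial ℕ, ∀ T : ℕ → ℕ,
    (∀ n, 2 ^ P.r n * 2 ^ exponent (k n) (P.q n) (P.a n) * s.eval n ≤ T n) → L ∈ DTIME T := by
  obtain ⟨τ, hτ, hL⟩ := exists_mem_DTIME P h
  obtain ⟨hk, hq, ha, hr, hn⟩ := hτ.polyBounded
  have hτ' := PolyBounded.eval τ
  obtain ⟨s, hs⟩ := (((polyBounded_baseCost hn hk hq ha hr hτ').add
    (((PolyBounded.const 9).mul hr).add (.const 7))).add (.const 3)).add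
    ((PolyBounded.const 800).mul (polyBounded_evalCost hn hk hq ha hr hτ'))
  refine ⟨s, fun T hT => hL T fun n => le_trans ?_ (hT n)⟩
  exact (cost_le (Nat.one_le_two_pow) (Nat.one_le_two_pow)).trans (Nat.mul_le_mul_left _ (hs n))

theorem AMProtocol.Decides.mem_BPTIME {P : AMProtocol fun _ => 2} (h : P.Decides L) :
    ∃ s : Polynomial ℕ, ∀ T : ℕ → ℕ,
    (∀ n, 2 ^ P.q n * 2 ^ P.a n * 2 ^ exponent 2 (P.q n) (P.a n) * s.eval n ≤ T n) →
      L ∈ BPTIME T := by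
  obtain ⟨τ, hτ, hL⟩ := exists_mem_BPTIME h
  obtain ⟨hk, hq, ha, hr, hn⟩ := hτ.polyBounded
  have hτ' := PolyBounded.eval τ
  have hc := PolyBounded.const
  obtain ⟨s, hs⟩ := (hc 2048).mul ((((polyBounded_baseCost hn hk hq ha hr hτ').add
    (((((hc 9).mul hq).add ((hc 9).mul ha)).add ((hc 6).mul hr)).add (hc 12))).add
    ((((hc 8).mul hq).add ((hc 8).mul ha)).add (hc 2058))).add
    ((hc 800).mul (polyBounded_evalCost hn hk hq ha hr hτ')))
  refine ⟨s, fun T hT => hL T fun n => le_trans ?_ (hT n)⟩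
  have := (cost_le (c₁ := baseCost n 2 (P.q n) (P.a n) (P.r n) (τ.eval n))
    (c₂ := 9 * P.q n + 9 * P.a n + 6 * P.r n + 12) (c₃ := 8 * P.q n + 8 * P.a n + 2058)
    (u := evalCost n 2 (P.q n) (P.a n) (P.r n) (τ.eval n)) (R := 2048 * 2 ^ P.q n * 2 ^ P.a n)
    (X := 2 ^ exponent 2 (P.q n) (P.a n)) (Nat.succ_le_of_lt (by positivity)) Nat.one_le_two_pow)
  refine le_trans (le_of_eq (by ring)) (this.trans ?_)
  calc _ = 2 ^ P.q n * 2 ^ P.a n * 2 ^ exponent 2 (P.q n) (P.a n) * (2048 *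
        (baseCost n 2 (P.q n) (P.a n) (P.r n) (τ.eval n) + (9 * P.q n + 9 * P.a n + 6 * P.r n + 12) +
        (8 * P.q n + 8 * P.a n + 2058) +
        800 * evalCost n 2 (P.q n) (P.a n) (P.r n) (τ.eval n))) := by ring
    _ ≤ _ := Nat.mul_le_mul_left _ (hs n)

/-- A protocol with `k` Merlins forces `k` to be polynomially bounded, so all exponents are
polynomial; the polynomial factor is absorbed by s ≤ 2^s. -/
theorem AM_subset_EXP (k : ℕ → ℕ) : AM k ⊆ EXP := by
  rintro L ⟨P, h⟩
  obtain ⟨τ, hτ, -⟩ := exists_mem_DTIME P h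
  obtain ⟨hk, hq, ha, hr, -⟩ := hτ.polyBounded
  obtain ⟨s, hs⟩ := h.mem_DTIME
  obtain ⟨t, ht⟩ := (hr.add (polyBounded_exponent hk hq ha)).add (PolyBounded.eval s)
  refine ⟨t, hs _ fun n => ?_⟩
  calc 2 ^ P.r n * 2 ^ exponent (k n) (P.q n) (P.a n) * s.eval n
      ≤ 2 ^ P.r n * 2 ^ exponent (k n) (P.q n) (P.a n) * 2 ^ s.eval n := by
        gcongr; exact Nat.lt_two_pow_self.le
    _ = 2 ^ (P.r n + exponent (k n) (P.q n) (P.a n) + s.eval n) := by rw [pow_add, pow_add]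
    _ ≤ _ := Nat.pow_le_pow_right (by norm_num) (ht n)

end Main

end

theorem mainTheorem12 :
    -- `AM(k) ⊆ EXP`
    (∀ k : ℕ → ℕ, AM k ⊆ EXP) ∧
    -- two Merlins, all messages of at most `p(n)` bits, `r(n)` auxiliary random bits:
    -- deterministic time `2^{O(p(n)^2) + r(n)} poly(n)`, randomized time `2^{O(p(n)^2)} poly(n)`
    (∃ C : ℕ, ∀ (P : AMProtocol fun _ => 2) (p : ℕ → ℕ) (L : Language Bool),
      (∀ n, P.q n ≤ p n ∧ P.a n ≤ p n) → P.Decides L →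
      ∃ s : Polynomial ℕ,
        L ∈ DTIME (fun n => 2 ^ (C * p n ^ 2 + P.r n) * s.eval n) ∧
        L ∈ BPTIME (fun n => 2 ^ (C * p n ^ 2) * s.eval n)) := by
  -- The search contributes 400000. The additional 2 pays for the factor 2^q·2^a in the number of
  -- sampled strings, as q + a ≤ 2p².
  refine ⟨AM_subset_EXP, 400002, fun P p L hp h => ?_⟩
  obtain ⟨s, hs⟩ := h.mem_DTIME
  obtain ⟨t, ht⟩ := h.mem_BPTIME
  refine ⟨s + t, hs _ fun n => ?_, ht _ fun n => ?_⟩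
  · have := exponent_two_le (hp n).1 (hp n).2
    rw [← pow_add, Polynomial.eval_add]
    refine Nat.mul_le_mul (Nat.pow_le_pow_right (by norm_num) ?_) (Nat.le_add_right _ _)
    omega
  · have := exponent_two_le (hp n).1 (hp n).2
    have hp2 : p n ≤ p n ^ 2 := Nat.le_self_pow (by norm_num) _
    have := hp n
    rw [← pow_add, ← pow_add, Polynomial.eval_add]
    refine Nat.mul_le_mul (Nat.pow_le_pow_right (by norm_num) ?_) (Nat.le_add_left _ _)
    omega
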